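/- Let $M=(S(V),d)$ be a minimal Sullivan algebra over $\mathbb{R}$ of strong finite type: $V=\bigoplus_{n>0}V^n$ is a graded real vector space of finite total dimension, $S(V)$ is the free graded commutative algebra on $V$, and $d$ is a differential of degree $1$ satisfying the Sullivan nilpotence condition and $d(M)\subseteq M^+\cdot M^+$, where $M^+=\bigoplus_{n>0}M^n$. (For example, $M=M(Z)$ is the real Sullivan minimal model of a path-connected nilpotent space $Z$.) Let $V[1]$ be the truncated desuspension, $V[1]^n=V^{n+1}$ for $n>0$ and $V[1]^n=0$ for $n\le 0$, let $s\colon V\to V[1]$ be the natural surjection of degree $-1$ with kernel $V^1$, and let $w$ be a generator of degree $2$. The cyclification of $M$ is the minimal Sullivan algebra $M_c=(S(V\oplus V[1]\oplus\mathbb{R}w),d_c)$ with $$d_c v=dv+sv\cdot w,\qquad d_c(sv)=-s(dv),\qquad d_c w=0\qquad (v\in V),$$ where $s$ is extended to the derivation of degree $-1$ that vanishes on $V[1]$ and $w$. (If $M=M(Z)$, then $M_c=M(\mathcal{L}_cZ)$ is the model of the cyclic loop space $\mathcal{L}_cZ$.) For a minimal Sullivan algebra $N$ with differential $d_N$, put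 $P(N)=Z(N^+)/\bigl(Z(N^+)\cap (N^+)^2\bigr)$ with $Z(N^+)=\ker d_N|_{N^+}$, and let $\operatorname{Aut}N$ be the algebraic group over $\mathbb{R}$ of automorphisms of $N$ as a differential graded commutative algebra; its $A$-points are the automorphisms of the differential graded $A$-algebra $A\otimes_{\mathbb{R}}N$. An $\mathbb{R}$-split torus of dimension $n\ge 0$ is an algebraic group isomorphic to $\mathbb{G}_m^n$ over $\mathbb{R}$. **Theorem (maximal split tori of the Sullivan model of a cyclification).** Suppose that $d$ is quadratic, i.e. $d(V)\subseteq S^2(V)$, and that there is an $\mathbb{R}$-split torus $T\subseteq\operatorname{Aut}M$ with $\dim T=\dim P(M)$. Then: 1. $T$ is a maximal $\mathbb{R}$-split torus of $\operatorname{Aut}M$. 2. $\dim\bigl(\ker d_c\cap(V\oplus V[1]\oplus\mathbb{R}w)\bigr)=\dim(\ker d\cap V)+1$, and $\dim P(M_c)=\dim P(M)+1=\dim(T\times\mathbb{G}_m)$. 3. There is a natural inclusion of algebraic groups $\operatorname{Aut}M\times\mathbb{G}_m\subseteq\operatorname{Aut}M_c$, in which $(g,t)$ acts by $v\mapsto gv$,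 $sv\mapsto t\,s(gv)$ for $v\in V$, and $w\mapsto t^{-1}w$. Under this inclusion, $T\times\mathbb{G}_m$ is an $\mathbb{R}$-split torus of dimension $\dim T+1$ and a maximal $\mathbb{R}$-split torus of $\operatorname{Aut}M_c$. -/

import Mathlib

open scoped TensorProduct

namespace Sullivan

universe u

/-! ### Free graded commutative algebras -/

section Free

variable {V : Type u} [AddCommGroup V] [Module ℝ V]

/-- The relations `x y = (-1)^(|x||y|) y x` for homogeneous elements `x`, `y` of `V`. -/
inductive GCRel (gr : ℕ → Submodule ℝ V) : TensorAlgebra ℝ V → TensorAlgebra ℝ V → Prop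
  | comm {m n : ℕ} {x y : V} (hx : x ∈ gr m) (hy : y ∈ gr n) :
      GCRel gr (TensorAlgebra.ι ℝ x * TensorAlgebra.ι ℝ y)
        ((-1 : ℝ) ^ (m * n) • (TensorAlgebra.ι ℝ y * TensorAlgebra.ι ℝ x))

/-- The free graded commutative algebra `S(V)` on a graded real vector space `V`. -/
def FreeGC (gr : ℕ → Submodule ℝ V) : Type u := RingQuot (GCRel gr)

/-- `V` is the direct sum of its graded parts, and is concentrated in positive degrees. -/
structure IsGrading (gr : ℕ → Submodule ℝ V) : Prop where
  internal : DirectSum.IsInternal gr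
  zero : gr 0 = ⊥

theorem IsGrading.iSup_eq {gr : ℕ → Submodule ℝ V} (h : IsGrading gr) : ⨆ n, gr n = ⊤ :=
  h.internal.submodule_iSup_eq_top

namespace FreeGC

variable (gr : ℕ → Submodule ℝ V)

instance : Ring (FreeGC gr) := inferInstanceAs (Ring (RingQuot (GCRel gr)))

instance : Algebra ℝ (FreeGC gr) := inferInstanceAs (Algebra ℝ (RingQuot (GCRel gr)))

/-- The inclusion of the generators `V` in `S(V)`. -/
def ι : V →ₗ[ℝ] FreeGC gr :=
  (RingQuot.mkAlgHom ℝ (GCRel gr)).toLinearMap ∘ₗ TensorAlgebra.ι ℝ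

variable {gr}

theorem ι_comm {m n : ℕ} {x y : V} (hx : x ∈ gr m) (hy : y ∈ gr n) :
    ι gr x * ι gr y = (-1 : ℝ) ^ (m * n) • (ι gr y * ι gr x) := by
  have h := RingQuot.mkAlgHom_rel ℝ (GCRel.comm hx hy)
  rw [map_smul, map_mul, map_mul] at h
  exact h

variable {B : Type*} [Ring B] [Algebra ℝ B]

/-- The universal property of `S(V)`. -/
def lift (f : V →ₗ[ℝ] B)
    (hf : ∀ (m n : ℕ) (x y : V), x ∈ gr m → y ∈ gr n →
      f x * f y = (-1 : ℝ) ^ (m * n) • (f y * f x)) : FreeGC gr →ₐ[ℝ] B :=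
  RingQuot.liftAlgHom ℝ ⟨TensorAlgebra.lift ℝ f, by
    rintro _ _ ⟨hx, hy⟩
    simpa using hf _ _ _ _ hx hy⟩

theorem lift_ι (f : V →ₗ[ℝ] B)
    (hf : ∀ (m n : ℕ) (x y : V), x ∈ gr m → y ∈ gr n →
      f x * f y = (-1 : ℝ) ^ (m * n) • (f y * f x)) (v : V) :
    lift f hf (ι gr v) = f v := by
  have : lift f hf (ι gr v) = TensorAlgebra.lift ℝ f (TensorAlgebra.ι ℝ v) :=
    RingQuot.liftAlgHom_mkAlgHom_apply ℝ _ _ _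
  rw [this, TensorAlgebra.lift_ι_apply]

variable (gr) in
/-- The degree `n` part of `S(V)`: the span of the products of homogeneous generators
whose degrees add up to `n`. -/
def deg (n : ℕ) : Submodule ℝ (FreeGC gr) :=
  Submodule.span ℝ {x | ∃ l : List (ℕ × V), (∀ p ∈ l, p.2 ∈ gr p.1) ∧
    (l.map Prod.fst).sum = n ∧ (l.map fun p => ι gr p.2).prod = x}

variable (gr) in
/-- `S(V)⁺`, the sum of the parts of positive degree. -/
def plus : Submodule ℝ (FreeGC gr) := ⨆ n : ℕ, deg gr (n + 1)

theorem one_mem_deg : (1 : FreeGC gr) ∈ deg gr 0 :=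
  Submodule.subset_span ⟨[], by simp⟩

theorem ι_mem_deg {n : ℕ} {v : V} (hv : v ∈ gr n) : ι gr v ∈ deg gr n :=
  Submodule.subset_span ⟨[(n, v)], by simpa using hv⟩

theorem mul_mem_deg {m n : ℕ} {x y : FreeGC gr} (hx : x ∈ deg gr m) (hy : y ∈ deg gr n) :
    x * y ∈ deg gr (m + n) := by
  have h := Submodule.mul_mem_mul hx hy
  rw [deg, deg, Submodule.span_mul_span] at h
  refine Submodule.span_mono ?_ h
  rintro _ ⟨_, ⟨l, hl, rfl, rfl⟩, _, ⟨k, hk, rfl, rfl⟩, rfl⟩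
  refine ⟨l ++ k, ?_, by simp, by simp⟩
  intro p hp
  rcases List.mem_append.1 hp with h | h
  exacts [hl p h, hk p h]

/-- Induction on a homogeneous element of `S(V)`. -/
theorem deg_induction {p : ℕ → FreeGC gr → Prop}
    (one : p 0 1)
    (ι_mul : ∀ (a b : ℕ) (v : V) (y : FreeGC gr), v ∈ gr a → y ∈ deg gr b → p b y →
      p (a + b) (ι gr v * y))
    (zero : ∀ n, p n 0)
    (add : ∀ n x y, p n x → p n y → p n (x + y))
    (smul : ∀ n (r : ℝ) x, p n x → p n (r • x))
    {n : ℕ} {x : FreeGC gr} (hx : x ∈ deg gr n) : p n x := by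
  induction hx using Submodule.span_induction with
  | zero => exact zero n
  | add x y _ _ hx hy => exact add _ _ _ hx hy
  | smul r x _ hx => exact smul _ _ _ hx
  | mem x h =>
    obtain ⟨l, hl, rfl, rfl⟩ := h
    induction l with
    | nil => simpa using one
    | cons q l ih =>
      have hl' : ∀ p ∈ l, p.2 ∈ gr p.1 := fun p hp => hl p (List.mem_cons_of_mem _ hp)
      simp only [List.map_cons, List.sum_cons, List.prod_cons]
      exact ι_mul _ _ _ _ (hl q (by simp)) (Submodule.subset_span ⟨l, hl', rfl, rfl⟩) (ih hl')

theorem comm_deg {m n : ℕ} {x y : FreeGC gr} (hx : x ∈ deg gr m) (hy : y ∈ deg gr n) :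
    x * y = (-1 : ℝ) ^ (m * n) • (y * x) := by
  have key : ∀ {a : ℕ} {v : V}, v ∈ gr a → ∀ {k : ℕ} {z : FreeGC gr}, z ∈ deg gr k →
      ι gr v * z = (-1 : ℝ) ^ (a * k) • (z * ι gr v) := by
    intro a v hv k z hz
    refine deg_induction (p := fun k z => ι gr v * z = (-1 : ℝ) ^ (a * k) • (z * ι gr v))
      ?_ ?_ ?_ ?_ ?_ hz
    · simp
    · intro c b u y hu hy ih
      rw [← mul_assoc, ι_comm hv hu, smul_mul_assoc, mul_assoc, ih, mul_smul_comm, smul_smul,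
        ← mul_assoc, ← pow_add, mul_add]
    · simp
    · intro _ x y hx hy
      rw [mul_add, add_mul, smul_add, hx, hy]
    · intro n r x hx
      rw [mul_smul_comm, hx, smul_mul_assoc, smul_comm]
  refine deg_induction (p := fun m x => x * y = (-1 : ℝ) ^ (m * n) • (y * x))
    ?_ ?_ ?_ ?_ ?_ hx
  · simp
  · intro a b v z hv hz ih
    rw [mul_assoc, ih, mul_smul_comm, ← mul_assoc, key hv hy, smul_mul_assoc, smul_smul,
      mul_assoc, ← pow_add, add_mul, add_comm]
  · simp
  · intro n x z hx hz
    rw [mul_add, add_mul, smul_add, hx, hz]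
  · intro n r x hx
    rw [mul_smul_comm, smul_mul_assoc, hx, smul_comm]

theorem iSup_deg (h : ⨆ n, gr n = ⊤) : ⨆ n, deg gr n = ⊤ := by
  have hι : ∀ v, ι gr v ∈ ⨆ n, deg gr n := by
    intro v
    have hv : v ∈ ⨆ n, gr n := h ▸ Submodule.mem_top
    have : (⨆ n, gr n) ≤ (⨆ n, deg gr n).comap (ι gr) :=
      iSup_le fun n x hx => Submodule.mem_iSup_of_mem n (ι_mem_deg hx)
    exact this hv
  have hmul : ∀ x ∈ ⨆ n, deg gr n, ∀ y ∈ ⨆ n, deg gr n, x * y ∈ ⨆ n, deg gr n := by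
    intro x hx y hy
    have := Submodule.mul_mem_mul hx hy
    rw [Submodule.iSup_mul] at this
    refine (iSup_le fun m => ?_ : _ ≤ ⨆ n, deg gr n) this
    rw [Submodule.mul_iSup]
    refine iSup_le fun n => ?_
    rw [Submodule.mul_le]
    exact fun a ha b hb => Submodule.mem_iSup_of_mem _ (mul_mem_deg ha hb)
  rw [eq_top_iff]
  rintro x -
  obtain ⟨t, rfl⟩ := RingQuot.mkAlgHom_surjective ℝ (GCRel gr) x
  induction t using TensorAlgebra.induction with
  | algebraMap r =>
    rw [AlgHom.commutes, Algebra.algebraMap_eq_smul_one]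
    exact Submodule.smul_mem _ _ (Submodule.mem_iSup_of_mem 0 one_mem_deg)
  | ι v => exact hι v
  | mul a b ha hb => rw [map_mul]; exact hmul _ ha _ hb
  | add a b ha hb => rw [map_add]; exact Submodule.add_mem _ ha hb

theorem induction_on (h : ⨆ n, gr n = ⊤) {p : FreeGC gr → Prop}
    (hp : ∀ n, ∀ x ∈ deg gr n, p x) (add : ∀ x y, p x → p y → p (x + y)) (x : FreeGC gr) :
    p x := by
  have hx : x ∈ ⨆ n, deg gr n := iSup_deg h ▸ Submodule.mem_top
  exact Submodule.iSup_induction _ (motive := p) hx hp (hp 0 0 (Submodule.zero_mem _)) add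

theorem mul_mem_plus_left (h : ⨆ n, gr n = ⊤) (x : FreeGC gr) {y : FreeGC gr}
    (hy : y ∈ plus gr) : x * y ∈ plus gr := by
  induction x using induction_on h with
  | add a b ha hb => rw [add_mul]; exact Submodule.add_mem _ ha hb
  | hp m x hx =>
    have : plus gr ≤ (plus gr).comap (LinearMap.mulLeft ℝ x) :=
      iSup_le fun n z hz => Submodule.mem_iSup_of_mem (m + n) (by
        have := mul_mem_deg hx hz
        rwa [← add_assoc] at this)
    exact this hy

theorem mul_mem_plus_right (h : ⨆ n, gr n = ⊤) (x : FreeGC gr) {y : FreeGC gr}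
    (hy : y ∈ plus gr) : y * x ∈ plus gr := by
  induction x using induction_on h with
  | add a b ha hb => rw [mul_add]; exact Submodule.add_mem _ ha hb
  | hp m x hx =>
    have : plus gr ≤ (plus gr).comap (LinearMap.mulRight ℝ x) :=
      iSup_le fun n z hz => Submodule.mem_iSup_of_mem (n + m) (by
        have := mul_mem_deg hz hx
        rwa [add_right_comm] at this)
    exact this hy

theorem ι_mem_plus (h : ⨆ n, gr n = ⊤) (h0 : gr 0 = ⊥) (v : V) : ι gr v ∈ plus gr := by
  have hv : v ∈ ⨆ n, gr n := h ▸ Submodule.mem_top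
  have : (⨆ n, gr n) ≤ (plus gr).comap (ι gr) := by
    refine iSup_le fun n => ?_
    cases n with
    | zero => rw [h0]; exact bot_le
    | succ n => exact fun x hx => Submodule.mem_iSup_of_mem n (ι_mem_deg hx)
  exact this hv

/-- The linear map on `V` that is `f n` on the part of degree `n`. -/
noncomputable def fromGr (h : IsGrading gr) {C : Type*} [AddCommGroup C] [Module ℝ C]
    (f : ℕ → V →ₗ[ℝ] C) : V →ₗ[ℝ] C :=
  DirectSum.toModule ℝ ℕ C (fun n => f n ∘ₗ (gr n).subtype) ∘ₗ
    (LinearEquiv.ofBijective (DirectSum.coeLinearMap gr) h.internal).symm.toLinearMap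

theorem fromGr_apply (h : IsGrading gr) {C : Type*} [AddCommGroup C] [Module ℝ C]
    (f : ℕ → V →ₗ[ℝ] C) {n : ℕ} {v : V} (hv : v ∈ gr n) : fromGr h f v = f n v := by
  have : (LinearEquiv.ofBijective (DirectSum.coeLinearMap gr) h.internal).symm v =
      DirectSum.lof ℝ ℕ (fun n => gr n) n ⟨v, hv⟩ := by
    rw [LinearEquiv.symm_apply_eq]
    exact (DirectSum.coeLinearMap_lof gr n ⟨v, hv⟩).symm
  simp [fromGr, this]

/-- The parity involution of `S(V)`, equal to `(-1)^n` on the part of degree `n`. -/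
noncomputable def par (h : IsGrading gr) : FreeGC gr →ₐ[ℝ] FreeGC gr :=
  lift (fromGr h fun n => (-1 : ℝ) ^ n • ι gr) (by
    intro m n x y hx hy
    rw [fromGr_apply h _ hx, fromGr_apply h _ hy]
    simp only [LinearMap.smul_apply, smul_mul_smul_comm]
    rw [ι_comm hx hy, smul_comm, mul_comm ((-1 : ℝ) ^ m)])

theorem par_ι (h : IsGrading gr) {n : ℕ} {v : V} (hv : v ∈ gr n) :
    par h (ι gr v) = (-1 : ℝ) ^ n • ι gr v := by
  rw [par, lift_ι, fromGr_apply h _ hv]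
  rfl

theorem par_deg (h : IsGrading gr) {n : ℕ} {x : FreeGC gr} (hx : x ∈ deg gr n) :
    par h x = (-1 : ℝ) ^ n • x := by
  refine deg_induction (p := fun n x => par h x = (-1 : ℝ) ^ n • x) ?_ ?_ ?_ ?_ ?_ hx
  · simp
  · intro a b v y hv hy ih
    rw [map_mul, ih, par_ι h hv, smul_mul_smul_comm, pow_add]
  · simp
  · intro n x y hx hy
    rw [map_add, hx, hy, smul_add]
  · intro n r x hx
    rw [map_smul, hx, smul_comm]

theorem par_par (h : IsGrading gr) (x : FreeGC gr) : par h (par h x) = x := by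
  induction x using induction_on h.iSup_eq with
  | add a b ha hb => rw [map_add, map_add, ha, hb]
  | hp n x hx =>
    rw [par_deg h hx, map_smul, par_deg h hx, smul_smul, ← mul_pow]
    simp

/-! ### Odd derivations -/

/-- `δ` changes the parity of homogeneous generators. -/
def IsOdd (δ : V →ₗ[ℝ] FreeGC gr) : Prop :=
  ∀ (n : ℕ) (v : V), v ∈ gr n → ∃ k, Even (k + n + 1) ∧ δ v ∈ deg gr k

theorem IsOdd.comm {δ : V →ₗ[ℝ] FreeGC gr} (hδ : IsOdd δ) {m n : ℕ} {x : FreeGC gr} {v : V}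
    (hx : x ∈ deg gr m) (hv : v ∈ gr n) :
    x * δ v = (-1 : ℝ) ^ (m * (n + 1)) • (δ v * x) := by
  obtain ⟨k, hk, h⟩ := hδ n v hv
  rw [comm_deg hx h]
  congr 1
  rcases Nat.even_or_odd m with hm | hm
  · rw [(hm.mul_right _).neg_one_pow, (hm.mul_right _).neg_one_pow]
  · rw [pow_mul, pow_mul, hm.neg_one_pow, neg_one_pow_congr]
    rw [add_assoc] at hk
    exact Nat.even_add.1 hk

/-- The algebra map `x ↦ (σ(x), D(x); 0, x)` whose off-diagonal entry is the odd derivation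
extending `δ`. -/
noncomputable def derHom (h : IsGrading gr) (δ : V →ₗ[ℝ] FreeGC gr) (hδ : IsOdd δ) :
    FreeGC gr →ₐ[ℝ] Matrix (Fin 2) (Fin 2) (FreeGC gr) :=
  lift
    { toFun := fun v => !![par h (ι gr v), δ v; 0, ι gr v]
      map_add' := fun v w => by
        ext i j; fin_cases i <;> fin_cases j <;> simp
      map_smul' := fun r v => by
        ext i j; fin_cases i <;> fin_cases j <;> simp }
    (by
      intro m n x y hx hy
      simp only [LinearMap.coe_mk, AddHom.coe_mk, par_ι h hx, par_ι h hy, Matrix.mul_fin_two]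
      have h1 := hδ.comm (ι_mem_deg hx) hy
      have h2 := hδ.comm (ι_mem_deg hy) hx
      ext i j
      fin_cases i <;> fin_cases j
      · simp only [Fin.zero_eta, Matrix.of_apply, Matrix.cons_val', Matrix.cons_val_zero,
          Matrix.smul_apply, mul_zero, add_zero, smul_mul_smul_comm]
        rw [ι_comm hx hy, smul_comm, mul_comm ((-1 : ℝ) ^ n)]
      · simp only [Fin.zero_eta, Matrix.of_apply, Matrix.cons_val', Matrix.cons_val_zero,
          Matrix.smul_apply, Fin.mk_one, Matrix.cons_val_one, smul_mul_assoc, smul_add, h1, h2,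
          smul_smul]
        rw [add_comm]
        congr 1
        · rw [← pow_add, ← pow_add,
            show m * n + (n + n * (m + 1)) = 2 * (m * n + n) by ring, pow_mul]
          simp
        · rw [← pow_add, show m + m * (n + 1) = 2 * m + m * n by ring, pow_add, pow_mul]
          simp
      · simp
      · simpa using ι_comm hx hy)

/-- The unique odd derivation of `S(V)` that extends `δ`. -/
noncomputable def oddDer (h : IsGrading gr) (δ : V →ₗ[ℝ] FreeGC gr) (hδ : IsOdd δ) :
    FreeGC gr →ₗ[ℝ] FreeGC gr where
  toFun x := derHom h δ hδ x 0 1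
  map_add' x y := by simp
  map_smul' r x := by simp

variable (h : IsGrading gr) (δ : V →ₗ[ℝ] FreeGC gr) (hδ : IsOdd δ)

theorem oddDer_ι (v : V) : oddDer h δ hδ (ι gr v) = δ v := by
  simp [oddDer, derHom, lift_ι]

theorem derHom_eq (x : FreeGC gr) :
    derHom h δ hδ x = !![par h x, oddDer h δ hδ x; 0, x] := by
  induction x using induction_on h.iSup_eq with
  | add a b ha hb =>
    rw [map_add, ha, hb]
    ext i j; fin_cases i <;> fin_cases j <;> simp
  | hp n x hx =>
    refine deg_induction (p := fun _ x => derHom h δ hδ x = !![par h x, oddDer h δ hδ x; 0, x])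
      ?_ ?_ ?_ ?_ ?_ hx
    · ext i j; fin_cases i <;> fin_cases j <;> simp [oddDer]
    · intro a b v y hv hy ih
      have hv : derHom h δ hδ (ι gr v) =
          !![par h (ι gr v), oddDer h δ hδ (ι gr v); 0, ι gr v] := by
        rw [oddDer_ι, derHom, lift_ι]
        rfl
      have h01 : oddDer h δ hδ (ι gr v * y) = derHom h δ hδ (ι gr v * y) 0 1 := rfl
      rw [h01, map_mul, map_mul, ih, hv]
      ext i j; fin_cases i <;> fin_cases j <;> simp
    · intro n
      ext i j; fin_cases i <;> fin_cases j <;> simp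
    · intro n x y hx hy
      rw [map_add, hx, hy]
      ext i j; fin_cases i <;> fin_cases j <;> simp
    · intro n r x hx
      rw [map_smul, hx]
      ext i j; fin_cases i <;> fin_cases j <;> simp

theorem oddDer_mul (x y : FreeGC gr) :
    oddDer h δ hδ (x * y) = oddDer h δ hδ x * y + par h x * oddDer h δ hδ y := by
  have h01 : oddDer h δ hδ (x * y) = derHom h δ hδ (x * y) 0 1 := rfl
  rw [h01, map_mul, derHom_eq, derHom_eq]
  simp [add_comm]

theorem oddDer_one : oddDer h δ hδ 1 = 0 := by
  simpa using oddDer_mul h δ hδ 1 1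

/-- A linear map that satisfies a product rule and vanishes on generators is zero. -/
theorem eq_zero_of_ι {gr : ℕ → Submodule ℝ V} (h : IsGrading gr)
    {E : FreeGC gr →ₗ[ℝ] FreeGC gr} {f g : FreeGC gr → FreeGC gr}
    (h1 : E 1 = 0) (hι : ∀ v, E (ι gr v) = 0)
    (hE : ∀ x y, E (x * y) = E x * f y + g x * E y) (x : FreeGC gr) : E x = 0 := by
  induction x using induction_on h.iSup_eq with
  | add a b ha hb => rw [map_add, ha, hb, add_zero]
  | hp n x hx =>
    refine deg_induction (p := fun _ x => E x = 0) h1 ?_ ?_ ?_ ?_ hx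
    · intro a b v y hv hy ih
      rw [hE, hι, ih, zero_mul, mul_zero, add_zero]
    · simp
    · intro n x y hx hy
      rw [map_add, hx, hy, add_zero]
    · intro n r x hx
      rw [map_smul, hx, smul_zero]

theorem oddDer_par (x : FreeGC gr) :
    oddDer h δ hδ (par h x) = - par h (oddDer h δ hδ x) := by
  have key := eq_zero_of_ι h
    (E := oddDer h δ hδ ∘ₗ (par h).toLinearMap + (par h).toLinearMap ∘ₗ oddDer h δ hδ)
    (f := fun y => par h y) (g := fun x => x) ?_ ?_ ?_ x
  · simpa [add_eq_zero_iff_eq_neg] using key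
  · simp [oddDer_one]
  · intro v
    have hv : v ∈ ⨆ n, gr n := h.iSup_eq ▸ Submodule.mem_top
    induction hv using Submodule.iSup_induction' with
    | zero => simp
    | add a b _ _ ha hb => rw [map_add, map_add, ha, hb, add_zero]
    | mem n v hv =>
      obtain ⟨k, hk, hd⟩ := hδ n v hv
      simp only [LinearMap.add_apply, LinearMap.comp_apply, AlgHom.toLinearMap_apply, par_ι h hv,
        map_smul, oddDer_ι, par_deg h hd, ← add_smul]
      suffices hs : (-1 : ℝ) ^ n + (-1) ^ k = 0 by rw [hs, zero_smul]
      rcases Nat.even_or_odd n with hn | hn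
      · have : Odd k := by
          by_contra hc
          rw [Nat.not_odd_iff_even] at hc
          exact (Nat.not_even_iff_odd.2 (hc.add hn).add_one) hk
        rw [hn.neg_one_pow, this.neg_one_pow]; norm_num
      · have : Even k := by
          by_contra hc
          rw [Nat.not_even_iff_odd] at hc
          exact (Nat.not_even_iff_odd.2 (hc.add_odd hn).add_one) hk
        rw [hn.neg_one_pow, this.neg_one_pow]; norm_num
  · intro x y
    simp only [LinearMap.add_apply, LinearMap.comp_apply, AlgHom.toLinearMap_apply, map_mul,
      oddDer_mul, map_add, par_par]
    noncomm_ring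

/-- Odd derivations anticommute if they do so on generators. -/
theorem oddDer_anticomm (ε : V →ₗ[ℝ] FreeGC gr) (hε : IsOdd ε)
    (hι : ∀ v, oddDer h δ hδ (ε v) + oddDer h ε hε (δ v) = 0) (x : FreeGC gr) :
    oddDer h δ hδ (oddDer h ε hε x) + oddDer h ε hε (oddDer h δ hδ x) = 0 := by
  have key := eq_zero_of_ι h
    (E := oddDer h δ hδ ∘ₗ oddDer h ε hε + oddDer h ε hε ∘ₗ oddDer h δ hδ)
    (f := fun y => y) (g := fun x => x) ?_ ?_ ?_ x
  · simpa using key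
  · simp [oddDer_one]
  · intro v
    simpa [oddDer_ι] using hι v
  · intro x y
    simp only [LinearMap.add_apply, LinearMap.comp_apply, oddDer_mul, map_add, oddDer_par, par_par]
    noncomm_ring

theorem oddDer_sq (hι : ∀ v, oddDer h δ hδ (δ v) = 0) (x : FreeGC gr) :
    oddDer h δ hδ (oddDer h δ hδ x) = 0 := by
  have := oddDer_anticomm h δ hδ δ hδ (fun v => by rw [hι, add_zero]) x
  rwa [← two_smul ℝ, smul_eq_zero_iff_right two_ne_zero] at this

theorem oddDer_mem (I : Submodule ℝ (FreeGC gr))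
    (hl : ∀ x, ∀ y ∈ I, x * y ∈ I) (hr : ∀ x, ∀ y ∈ I, y * x ∈ I) (hI : ∀ v, δ v ∈ I)
    (x : FreeGC gr) : oddDer h δ hδ x ∈ I := by
  induction x using induction_on h.iSup_eq with
  | add a b ha hb => rw [map_add]; exact I.add_mem ha hb
  | hp n x hx =>
    refine deg_induction (p := fun _ x => oddDer h δ hδ x ∈ I) ?_ ?_ ?_ ?_ ?_ hx
    · rw [oddDer_one]; exact I.zero_mem
    · intro a b v y hv hy ih
      rw [oddDer_mul, oddDer_ι]
      exact I.add_mem (hr _ _ (hI v)) (hl _ _ ih)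
    · simp
    · intro n x y hx hy
      rw [map_add]; exact I.add_mem hx hy
    · intro n r x hx
      rw [map_smul]; exact I.smul_mem _ hx

theorem oddDer_mem_deg (E : ℕ → Submodule ℝ (FreeGC gr))
    (hl : ∀ a b x y, x ∈ deg gr a → y ∈ E b → x * y ∈ E (a + b))
    (hr : ∀ a b x y, x ∈ E a → y ∈ deg gr b → x * y ∈ E (a + b))
    (hE : ∀ n, ∀ v ∈ gr n, δ v ∈ E n) {n : ℕ} {x : FreeGC gr} (hx : x ∈ deg gr n) :
    oddDer h δ hδ x ∈ E n := by
  refine deg_induction (p := fun n x => oddDer h δ hδ x ∈ E n) ?_ ?_ ?_ ?_ ?_ hx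
  · rw [oddDer_one]; exact (E 0).zero_mem
  · intro a b v y hv hy ih
    rw [oddDer_mul, oddDer_ι, par_ι h hv, smul_mul_assoc]
    exact (E _).add_mem (hr _ _ _ _ (hE _ _ hv) hy)
      ((E _).smul_mem _ (hl _ _ _ _ (ι_mem_deg hv) ih))
  · simp
  · intro n x y hx hy
    rw [map_add]; exact (E n).add_mem hx hy
  · intro n r x hx
    rw [map_smul]; exact (E n).smul_mem _ hx

/-- The grading of `S(V)` as an algebra map to polynomials, `x ↦ x X^n` in degree `n`. -/
noncomputable def gradingHom : FreeGC gr →ₐ[ℝ] Polynomial (FreeGC gr) :=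
  lift (fromGr h fun n => ((Polynomial.monomial n).restrictScalars ℝ) ∘ₗ ι gr) (by
    intro m n x y hx hy
    rw [fromGr_apply h _ hx, fromGr_apply h _ hy]
    simp only [LinearMap.comp_apply, LinearMap.restrictScalars_apply,
      Polynomial.monomial_mul_monomial]
    rw [ι_comm hx hy, add_comm, Polynomial.smul_monomial])

theorem gradingHom_deg {n : ℕ} {x : FreeGC gr} (hx : x ∈ deg gr n) :
    gradingHom h x = Polynomial.monomial n x := by
  refine deg_induction (p := fun n x => gradingHom h x = Polynomial.monomial n x)
    ?_ ?_ ?_ ?_ ?_ hx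
  · rw [map_one, Polynomial.monomial_zero_one]
  · intro a b v y hv hy ih
    rw [map_mul, ih, gradingHom, lift_ι, fromGr_apply h _ hv]
    simp [Polynomial.monomial_mul_monomial]
  · simp
  · intro n x y hx hy
    rw [map_add, hx, hy, map_add]
  · intro n r x hx
    rw [map_smul, hx, Polynomial.smul_monomial]

/-- In degree two, decomposable elements are sums of products of elements of degree one. -/
theorem mem_deg_one_mul_deg_one (h : IsGrading gr) {x : FreeGC gr} (hx : x ∈ deg gr 2)
    (hx' : x ∈ plus gr * plus gr) : x ∈ deg gr 1 * deg gr 1 := by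
  let π : FreeGC gr →ₗ[ℝ] FreeGC gr :=
    ((Polynomial.lcoeff (FreeGC gr) 2).restrictScalars ℝ) ∘ₗ (gradingHom h).toLinearMap
  have hπ : ∀ {n : ℕ} {y : FreeGC gr}, y ∈ deg gr n → π y = if n = 2 then y else 0 := by
    intro n y hy
    simp [π, gradingHom_deg h hy, Polynomial.coeff_monomial]
  have hle : plus gr * plus gr ≤ (deg gr 1 * deg gr 1).comap π := by
    rw [plus, Submodule.iSup_mul]
    refine iSup_le fun m => ?_
    rw [Submodule.mul_iSup]
    refine iSup_le fun n => ?_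
    rw [Submodule.mul_le]
    intro a ha b hb
    rw [Submodule.mem_comap, hπ (mul_mem_deg ha hb)]
    split_ifs with hmn
    · obtain ⟨rfl, rfl⟩ : m = 0 ∧ n = 0 := by omega
      exact Submodule.mul_mem_mul ha hb
    · exact Submodule.zero_mem _
  have := hle hx'
  rwa [Submodule.mem_comap, hπ hx, if_pos rfl] at this

theorem mem_deg_zero_or_one (h0 : gr 0 = ⊥) {n : ℕ} {x : FreeGC gr} (hx : x ∈ deg gr n) :
    (n = 0 → x ∈ Submodule.span ℝ {(1 : FreeGC gr)}) ∧ (n = 1 → x ∈ (gr 1).map (ι gr)) := by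
  refine deg_induction (p := fun n x => (n = 0 → x ∈ Submodule.span ℝ {(1 : FreeGC gr)}) ∧
    (n = 1 → x ∈ (gr 1).map (ι gr))) ?_ ?_ ?_ ?_ ?_ hx
  · exact ⟨fun _ => Submodule.mem_span_singleton_self _, fun h => absurd h (by norm_num)⟩
  · intro a b v y hv hy ih
    rcases Nat.eq_zero_or_pos a with rfl | ha
    · rw [h0, Submodule.mem_bot] at hv
      subst hv
      simp
    · refine ⟨fun hab => by omega, fun hab => ?_⟩
      obtain ⟨rfl, rfl⟩ : a = 1 ∧ b = 0 := by omega
      obtain ⟨r, rfl⟩ := Submodule.mem_span_singleton.1 (ih.1 rfl)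
      rw [mul_smul_comm, mul_one]
      exact Submodule.smul_mem _ _ ⟨v, hv, rfl⟩
  · simp
  · intro n x y hx hy
    exact ⟨fun h => Submodule.add_mem _ (hx.1 h) (hy.1 h),
      fun h => Submodule.add_mem _ (hx.2 h) (hy.2 h)⟩
  · intro n r x hx
    exact ⟨fun h => Submodule.smul_mem _ _ (hx.1 h), fun h => Submodule.smul_mem _ _ (hx.2 h)⟩

end FreeGC

/-! ### The generators of the cyclification -/

section Cyc

variable (gr : ℕ → Submodule ℝ V)

/-- The space `V ⊕ V[1] ⊕ ℝ w`. The truncated desuspension `V[1]` is the quotient of `V` by `V¹`,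
so that the natural surjection `s : V → V[1]` with kernel `V¹` is the quotient map. -/
abbrev CycSpace : Type u := V × (V ⧸ gr 1) × ℝ

/-- The grading of `V ⊕ V[1] ⊕ ℝ w`: the component `V[1]ⁿ` is the image of `Vⁿ⁺¹` (it vanishes
for `n = 0`), and `w` has degree `2`. -/
def cycGr (n : ℕ) : Submodule ℝ (CycSpace gr) :=
  (gr n).prod (((gr (n + 1)).map (gr 1).mkQ).prod (if n = 2 then ⊤ else ⊥))

/-- The inclusion of `V`. -/
def inV : V →ₗ[ℝ] CycSpace gr := LinearMap.inl ℝ V ((V ⧸ gr 1) × ℝ)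

/-- The map `s : V → V[1]`. -/
def inS : V →ₗ[ℝ] CycSpace gr :=
  LinearMap.inr ℝ V ((V ⧸ gr 1) × ℝ) ∘ₗ LinearMap.inl ℝ (V ⧸ gr 1) ℝ ∘ₗ (gr 1).mkQ

/-- The generator `w`. -/
def genW : CycSpace gr := (0, 0, 1)

variable {gr}

theorem inV_mem {n : ℕ} {v : V} (hv : v ∈ gr n) : inV gr v ∈ cycGr gr n :=
  ⟨hv, Submodule.zero_mem _, Submodule.zero_mem _⟩

theorem inS_mem {n : ℕ} {v : V} (hv : v ∈ gr (n + 1)) : inS gr v ∈ cycGr gr n :=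
  ⟨Submodule.zero_mem _, ⟨v, hv, rfl⟩, Submodule.zero_mem _⟩

theorem genW_mem : genW gr ∈ cycGr gr 2 :=
  ⟨Submodule.zero_mem _, Submodule.zero_mem _, by simp [genW]⟩

theorem inS_eq_zero {v : V} (hv : v ∈ gr 1) : inS gr v = 0 := by
  have : (gr 1).mkQ v = 0 := by simpa using hv
  simp [inS, this]

theorem cyc_decomp (x : CycSpace gr) :
    ∃ (v u : V) (c : ℝ), x = inV gr v + inS gr u + c • genW gr := by
  obtain ⟨v, u, c⟩ := x
  obtain ⟨u, rfl⟩ := (gr 1).mkQ_surjective u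
  exact ⟨v, u, c, by simp [inV, inS, genW]⟩

theorem cycGr_zero (h : IsGrading gr) : cycGr gr 0 = ⊥ := by
  have : (gr 1).map (gr 1).mkQ = ⊥ := by
    rw [Submodule.mkQ_map_self]
  simp [cycGr, h.zero, this]

/-- A family of submodules that spans and has compatible projections is a decomposition. -/
theorem isInternal_of_proj {U : Type*} [AddCommGroup U] [Module ℝ U] (p : ℕ → Submodule ℝ U)
    (π : ℕ → U →ₗ[ℝ] U) (h1 : ∀ n, ∀ x ∈ p n, π n x = x)
    (h2 : ∀ n m, n ≠ m → ∀ x ∈ p m, π n x = 0) (ht : ⨆ n, p n = ⊤) :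
    DirectSum.IsInternal p := by
  rw [DirectSum.isInternal_submodule_iff_iSupIndep_and_iSup_eq_top]
  refine ⟨fun n => ?_, ht⟩
  rw [Submodule.disjoint_def]
  intro x hx hx'
  have hle : (⨆ m, ⨆ _ : m ≠ n, p m) ≤ LinearMap.ker (π n) :=
    iSup_le fun m => iSup_le fun hm y hy => h2 n m hm.symm y hy
  rw [← h1 n x hx]
  exact hle hx'

theorem cycGr_grading (h : IsGrading gr) : IsGrading (cycGr gr) := by
  refine ⟨?_, cycGr_zero h⟩
  let π : ℕ → V →ₗ[ℝ] V := fun n =>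
    FreeGC.fromGr h fun m => if n = m then LinearMap.id else 0
  have hπ : ∀ {n m : ℕ} {v : V}, v ∈ gr m → π n v = if n = m then v else 0 := by
    intro n m v hv
    simp only [π]
    rw [FreeGC.fromGr_apply h _ hv]
    split_ifs <;> rfl
  have hker : ∀ n, gr 1 ≤ LinearMap.ker ((gr 1).mkQ ∘ₗ π (n + 1)) := by
    intro n v hv
    rw [LinearMap.mem_ker, LinearMap.comp_apply, hπ hv]
    split_ifs
    · simpa using hv
    · simp
  let ρ : ℕ → (V ⧸ gr 1) →ₗ[ℝ] (V ⧸ gr 1) := fun n => (gr 1).liftQ _ (hker n)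
  let τ : ℕ → ℝ →ₗ[ℝ] ℝ := fun n => if n = 2 then LinearMap.id else 0
  refine isInternal_of_proj (cycGr gr)
    (fun n => LinearMap.prodMap (π n) (LinearMap.prodMap (ρ n) (τ n))) ?_ ?_ ?_
  · rintro n ⟨v, u, c⟩ ⟨hv, ⟨u, hu, rfl⟩, hc⟩
    have hu' : ρ n ((gr 1).mkQ u) = (gr 1).mkQ u := by
      simp only [ρ, Submodule.mkQ_apply, Submodule.liftQ_apply, LinearMap.comp_apply]
      rw [hπ hu, if_pos rfl]
    have hv' : π n v = v := by rw [hπ hv, if_pos rfl]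
    have hc' : τ n c = c := by
      simp only [τ]
      split_ifs with hn
      · rfl
      · simp [hn] at hc
        simp [hc]
    change (π n v, ρ n ((gr 1).mkQ u), τ n c) = _
    rw [hu', hv', hc']
  · rintro n m hnm ⟨v, u, c⟩ ⟨hv, ⟨u, hu, rfl⟩, hc⟩
    have hu' : ρ n ((gr 1).mkQ u) = 0 := by
      simp only [ρ, Submodule.mkQ_apply, Submodule.liftQ_apply, LinearMap.comp_apply]
      rw [hπ hu, if_neg (by omega)]
      rfl
    have hv' : π n v = 0 := by rw [hπ hv, if_neg hnm]
    have hc' : τ n c = 0 := by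
      simp only [τ]
      split_ifs with hn
      · subst hn
        simpa [hnm.symm] using hc
      · rfl
    change (π n v, ρ n ((gr 1).mkQ u), τ n c) = 0
    rw [hu', hv', hc']
    rfl
  · have ht : ⨆ n, gr n = ⊤ := h.iSup_eq
    have hV : ∀ v, inV gr v ∈ ⨆ n, cycGr gr n := by
      intro v
      have hv : v ∈ ⨆ n, gr n := ht ▸ Submodule.mem_top
      have : (⨆ n, gr n) ≤ (⨆ n, cycGr gr n).comap (inV gr) :=
        iSup_le fun n x hx => Submodule.mem_iSup_of_mem n (inV_mem hx)
      exact this hv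
    have hS : ∀ v, inS gr v ∈ ⨆ n, cycGr gr n := by
      intro v
      have hv : v ∈ ⨆ n, gr n := ht ▸ Submodule.mem_top
      have : (⨆ n, gr n) ≤ (⨆ n, cycGr gr n).comap (inS gr) := by
        refine iSup_le fun n => ?_
        cases n with
        | zero => rw [h.zero]; exact bot_le
        | succ n => exact fun x hx => Submodule.mem_iSup_of_mem n (inS_mem hx)
      exact this hv
    rw [eq_top_iff]
    rintro x -
    obtain ⟨v, u, c, rfl⟩ := cyc_decomp x
    exact Submodule.add_mem _ (Submodule.add_mem _ (hV v) (hS u))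
      (Submodule.smul_mem _ _ (Submodule.mem_iSup_of_mem 2 genW_mem))

open FreeGC

/-- The inclusion of algebras `S(V) → S(V ⊕ V[1] ⊕ ℝ w)`. -/
def incl (gr : ℕ → Submodule ℝ V) : FreeGC gr →ₐ[ℝ] FreeGC (cycGr gr) :=
  lift (ι (cycGr gr) ∘ₗ inV gr) fun _ _ _ _ hx hy => ι_comm (inV_mem hx) (inV_mem hy)

theorem incl_ι (v : V) : incl gr (ι gr v) = ι (cycGr gr) (inV gr v) := lift_ι _ _ v

theorem incl_deg {n : ℕ} {x : FreeGC gr} (hx : x ∈ deg gr n) :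
    incl gr x ∈ deg (cycGr gr) n := by
  refine deg_induction (p := fun n x => incl gr x ∈ deg (cycGr gr) n) ?_ ?_ ?_ ?_ ?_ hx
  · rw [map_one]; exact one_mem_deg
  · intro a b v y hv hy ih
    rw [map_mul, incl_ι]
    exact mul_mem_deg (ι_mem_deg (inV_mem hv)) ih
  · simp
  · intro n x y hx hy
    rw [map_add]; exact Submodule.add_mem _ hx hy
  · intro n r x hx
    rw [map_smul]; exact Submodule.smul_mem _ _ hx

theorem incl_plus {x : FreeGC gr} (hx : x ∈ plus gr) : incl gr x ∈ plus (cycGr gr) := by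
  have : plus gr ≤ (plus (cycGr gr)).comap (incl gr).toLinearMap :=
    iSup_le fun n y hy => Submodule.mem_iSup_of_mem n (incl_deg hy)
  exact this hx

/-- The values of `s` on generators: `v ↦ sv` on `V`, and zero on `V[1]` and `w`. -/
def sGen (gr : ℕ → Submodule ℝ V) : CycSpace gr →ₗ[ℝ] FreeGC (cycGr gr) :=
  ι (cycGr gr) ∘ₗ inS gr ∘ₗ LinearMap.fst ℝ V ((V ⧸ gr 1) × ℝ)

theorem sGen_odd (h : IsGrading gr) : IsOdd (sGen gr) := by
  rintro n ⟨v, u, c⟩ ⟨hv, -, -⟩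
  cases n with
  | zero =>
    have hv : v ∈ gr 0 := hv
    rw [h.zero, Submodule.mem_bot] at hv
    exact ⟨1, by decide, by simp [sGen, hv]⟩
  | succ n => exact ⟨n, ⟨n + 1, by ring⟩, ι_mem_deg (inS_mem hv)⟩

/-- The derivation `s` of degree `-1` of `S(V ⊕ V[1] ⊕ ℝ w)`. -/
noncomputable def sDer (h : IsGrading gr) :
    FreeGC (cycGr gr) →ₗ[ℝ] FreeGC (cycGr gr) :=
  oddDer (cycGr_grading h) (sGen gr) (sGen_odd h)

theorem sDer_inV (h : IsGrading gr) (v : V) :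
    sDer h (ι _ (inV gr v)) = ι _ (inS gr v) := oddDer_ι _ _ _ _

theorem sDer_inS (h : IsGrading gr) (v : V) :
    sDer h (ι _ (inS gr v)) = 0 := by
  rw [sDer, oddDer_ι]
  have : sGen gr (inS gr v) = ι (cycGr gr) (inS gr 0) := rfl
  rw [this, map_zero, map_zero]

theorem sDer_genW (h : IsGrading gr) :
    sDer h (ι _ (genW gr)) = 0 := by
  rw [sDer, oddDer_ι]
  have : sGen gr (genW gr) = ι (cycGr gr) (inS gr 0) := rfl
  rw [this, map_zero, map_zero]

theorem sDer_sDer (h : IsGrading gr) (x : FreeGC (cycGr gr)) :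
    sDer h (sDer h x) = 0 := by
  refine oddDer_sq _ _ _ (fun v => ?_) x
  exact sDer_inS h _

theorem sDer_mul (h : IsGrading gr) (x y : FreeGC (cycGr gr)) :
    sDer h (x * y) = sDer h x * y + par (cycGr_grading h) x * sDer h y := by
  unfold sDer
  exact oddDer_mul (cycGr_grading h) (sGen gr) (sGen_odd h) x y

theorem sDer_mem_plus (h : IsGrading gr) (x : FreeGC (cycGr gr)) :
    sDer h x ∈ plus (cycGr gr) := by
  have ht := (cycGr_grading h).iSup_eq
  unfold sDer
  refine oddDer_mem (cycGr_grading h) (sGen gr) (sGen_odd h) (plus (cycGr gr)) ?_ ?_ ?_ x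
  · exact fun x y hy => mul_mem_plus_left ht x hy
  · exact fun x y hy => mul_mem_plus_right ht x hy
  · exact fun v => ι_mem_plus ht (cycGr_zero h) (inS gr v.1)

/-- The target of `s` on the part of each degree. -/
def predDeg (gr : ℕ → Submodule ℝ V) : ℕ → Submodule ℝ (FreeGC (cycGr gr))
  | 0 => ⊥
  | n + 1 => deg (cycGr gr) n

theorem sDer_deg (h : IsGrading gr) {n : ℕ} {x : FreeGC (cycGr gr)}
    (hx : x ∈ deg (cycGr gr) (n + 1)) : sDer h x ∈ deg (cycGr gr) n := by
  have key : sDer h x ∈ predDeg gr (n + 1) := by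
    unfold sDer
    refine oddDer_mem_deg (cycGr_grading h) (sGen gr) (sGen_odd h) (predDeg gr)
      ?_ ?_ ?_ hx
    · intro a b x y hx hy
      cases b with
      | zero =>
        rw [predDeg, Submodule.mem_bot] at hy
        rw [hy, mul_zero]; exact Submodule.zero_mem _
      | succ b =>
        rw [predDeg] at hy
        rw [← add_assoc, predDeg]
        exact mul_mem_deg hx hy
    · intro a b x y hx hy
      cases a with
      | zero =>
        rw [predDeg, Submodule.mem_bot] at hx
        rw [hx, zero_mul]; exact Submodule.zero_mem _
      | succ a =>
        rw [predDeg] at hx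
        rw [add_right_comm, predDeg]
        exact mul_mem_deg hx hy
    · rintro n ⟨v, u, c⟩ ⟨hv, -, -⟩
      have hs : sGen gr (v, u, c) = ι (cycGr gr) (inS gr v) := rfl
      rw [hs]
      cases n with
      | zero =>
        have hv : v ∈ gr 0 := hv
        rw [h.zero, Submodule.mem_bot] at hv
        rw [hv, map_zero, map_zero]; exact Submodule.zero_mem _
      | succ n =>
        rw [predDeg]
        exact ι_mem_deg (inS_mem hv)
  rwa [predDeg] at key

end Cyc

end Free

/-! ### Minimal Sullivan algebras -/

open FreeGC

/-- A minimal Sullivan algebra `(S(V), d)` over `ℝ` with underlying space of generators `V`.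
The subalgebra `S(F k)` of `S(V)` in the Sullivan condition is the one generated by `F k`. -/
structure MinimalSullivanAlgebra (V : Type u) [AddCommGroup V] [Module ℝ V] where
  /-- the grading of `V`, concentrated in positive degrees -/
  gr : ℕ → Submodule ℝ V
  grading : IsGrading gr
  /-- the differential -/
  d : FreeGC gr →ₗ[ℝ] FreeGC gr
  d_deg : ∀ (n : ℕ) (x : FreeGC gr), x ∈ deg gr n → d x ∈ deg gr (n + 1)
  leibniz : ∀ (m : ℕ) (x y : FreeGC gr), x ∈ deg gr m →
    d (x * y) = d x * y + (-1 : ℝ) ^ m • (x * d y)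
  d_d : ∀ x, d (d x) = 0
  /-- the Sullivan condition -/
  sullivan : ∃ F : ℕ → Submodule ℝ V, Monotone F ∧ (∀ v, ∃ k, v ∈ F k) ∧
    (∀ k, F k ≤ ⨆ n, F k ⊓ gr n) ∧
    (∀ v ∈ F 0, d (ι gr v) = 0) ∧
    ∀ k, ∀ v ∈ F (k + 1), d (ι gr v) ∈ Algebra.adjoin ℝ (ι gr '' (F k : Set V))
  /-- minimality -/
  minimal : ∀ x, d x ∈ plus gr * plus gr

namespace MinimalSullivanAlgebra

variable {V : Type u} [AddCommGroup V] [Module ℝ V] (M : MinimalSullivanAlgebra V)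

/-- The underlying graded algebra `S(V)`. -/
abbrev S : Type u := FreeGC M.gr

theorem d_mul (x y : M.S) : M.d (x * y) = M.d x * y + par M.grading x * M.d y := by
  induction x using induction_on M.grading.iSup_eq with
  | hp n x hx => rw [M.leibniz n x y hx, par_deg _ hx, smul_mul_assoc]
  | add a b ha hb => rw [add_mul, map_add, ha, hb, map_add, map_add]; noncomm_ring

theorem d_one : M.d 1 = 0 := by simpa using M.d_mul 1 1

/-! ### The cyclification -/

/-- The composition `v ↦ s(dv)`. -/
noncomputable def sd : V →ₗ[ℝ] FreeGC (cycGr M.gr) :=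
  sDer M.grading ∘ₗ (incl M.gr).toLinearMap ∘ₗ M.d ∘ₗ ι M.gr

theorem sd_eq_zero : M.gr 1 ≤ LinearMap.ker M.sd := by
  intro v hv
  have h2 := mem_deg_one_mul_deg_one M.grading (M.d_deg 1 _ (ι_mem_deg hv)) (M.minimal _)
  have hle : deg M.gr 1 * deg M.gr 1 ≤
      LinearMap.ker (sDer M.grading ∘ₗ (incl M.gr).toLinearMap) := by
    rw [Submodule.mul_le]
    intro a ha b hb
    obtain ⟨a, ha', rfl⟩ := (mem_deg_zero_or_one M.grading.zero ha).2 rfl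
    obtain ⟨b, hb', rfl⟩ := (mem_deg_zero_or_one M.grading.zero hb).2 rfl
    rw [LinearMap.mem_ker, LinearMap.comp_apply, AlgHom.toLinearMap_apply, map_mul, incl_ι, incl_ι]
    rw [sDer_mul, sDer_inV, sDer_inV, inS_eq_zero ha', inS_eq_zero hb', map_zero, zero_mul,
      mul_zero, add_zero]
  have h3 := hle h2
  rw [LinearMap.mem_ker, LinearMap.comp_apply] at h3
  rw [LinearMap.mem_ker, sd, LinearMap.comp_apply, LinearMap.comp_apply, LinearMap.comp_apply]
  exact h3

/-- The values of the differential `d_c` on generators: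
`d_c v = dv + sv · w`, `d_c (sv) = - s(dv)`, `d_c w = 0`. -/
noncomputable def cycGen : CycSpace M.gr →ₗ[ℝ] FreeGC (cycGr M.gr) :=
  LinearMap.coprod
    ((incl M.gr).toLinearMap ∘ₗ M.d ∘ₗ ι M.gr +
      LinearMap.mulRight ℝ (ι (cycGr M.gr) (genW M.gr)) ∘ₗ ι (cycGr M.gr) ∘ₗ inS M.gr)
    (LinearMap.coprod (-(M.gr 1).liftQ M.sd M.sd_eq_zero) 0)

theorem cycGen_inV (v : V) : M.cycGen (inV M.gr v) =
    incl M.gr (M.d (ι M.gr v)) + ι _ (inS M.gr v) * ι _ (genW M.gr) := by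
  rw [cycGen, inV, LinearMap.coprod_apply, LinearMap.inl_apply, map_zero, add_zero]
  rfl

theorem cycGen_inS (v : V) : M.cycGen (inS M.gr v) =
    - sDer M.grading (incl M.gr (M.d (ι M.gr v))) := by
  have : M.cycGen (inS M.gr v) = M.cycGen (0, (M.gr 1).mkQ v, 0) := rfl
  rw [this, cycGen, LinearMap.coprod_apply, LinearMap.coprod_apply, map_zero, zero_add, map_zero,
    add_zero, LinearMap.neg_apply, Submodule.mkQ_apply, Submodule.liftQ_apply]
  rfl

theorem cycGen_genW : M.cycGen (genW M.gr) = 0 := by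
  rw [cycGen, genW, LinearMap.coprod_apply, LinearMap.coprod_apply, map_zero, map_zero, zero_add,
    zero_add, LinearMap.zero_apply]

theorem cycGen_deg (n : ℕ) (x : CycSpace M.gr) (hx : x ∈ cycGr M.gr n) :
    M.cycGen x ∈ deg (cycGr M.gr) (n + 1) := by
  obtain ⟨v, u, c⟩ := x
  obtain ⟨hv, ⟨u, hu, rfl⟩, hc⟩ := hx
  have hdec : ((v, (M.gr 1).mkQ u, c) : CycSpace M.gr) =
      inV M.gr v + inS M.gr u + c • genW M.gr := by simp [inV, inS, genW]
  rw [hdec, map_add, map_add, map_smul, cycGen_genW, smul_zero, add_zero, cycGen_inV, cycGen_inS]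
  refine Submodule.add_mem _ (Submodule.add_mem _ ?_ ?_) (Submodule.neg_mem _ ?_)
  · exact incl_deg (M.d_deg _ _ (ι_mem_deg hv))
  · cases n with
    | zero =>
      have hv : v ∈ M.gr 0 := hv
      rw [M.grading.zero, Submodule.mem_bot] at hv
      rw [hv, map_zero, map_zero, zero_mul]; exact Submodule.zero_mem _
    | succ n => exact mul_mem_deg (m := n) (n := 2) (ι_mem_deg (inS_mem hv)) (ι_mem_deg genW_mem)
  · exact sDer_deg _ (incl_deg (M.d_deg _ _ (ι_mem_deg hu)))

theorem cycGen_odd : IsOdd M.cycGen := fun n v hv =>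
  ⟨n + 1, ⟨n + 1, by ring⟩, M.cycGen_deg n v hv⟩

/-- The differential `d_c` of `S(V ⊕ V[1] ⊕ ℝ w)`. -/
noncomputable def cycD : FreeGC (cycGr M.gr) →ₗ[ℝ] FreeGC (cycGr M.gr) :=
  oddDer (cycGr_grading M.grading) M.cycGen M.cycGen_odd

theorem cycD_ι (x : CycSpace M.gr) : M.cycD (ι _ x) = M.cycGen x := oddDer_ι _ _ _ _

theorem cycD_mul (x y : FreeGC (cycGr M.gr)) : M.cycD (x * y) =
    M.cycD x * y + par (cycGr_grading M.grading) x * M.cycD y := by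
  unfold cycD
  exact oddDer_mul (cycGr_grading M.grading) M.cycGen M.cycGen_odd x y

theorem w_central (x : FreeGC (cycGr M.gr)) :
    x * ι _ (genW M.gr) = ι _ (genW M.gr) * x := by
  induction x using induction_on (cycGr_grading M.grading).iSup_eq with
  | add a b ha hb => rw [add_mul, mul_add, ha, hb]
  | hp n x hx =>
    rw [comm_deg hx (ι_mem_deg genW_mem), (even_two.mul_left n).neg_one_pow, one_smul]

theorem cycD_incl (x : M.S) : M.cycD (incl M.gr x) =
    incl M.gr (M.d x) + sDer M.grading (incl M.gr x) * ι _ (genW M.gr) := by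
  induction x using induction_on M.grading.iSup_eq with
  | add a b ha hb => simp only [map_add, ha, hb, add_mul]; abel
  | hp n x hx =>
    refine deg_induction (p := fun _ x => M.cycD (incl M.gr x) = incl M.gr (M.d x) +
      sDer M.grading (incl M.gr x) * ι _ (genW M.gr)) ?_ ?_ ?_ ?_ ?_ hx
    · simp [cycD, sDer, oddDer_one, d_one]
    · intro a b v y hv hy ih
      rw [map_mul, cycD_mul, ih, d_mul, sDer_mul, incl_ι, cycD_ι, cycGen_inV, sDer_inV,
        par_ι _ (inV_mem hv), par_ι _ hv, map_add, map_mul, map_mul, map_smul, incl_ι]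
      rw [add_mul, mul_assoc (ι _ (inS M.gr v)), ← w_central]
      simp only [add_mul, mul_add, mul_assoc]
      abel
    · simp
    · intro n x y hx hy
      simp only [map_add, hx, hy, add_mul]; abel
    · intro n r x hx
      simp only [map_smul, hx, smul_add, smul_mul_assoc]

theorem cycD_sDer (x : FreeGC (cycGr M.gr)) :
    M.cycD (sDer M.grading x) + sDer M.grading (M.cycD x) = 0 := by
  refine oddDer_anticomm _ _ _ _ _ (fun y => ?_) x
  change M.cycD (sGen M.gr y) + sDer M.grading (M.cycGen y) = 0
  obtain ⟨v, u, c, rfl⟩ := cyc_decomp y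
  have hs : sGen M.gr (inV M.gr v + inS M.gr u + c • genW M.gr) = ι _ (inS M.gr v) := by
    simp [sGen, inV, inS, genW]
  rw [hs, map_add M.cycGen, map_add M.cycGen, map_smul, cycGen_genW, cycD_ι, cycGen_inV,
    cycGen_inS, cycGen_inS]
  simp only [map_add, map_neg, sDer_sDer, sDer_mul, sDer_inS, sDer_genW, smul_zero, map_zero]
  simp

theorem cycD_cycD (x : FreeGC (cycGr M.gr)) : M.cycD (M.cycD x) = 0 := by
  refine oddDer_sq _ _ _ (fun y => ?_) x
  change M.cycD (M.cycGen y) = 0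
  obtain ⟨v, u, c, rfl⟩ := cyc_decomp y
  have hs := M.cycD_sDer (incl M.gr (M.d (ι M.gr u)))
  rw [cycD_incl, M.d_d, map_zero, zero_add, sDer_mul, sDer_sDer, sDer_genW, zero_mul, mul_zero,
    add_zero, add_zero] at hs
  rw [map_add M.cycGen, map_add M.cycGen, map_smul, cycGen_genW, smul_zero, add_zero, map_add, cycGen_inV,
    cycGen_inS, map_neg, hs, map_add, cycD_incl, M.d_d, cycD_mul, cycD_ι, cycD_ι, cycGen_genW,
    cycGen_inS]
  simp

theorem cyc_minimal (x : FreeGC (cycGr M.gr)) :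
    M.cycD x ∈ plus (cycGr M.gr) * plus (cycGr M.gr) := by
  have hi := cycGr_grading M.grading
  have ht := hi.iSup_eq
  have hl : ∀ x, ∀ y ∈ plus (cycGr M.gr) * plus (cycGr M.gr),
      x * y ∈ plus (cycGr M.gr) * plus (cycGr M.gr) := by
    intro x y hy
    have : plus (cycGr M.gr) * plus (cycGr M.gr) ≤
        (plus (cycGr M.gr) * plus (cycGr M.gr)).comap (LinearMap.mulLeft ℝ x) := by
      rw [Submodule.mul_le]
      intro a ha b hb
      rw [Submodule.mem_comap, LinearMap.mulLeft_apply, ← mul_assoc]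
      exact Submodule.mul_mem_mul (mul_mem_plus_left ht x ha) hb
    exact this hy
  have hr : ∀ x, ∀ y ∈ plus (cycGr M.gr) * plus (cycGr M.gr),
      y * x ∈ plus (cycGr M.gr) * plus (cycGr M.gr) := by
    intro x y hy
    have : plus (cycGr M.gr) * plus (cycGr M.gr) ≤
        (plus (cycGr M.gr) * plus (cycGr M.gr)).comap (LinearMap.mulRight ℝ x) := by
      rw [Submodule.mul_le]
      intro a ha b hb
      rw [Submodule.mem_comap, LinearMap.mulRight_apply, mul_assoc]
      exact Submodule.mul_mem_mul ha (mul_mem_plus_right ht x hb)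
    exact this hy
  have hincl : plus M.gr * plus M.gr ≤
      (plus (cycGr M.gr) * plus (cycGr M.gr)).comap (incl M.gr).toLinearMap := by
    rw [Submodule.mul_le]
    intro a ha b hb
    rw [Submodule.mem_comap, AlgHom.toLinearMap_apply, map_mul]
    exact Submodule.mul_mem_mul (incl_plus ha) (incl_plus hb)
  have hs : plus M.gr * plus M.gr ≤ (plus (cycGr M.gr) * plus (cycGr M.gr)).comap
      (sDer M.grading ∘ₗ (incl M.gr).toLinearMap) := by
    rw [Submodule.mul_le]
    intro a ha b hb
    rw [Submodule.mem_comap, LinearMap.comp_apply, AlgHom.toLinearMap_apply, map_mul, sDer_mul]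
    refine Submodule.add_mem _
      (Submodule.mul_mem_mul (sDer_mem_plus _ _) (incl_plus hb))
      (Submodule.mul_mem_mul ?_ (sDer_mem_plus _ _))
    have : plus (cycGr M.gr) ≤ (plus (cycGr M.gr)).comap (par hi).toLinearMap := by
      refine iSup_le fun n y hy => ?_
      rw [Submodule.mem_comap, AlgHom.toLinearMap_apply, par_deg hi hy]
      exact Submodule.smul_mem _ _ (Submodule.mem_iSup_of_mem n hy)
    exact this (incl_plus ha)
  refine oddDer_mem hi M.cycGen M.cycGen_odd _ hl hr (fun y => ?_) x
  obtain ⟨v, u, c, rfl⟩ := cyc_decomp y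
  rw [map_add, map_add, map_smul, cycGen_genW, smul_zero, add_zero, cycGen_inV, cycGen_inS]
  refine Submodule.add_mem _ (Submodule.add_mem _ (hincl (M.minimal _)) ?_)
    (Submodule.neg_mem _ (hs (M.minimal _)))
  exact Submodule.mul_mem_mul (ι_mem_plus ht (cycGr_zero M.grading) _)
    (ι_mem_plus ht (cycGr_zero M.grading) _)

/-- A filtration shifted by one step, starting with zero. -/
def shift (F : ℕ → Submodule ℝ V) : ℕ → Submodule ℝ V
  | 0 => ⊥
  | n + 1 => F n

theorem shift_mono {F : ℕ → Submodule ℝ V} (hF : Monotone F) : Monotone (shift F) := by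
  refine monotone_nat_of_le_succ fun n => ?_
  cases n with
  | zero => exact bot_le
  | succ n => exact hF n.le_succ

theorem par_incl_mem {N : Subalgebra ℝ (FreeGC (cycGr M.gr))} {G : Submodule ℝ V}
    (hG : G ≤ ⨆ n, G ⊓ M.gr n) (hN : ∀ v ∈ G, ι _ (inV M.gr v) ∈ N)
    (hS : ∀ v ∈ G, ι _ (inS M.gr v) ∈ N) {x : M.S}
    (hx : x ∈ Algebra.adjoin ℝ (ι M.gr '' (G : Set V))) :
    incl M.gr x ∈ N ∧ par (cycGr_grading M.grading) (incl M.gr x) ∈ N ∧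
      sDer M.grading (incl M.gr x) ∈ N := by
  induction hx using Algebra.adjoin_induction with
  | mem x hx =>
    obtain ⟨v, hv, rfl⟩ := hx
    rw [incl_ι, sDer_inV]
    refine ⟨hN v hv, ?_, hS v hv⟩
    have hle : (⨆ n, G ⊓ M.gr n) ≤ (Subalgebra.toSubmodule N).comap
        ((par (cycGr_grading M.grading)).toLinearMap ∘ₗ ι _ ∘ₗ inV M.gr) := by
      refine iSup_le fun n u hu => ?_
      rw [Submodule.mem_comap, LinearMap.comp_apply, LinearMap.comp_apply,
        AlgHom.toLinearMap_apply, par_ι _ (inV_mem hu.2)]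
      exact Submodule.smul_mem _ _ (hN u hu.1)
    exact hle (hG hv)
  | algebraMap r =>
    have : sDer M.grading (algebraMap ℝ _ r) = 0 := by
      rw [Algebra.algebraMap_eq_smul_one, map_smul, sDer, oddDer_one, smul_zero]
    rw [AlgHom.commutes, AlgHom.commutes, this]
    exact ⟨N.algebraMap_mem r, N.algebraMap_mem r, N.zero_mem⟩
  | add x y _ _ hx hy =>
    simp only [map_add]
    exact ⟨N.add_mem hx.1 hy.1, N.add_mem hx.2.1 hy.2.1, N.add_mem hx.2.2 hy.2.2⟩
  | mul x y _ _ hx hy =>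
    rw [map_mul, map_mul, sDer_mul]
    exact ⟨N.mul_mem hx.1 hy.1, N.mul_mem hx.2.1 hy.2.1,
      N.add_mem (N.mul_mem hx.2.2 hy.1) (N.mul_mem hx.2.1 hy.2.2)⟩

theorem cyc_sullivan : ∃ F : ℕ → Submodule ℝ (CycSpace M.gr), Monotone F ∧
    (∀ v, ∃ k, v ∈ F k) ∧ (∀ k, F k ≤ ⨆ n, F k ⊓ cycGr M.gr n) ∧
    (∀ v ∈ F 0, M.cycD (ι _ v) = 0) ∧
    ∀ k, ∀ v ∈ F (k + 1), M.cycD (ι _ v) ∈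
      Algebra.adjoin ℝ (ι (cycGr M.gr) '' (F k : Set (CycSpace M.gr))) := by
  obtain ⟨F, hmono, hun, hhom, h0, hstep⟩ := M.sullivan
  have hsm := shift_mono hmono
  have hshom : ∀ k, shift F k ≤ ⨆ n, shift F k ⊓ M.gr n := by
    intro k
    cases k with
    | zero => exact bot_le
    | succ k => exact hhom k
  have hd : ∀ k, ∀ v ∈ F k, M.d (ι M.gr v) ∈
      Algebra.adjoin ℝ (ι M.gr '' (shift F k : Set V)) := by
    intro k v hv
    cases k with
    | zero => rw [h0 v hv]; exact Subalgebra.zero_mem _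
    | succ k => exact hstep k v hv
  let G : ℕ → Submodule ℝ (CycSpace M.gr) := fun j =>
    (shift F ((j + 1) / 2)).map (inV M.gr) ⊔ (F (j / 2)).map (inS M.gr) ⊔
      Submodule.span ℝ {genW M.gr}
  have hGV : ∀ j v, v ∈ shift F ((j + 1) / 2) → inV M.gr v ∈ G j := fun j v hv =>
    Submodule.mem_sup_left (Submodule.mem_sup_left ⟨v, hv, rfl⟩)
  have hGS : ∀ j v, v ∈ F (j / 2) → inS M.gr v ∈ G j := fun j v hv =>
    Submodule.mem_sup_left (Submodule.mem_sup_right ⟨v, hv, rfl⟩)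
  have hGw : ∀ j, genW M.gr ∈ G j := fun j =>
    Submodule.mem_sup_right (Submodule.mem_span_singleton_self _)
  have hGe : ∀ j x, x ∈ G j → ∃ v ∈ shift F ((j + 1) / 2), ∃ u ∈ F (j / 2), ∃ c : ℝ,
      x = inV M.gr v + inS M.gr u + c • genW M.gr := by
    intro j x hx
    obtain ⟨y, hy, z, hz, rfl⟩ := Submodule.mem_sup.1 hx
    obtain ⟨_, ⟨v, hv, rfl⟩, _, ⟨u, hu, rfl⟩, rfl⟩ := Submodule.mem_sup.1 hy
    obtain ⟨c, rfl⟩ := Submodule.mem_span_singleton.1 hz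
    exact ⟨v, hv, u, hu, c, rfl⟩
  refine ⟨G, ?_, ?_, ?_, ?_, ?_⟩
  · intro i j hij
    exact sup_le_sup (sup_le_sup (Submodule.map_mono (hsm (by omega)))
      (Submodule.map_mono (hmono (by omega)))) le_rfl
  · intro x
    obtain ⟨v, u, c, rfl⟩ := cyc_decomp x
    obtain ⟨k, hk⟩ := hun v
    obtain ⟨l, hl⟩ := hun u
    have hk' : v ∈ shift F (k + 1) := hk
    refine ⟨2 * (k + l + 1), Submodule.add_mem _ (Submodule.add_mem _ (hGV _ _ ?_) (hGS _ _ ?_))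
      (Submodule.smul_mem _ _ (hGw _))⟩
    · exact hsm (by omega) hk'
    · exact hmono (by omega) hl
  · intro k
    refine sup_le (sup_le ?_ ?_) ?_
    · refine (Submodule.map_mono (hshom _)).trans ?_
      rw [Submodule.map_iSup]
      refine iSup_mono fun n => ?_
      rintro _ ⟨v, hv, rfl⟩
      exact ⟨hGV k v hv.1, inV_mem hv.2⟩
    · refine (Submodule.map_mono (hhom _)).trans ?_
      rw [Submodule.map_iSup]
      refine iSup_le fun n => ?_
      rintro _ ⟨v, hv, rfl⟩
      cases n with
      | zero =>
        have hv2 : v ∈ M.gr 0 := hv.2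
        rw [M.grading.zero, Submodule.mem_bot] at hv2
        rw [hv2, map_zero]; exact Submodule.zero_mem _
      | succ n => exact Submodule.mem_iSup_of_mem n ⟨hGS k v hv.1, inS_mem hv.2⟩
    · rw [Submodule.span_singleton_le_iff_mem]
      exact Submodule.mem_iSup_of_mem 2 ⟨hGw k, genW_mem⟩
  · intro x hx
    obtain ⟨v, hv, u, hu, c, rfl⟩ := hGe 0 x hx
    have hv : v = 0 := hv
    have hu : u ∈ F 0 := hu
    rw [cycD_ι, map_add M.cycGen, map_add M.cycGen, map_smul, cycGen_genW, cycGen_inS, h0 u hu,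
      hv]
    simp
  · intro k x hx
    obtain ⟨v, hv, u, hu, c, rfl⟩ := hGe (k + 1) x hx
    have hv : v ∈ F (k / 2) := by
      have he : (k + 1 + 1) / 2 = k / 2 + 1 := by omega
      rw [he] at hv
      exact hv
    set N := Algebra.adjoin ℝ (ι (cycGr M.gr) '' (G k : Set (CycSpace M.gr))) with hN
    have hmem : ∀ y ∈ G k, ι _ y ∈ N := fun y hy => Algebra.subset_adjoin ⟨y, hy, rfl⟩
    have hVk : ∀ v ∈ shift F ((k + 1) / 2), ι _ (inV M.gr v) ∈ N := fun v hv =>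
      hmem _ (hGV k v hv)
    have hSk : ∀ v ∈ shift F ((k + 1) / 2), ι _ (inS M.gr v) ∈ N := fun v hv =>
      hmem _ (hGS k v (hsm (show (k + 1) / 2 ≤ k / 2 + 1 by omega) hv))
    have hdv : M.d (ι M.gr v) ∈
        Algebra.adjoin ℝ (ι M.gr '' (shift F ((k + 1) / 2) : Set V)) :=
      Algebra.adjoin_mono (Set.image_mono (hsm (by omega))) (hd _ v hv)
    rw [cycD_ι, map_add M.cycGen, map_add M.cycGen, map_smul, cycGen_genW, smul_zero, add_zero,
      cycGen_inV, cycGen_inS]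
    refine N.add_mem (N.add_mem ?_ (N.mul_mem ?_ ?_)) (N.neg_mem ?_)
    · exact (M.par_incl_mem (hshom _) hVk hSk hdv).1
    · exact hmem _ (hGS k v hv)
    · exact hmem _ (hGw k)
    · exact (M.par_incl_mem (hshom _) hVk hSk (hd _ u hu)).2.2

/-- The cyclification of a minimal Sullivan algebra `(S(V), d)`: the minimal Sullivan algebra
`(S(V ⊕ V[1] ⊕ ℝ w), d_c)`. If `(S(V), d)` is the Sullivan minimal model of a space `Z`, this is the
Sullivan minimal model of the cyclic loop space of `Z`. -/
noncomputable def cyclification : MinimalSullivanAlgebra (CycSpace M.gr) where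
  gr := cycGr M.gr
  grading := cycGr_grading M.grading
  d := M.cycD
  d_deg n x hx := by
    refine oddDer_mem_deg (cycGr_grading M.grading) M.cycGen M.cycGen_odd
      (fun n => deg (cycGr M.gr) (n + 1)) ?_ ?_ M.cycGen_deg hx
    · intro a b x y hx hy
      rw [add_assoc]
      exact mul_mem_deg hx hy
    · intro a b x y hx hy
      rw [add_right_comm]
      exact mul_mem_deg hx hy
  leibniz m x y hx := by
    rw [cycD_mul, par_deg _ hx, smul_mul_assoc]
  d_d := M.cycD_cycD
  sullivan := M.cyc_sullivan
  minimal := M.cyc_minimal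

/-! ### Closed generators -/

/-- The differential is quadratic: it maps `V` to `S²(V)`. -/
def IsQuadratic : Prop := ∀ v : V, M.d (ι M.gr v) ∈ LinearMap.range (ι M.gr) ^ 2

/-- `Z(M⁺)`, the closed elements of `M⁺`. -/
def closedPlus : Submodule ℝ M.S := plus M.gr ⊓ LinearMap.ker M.d

/-- `P(M) = Z(M⁺) / (Z(M⁺) ∩ (M⁺)²)`. -/
abbrev P : Type u := M.closedPlus ⧸ (plus M.gr * plus M.gr).submoduleOf M.closedPlus

/-- `ker d ∩ V`, the space of closed generators. -/
def closedGen : Submodule ℝ V := LinearMap.ker (M.d ∘ₗ ι M.gr)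

/-! ### The automorphism group and its split tori -/

/-- The group of `A`-points of the algebraic group `Aut M`: the automorphisms of the differential
graded `A`-algebra `A ⊗ M`. -/
def Aut (A : Type) [CommRing A] [Algebra ℝ A] :
    Subgroup ((A ⊗[ℝ] M.S) ≃ₐ[A] (A ⊗[ℝ] M.S)) where
  carrier := {g | (∀ n x, g x ∈ (deg M.gr n).baseChange A ↔ x ∈ (deg M.gr n).baseChange A) ∧
    ∀ x, g (M.d.baseChange A x) = M.d.baseChange A (g x)}
  one_mem' := ⟨fun _ _ => Iff.rfl, fun _ => rfl⟩
  mul_mem' := by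
    rintro g g' ⟨h1, h2⟩ ⟨h1', h2'⟩
    exact ⟨fun n x => (h1 n (g' x)).trans (h1' n x), fun x => by
      rw [AlgEquiv.mul_apply, AlgEquiv.mul_apply, h2', h2]⟩
  inv_mem' := by
    rintro g ⟨h1, h2⟩
    refine ⟨fun n x => ?_, fun x => g.injective ?_⟩
    · have := h1 n (g⁻¹ x)
      rw [← AlgEquiv.mul_apply, mul_inv_cancel] at this
      exact this.symm
    · rw [h2, ← AlgEquiv.mul_apply, ← AlgEquiv.mul_apply, mul_inv_cancel]
      rfl

/-- `g'` is the automorphism of `B ⊗ M` obtained from the automorphism `g` of `A ⊗ M` by extension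
of scalars along `f : A → B`. -/
def IsBaseChange {A B : Type} [CommRing A] [Algebra ℝ A] [CommRing B] [Algebra ℝ B]
    (f : A →ₐ[ℝ] B) (g : M.Aut A) (g' : M.Aut B) : Prop :=
  ∀ x : A ⊗[ℝ] M.S, Algebra.TensorProduct.map f (AlgHom.id ℝ M.S) (g.1 x) =
    g'.1 (Algebra.TensorProduct.map f (AlgHom.id ℝ M.S) x)

/-- A family of subgroups of the groups of `A`-points of `Aut M`, one for each commutative
`ℝ`-algebra `A`. -/
abbrev SubgroupFamily : Type (max u 1) :=
  ∀ (A : Type) [CommRing A] [Algebra ℝ A], Subgroup (M.Aut A)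

variable {M}

/-- `T` is (the functor of points of) an `ℝ`-split torus of dimension `n` in `Aut M`: there is an
isomorphism of `𝔾_mⁿ` with `T` over `ℝ`, that is, a family of isomorphisms of the groups of
`A`-points that commutes with extension of scalars. (If `V` has finite dimension, then `Aut M` is an
affine algebraic group over `ℝ`, in which every such subgroup functor is automatically closed.) -/
def IsSplitTorus (T : M.SubgroupFamily) (n : ℕ) : Prop :=
  ∃ φ : ∀ (A : Type) [CommRing A] [Algebra ℝ A], (Fin n → Aˣ) ≃* T A,
    ∀ (A B : Type) [CommRing A] [Algebra ℝ A] [CommRing B] [Algebra ℝ B] (f : A →ₐ[ℝ] B)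
      (t : Fin n → Aˣ), M.IsBaseChange f (φ A t).1 (φ B fun i => Units.map f (t i)).1

/-- `T` is a maximal `ℝ`-split torus of `Aut M`. -/
def IsMaximalSplitTorus (T : M.SubgroupFamily) : Prop :=
  (∃ n, IsSplitTorus T n) ∧
    ∀ T' : M.SubgroupFamily, (∃ m, IsSplitTorus T' m) →
      (∀ (A : Type) [CommRing A] [Algebra ℝ A], T A ≤ T' A) →
        ∀ (A : Type) [CommRing A] [Algebra ℝ A], T' A ≤ T A

variable (M)

/-- The inclusion `A ⊗ S(V) → A ⊗ S(V ⊕ V[1] ⊕ ℝ w)`. -/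
noncomputable def inclA (A : Type) [CommRing A] [Algebra ℝ A] :
    A ⊗[ℝ] M.S →ₐ[A] A ⊗[ℝ] M.cyclification.S :=
  Algebra.TensorProduct.map (AlgHom.id A A) (incl M.gr)

/-- The `A`-linear extension of the derivation `s` to `A ⊗ S(V ⊕ V[1] ⊕ ℝ w)`. -/
noncomputable def sA (A : Type) [CommRing A] [Algebra ℝ A] :
    A ⊗[ℝ] M.cyclification.S →ₗ[A] A ⊗[ℝ] M.cyclification.S :=
  LinearMap.baseChange A (sDer M.grading)

/-- A generator of the cyclification as an element of `A ⊗ S(V ⊕ V[1] ⊕ ℝ w)`. -/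
noncomputable def genA (A : Type) [CommRing A] [Algebra ℝ A] (x : CycSpace M.gr) :
    A ⊗[ℝ] M.cyclification.S := 1 ⊗ₜ[ℝ] ι (cycGr M.gr) x

/-- `j` is the natural inclusion `Aut M × 𝔾_m ⊆ Aut M_c` of algebraic groups, where `M_c` is the
cyclification of `M`: the pair `(g, t)` acts on the generators by `v ↦ g v`, `sv ↦ t · s(g v)`
and `w ↦ t⁻¹ w`. -/
structure IsNaturalInclusion
    (j : ∀ (A : Type) [CommRing A] [Algebra ℝ A], M.Aut A × Aˣ →* M.cyclification.Aut A) :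
    Prop where
  injective : ∀ (A : Type) [CommRing A] [Algebra ℝ A], Function.Injective (j A)
  natural : ∀ (A B : Type) [CommRing A] [Algebra ℝ A] [CommRing B] [Algebra ℝ B] (f : A →ₐ[ℝ] B)
    (g : M.Aut A) (g' : M.Aut B) (t : Aˣ), M.IsBaseChange f g g' →
      M.cyclification.IsBaseChange f (j A (g, t)) (j B (g', Units.map f t))
  map_v : ∀ (A : Type) [CommRing A] [Algebra ℝ A] (g : M.Aut A) (t : Aˣ) (v : V),
    (j A (g, t)).1 (M.genA A (inV M.gr v)) = M.inclA A (g.1 (1 ⊗ₜ[ℝ] ι M.gr v))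
  map_sv : ∀ (A : Type) [CommRing A] [Algebra ℝ A] (g : M.Aut A) (t : Aˣ) (v : V),
    (j A (g, t)).1 (M.genA A (inS M.gr v)) =
      (t : A) • M.sA A (M.inclA A (g.1 (1 ⊗ₜ[ℝ] ι M.gr v)))
  map_w : ∀ (A : Type) [CommRing A] [Algebra ℝ A] (g : M.Aut A) (t : Aˣ),
    (j A (g, t)).1 (M.genA A (genW M.gr)) = ((t⁻¹ : Aˣ) : A) • M.genA A (genW M.gr)

/-- The image of `T × 𝔾_m` under `j : Aut M × 𝔾_m → Aut M_c`. -/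
noncomputable def prodGm (j : ∀ (A : Type) [CommRing A] [Algebra ℝ A], M.Aut A × Aˣ →* M.cyclification.Aut A)
    (T : M.SubgroupFamily) : M.cyclification.SubgroupFamily :=
  fun A _ _ => ((T A).prod ⊤).map (j A)

end MinimalSullivanAlgebra

end Sullivan

/-! The maximality claims rest on one criterion: a split torus in `Aut M` whose dimension equals dim
P(M) is maximal (`IsSplitTorus.isMaximal`).

A split torus decomposes M into weight spaces, compatibly with degree and differential. A point of
the torus that acts trivially on P(M) acts trivially on M (`act_eq_self`): going up through degrees
and the Sullivan filtration, a weight component of a generator on which the point is nontrivial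
would be closed, because its differential is already fixed; so it would either give a weight of P(M)
or be decomposable, hence fixed. Thus the weights on P(M) separate the points of the torus over
every ℝ-algebra. If there are as many weights as the torus has dimensions, they form a basis of the
character lattice (`exists_chi_eq`), so T realizes every diagonal matrix in a weight basis of P(M).
A larger split torus T' is diagonal in a basis of the same length; each of its points therefore acts
on P(M) like a point of T, and equals that point.

For the cyclification, a quadratic differential makes the linear part of a closed element closed, so
P is the space of closed generators (`IsQuadratic.rank_P`), and d_c is again quadratic. A generator
v + su + cw is closed only if dv = 0, s(du) = 0 and sv · w = 0, as setting some of the new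
generators to zero shows. The last equation puts v in V¹. A contraction sv ↦ v shows that s is
injective on quadratic elements without component of degree two, so u is closed up to an element of
V¹, which s does not see. The closed generators of M_c are therefore a copy of ker d ∩ V together
with w (`IsQuadratic.exists_closedGenMap_eq`), and dim P grows by one.

The action of (g, t) respects d_c because the factors t on V[1] and t⁻¹ on w cancel in sv · w. So T
× 𝔾_m is a split torus of dimension dim P(M_c), and the criterion applies to M_c. -/

namespace Sullivan

universe u

open FreeGC

/-! ### Laurent polynomials and characters -/

/-- Laurent polynomials in `m` variables over `A`. -/
abbrev Laurent (A : Type) [CommRing A] (m : ℕ) : Type := AddMonoidAlgebra A (Fin m → ℤ)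

/-- The character `t ↦ t ^ χ` of `𝔾_mᵐ`. -/
def chi {A : Type} [CommRing A] {m : ℕ} (t : Fin m → Aˣ) (χ : Fin m → ℤ) : Aˣ := ∏ i, t i ^ χ i

section chi

variable {A B : Type} [CommRing A] [CommRing B] {m : ℕ}

theorem chi_mul (s t : Fin m → Aˣ) (χ : Fin m → ℤ) : chi (s * t) χ = chi s χ * chi t χ := by
  simp [chi, mul_zpow, Finset.prod_mul_distrib]

theorem chi_one (χ : Fin m → ℤ) : chi (1 : Fin m → Aˣ) χ = 1 := by simp [chi]

theorem chi_add (t : Fin m → Aˣ) (χ ψ : Fin m → ℤ) : chi t (χ + ψ) = chi t χ * chi t ψ := by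
  simp [chi, zpow_add, Finset.prod_mul_distrib]

theorem chi_zero (t : Fin m → Aˣ) : chi t 0 = 1 := by simp [chi]

theorem chi_single (t : Fin m → Aˣ) (i : Fin m) : chi t (Pi.single i 1) = t i := by
  rw [chi, Finset.prod_eq_single i]
  · simp
  · intro j _ hj; simp [hj]
  · simp

theorem map_chi (f : A →* B) (t : Fin m → Aˣ) (χ : Fin m → ℤ) :
    chi (fun i => Units.map f (t i)) χ = Units.map f (chi t χ) := by
  simp [chi, map_prod, map_zpow]

/-- A tuple in an abelian group G becomes a point of the torus through a homomorphism to units, and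
characters become integer combinations in G. This turns statements about points into statements
about lattices. -/
theorem chi_of_hom {G : Type*} [AddCommGroup G] (F : Multiplicative G →* Aˣ)
    (e : Fin m → G) (χ : Fin m → ℤ) :
    chi (fun i => F (Multiplicative.ofAdd (e i))) χ =
      F (Multiplicative.ofAdd (∑ i, χ i • e i)) := by
  rw [chi, ofAdd_sum, map_prod]
  exact Finset.prod_congr rfl fun i _ => by rw [ofAdd_zsmul, map_zpow]

/-- The monomials of a group algebra, as units. -/
noncomputable def monomialUnit (A : Type) [CommRing A] (G : Type) [AddCommGroup G] :
    Multiplicative G →* (AddMonoidAlgebra A G)ˣ :=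
  (Units.map (AddMonoidAlgebra.of A G)).comp toUnits.toMonoidHom

theorem coe_monomialUnit (G : Type) [AddCommGroup G] (g : G) :
    (monomialUnit A G (Multiplicative.ofAdd g) : AddMonoidAlgebra A G) =
      AddMonoidAlgebra.single g 1 := rfl

/-- The coordinates of `𝔾_mᵐ`. -/
noncomputable def coord (A : Type) [CommRing A] (m : ℕ) (i : Fin m) : (Laurent A m)ˣ :=
  monomialUnit A (Fin m → ℤ) (Multiplicative.ofAdd (Pi.single i 1))

theorem coe_chi_coord (χ : Fin m → ℤ) :
    (chi (coord A m) χ : Laurent A m) = AddMonoidAlgebra.single χ 1 := by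
  have h : ∑ i, χ i • (Pi.single i 1 : Fin m → ℤ) = χ := by
    ext j
    simp [Finset.sum_apply, Pi.single_apply]
  have := chi_of_hom (monomialUnit A (Fin m → ℤ)) (fun i => Pi.single i 1) χ
  rw [h] at this
  rw [← coe_monomialUnit, ← this]
  rfl

/-- Evaluation of Laurent polynomials at a point of `𝔾_mᵐ`. -/
noncomputable def evalLaurent [Algebra ℝ A] (t : Fin m → Aˣ) : Laurent ℝ m →ₐ[ℝ] A :=
  AddMonoidAlgebra.lift ℝ A (Fin m → ℤ)
    { toFun := fun χ => chi t χ.toAdd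
      map_one' := by simp [chi_zero]
      map_mul' := fun χ ψ => by simp [chi_add] }

theorem evalLaurent_single [Algebra ℝ A] (t : Fin m → Aˣ) (χ : Fin m → ℤ) :
    evalLaurent t (AddMonoidAlgebra.single χ 1) = chi t χ := by
  simp [evalLaurent, AddMonoidAlgebra.lift_single]

/-- Yoneda for 𝔾_mᵐ: every point is the image of the universal point `coord ℝ m`, so by naturality
the action of that single point determines the whole action. -/
theorem evalLaurent_coord [Algebra ℝ A] (t : Fin m → Aˣ) (i : Fin m) :
    Units.map (evalLaurent t : Laurent ℝ m →* A) (coord ℝ m i) = t i := by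
  ext
  simp only [Units.coe_map, MonoidHom.coe_coe]
  rw [coord, coe_monomialUnit, evalLaurent_single, chi_single]

/-- The coefficient of a monomial in a Laurent polynomial with coefficients in a vector space. -/
noncomputable def coeffT (A : Type) [CommRing A] [Algebra ℝ A] {m : ℕ} (X : Type u)
    [AddCommGroup X] [Module ℝ X] (χ : Fin m → ℤ) : Laurent A m ⊗[ℝ] X →ₗ[ℝ] A ⊗[ℝ] X :=
  LinearMap.rTensor X (Finsupp.lapply χ ∘ₗ (AddMonoidAlgebra.coeffLinearEquiv ℝ).toLinearMap)

theorem coeffT_tmul [Algebra ℝ A] {X : Type u} [AddCommGroup X] [Module ℝ X]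
    (χ : Fin m → ℤ) (a : Laurent A m) (x : X) : coeffT A X χ (a ⊗ₜ x) = a.coeff χ ⊗ₜ x := rfl

end chi

/-! ### Weight decomposition of M under a split torus -/

namespace MinimalSullivanAlgebra

variable {V : Type u} [AddCommGroup V] [Module ℝ V] {M : MinimalSullivanAlgebra V}

/-- A parametrization of a split torus in `Aut M`. -/
structure TorusParam (T : M.SubgroupFamily) (m : ℕ) where
  /-- the isomorphism with `𝔾_mᵐ` -/
  toEquiv : ∀ (A : Type) [CommRing A] [Algebra ℝ A], (Fin m → Aˣ) ≃* T A
  natural : ∀ (A B : Type) [CommRing A] [Algebra ℝ A] [CommRing B] [Algebra ℝ B] (f : A →ₐ[ℝ] B)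
      (t : Fin m → Aˣ), M.IsBaseChange f (toEquiv A t).1 (toEquiv B fun i => Units.map f (t i)).1

theorem IsSplitTorus.nonempty_param {T : M.SubgroupFamily} {m : ℕ} (h : IsSplitTorus T m) :
    Nonempty (TorusParam T m) := ⟨⟨h.choose, h.choose_spec⟩⟩

namespace TorusParam

variable {T : M.SubgroupFamily} {m : ℕ} (P : TorusParam T m)

/-- The action of a point of the torus on `A ⊗ M`. -/
def act {A : Type} [CommRing A] [Algebra ℝ A] (t : Fin m → Aˣ) :
    (A ⊗[ℝ] M.S) ≃ₐ[A] (A ⊗[ℝ] M.S) := (P.toEquiv A t).1.1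

variable {A B : Type} [CommRing A] [Algebra ℝ A] [CommRing B] [Algebra ℝ B]

theorem act_mul (s t : Fin m → Aˣ) (x : A ⊗[ℝ] M.S) : P.act (s * t) x = P.act s (P.act t x) := by
  simp [act]

theorem act_one (x : A ⊗[ℝ] M.S) : P.act (1 : Fin m → Aˣ) x = x := by
  simp [act]

theorem act_map (f : A →ₐ[ℝ] B) (t : Fin m → Aˣ) (x : A ⊗[ℝ] M.S) :
    P.act (fun i => Units.map (f : A →* B) (t i))
      (Algebra.TensorProduct.map f (AlgHom.id ℝ M.S) x) =
    Algebra.TensorProduct.map f (AlgHom.id ℝ M.S) (P.act t x) :=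
  (P.natural A B f t x).symm

/-- The weight component of an element of `M`. -/
noncomputable def comp (χ : Fin m → ℤ) : M.S →ₗ[ℝ] M.S :=
  (TensorProduct.lid ℝ M.S).toLinearMap ∘ₗ coeffT ℝ M.S χ ∘ₗ
    ((P.act (coord ℝ m)).toLinearMap.restrictScalars ℝ) ∘ₗ TensorProduct.mk ℝ (Laurent ℝ m) M.S 1

theorem comp_apply (χ : Fin m → ℤ) (x : M.S) :
    P.comp χ x = TensorProduct.lid ℝ M.S (coeffT ℝ M.S χ (P.act (coord ℝ m) (1 ⊗ₜ x))) := rfl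

/-- The expansion is asserted for every larger index set so that the expansions of two summands can
be added over a common one. -/
theorem exists_eq_sum_single {X : Type u} [AddCommGroup X] [Module ℝ X]
    (z : Laurent ℝ m ⊗[ℝ] X) : ∃ s : Finset (Fin m → ℤ), ∀ s', s ⊆ s' →
      z = ∑ χ ∈ s', AddMonoidAlgebra.single χ 1 ⊗ₜ TensorProduct.lid ℝ X (coeffT ℝ X χ z) := by
  induction z using TensorProduct.induction_on with
  | zero => exact ⟨∅, by simp⟩
  | tmul a x =>
    refine ⟨a.coeff.support, fun s' hs => ?_⟩
    conv_lhs => rw [← AddMonoidAlgebra.sum_coeff_single a]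
    rw [Finsupp.sum_of_support_subset _ hs _ (by simp), TensorProduct.sum_tmul]
    refine Finset.sum_congr rfl fun χ _ => ?_
    rw [coeffT_tmul, TensorProduct.lid_tmul, TensorProduct.tmul_smul, TensorProduct.smul_tmul',
      AddMonoidAlgebra.smul_single, smul_eq_mul, mul_one]
  | add a b ha hb =>
    classical
    obtain ⟨s, hs⟩ := ha
    obtain ⟨t, ht⟩ := hb
    refine ⟨s ∪ t, fun s' h => ?_⟩
    simp only [map_add, TensorProduct.tmul_add, Finset.sum_add_distrib]
    rw [← hs s' (Finset.union_subset_left h), ← ht s' (Finset.union_subset_right h)]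

/-- A finite set of weights that contains all those of the components of `x`. -/
theorem exists_weights (x : M.S) : ∃ s : Finset (Fin m → ℤ),
    ∀ (A : Type) [CommRing A] [Algebra ℝ A] (t : Fin m → Aˣ),
      P.act t (1 ⊗ₜ x) = ∑ χ ∈ s, (chi t χ : A) ⊗ₜ[ℝ] P.comp χ x := by
  obtain ⟨s, hs⟩ := exists_eq_sum_single (P.act (coord ℝ m) (1 ⊗ₜ x))
  refine ⟨s, fun A _ _ t => ?_⟩
  -- The action of t is the specialization of the universal action, whose finite monomial expansion
  -- does not depend on A or t.
  have h := P.act_map (evalLaurent t) (coord ℝ m) (1 ⊗ₜ x)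
  simp only [evalLaurent_coord, Algebra.TensorProduct.map_tmul, map_one, AlgHom.id_apply] at h
  rw [h, hs s subset_rfl, map_sum]
  refine Finset.sum_congr rfl fun χ _ => ?_
  rw [Algebra.TensorProduct.map_tmul, evalLaurent_single]
  rfl

/-- `x` is a vector of weight `χ`. -/
def IsWeight (χ : Fin m → ℤ) (x : M.S) : Prop :=
  ∀ (A : Type) [CommRing A] [Algebra ℝ A] (t : Fin m → Aˣ),
    P.act t (1 ⊗ₜ x) = (chi t χ : A) ⊗ₜ[ℝ] x

theorem coeffT_single_smul (χ ψ : Fin m → ℤ) (w : A ⊗[ℝ] M.S) :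
    coeffT A M.S χ ((AddMonoidAlgebra.single ψ 1 : Laurent A m) •
      Algebra.TensorProduct.map (AddMonoidAlgebra.singleZeroAlgHom : A →ₐ[ℝ] Laurent A m)
        (AlgHom.id ℝ M.S) w) = if ψ = χ then w else 0 := by
  induction w using TensorProduct.induction_on with
  | zero => simp
  | tmul a x =>
    rw [Algebra.TensorProduct.map_tmul, TensorProduct.smul_tmul', coeffT_tmul]
    have : (AddMonoidAlgebra.singleZeroAlgHom : A →ₐ[ℝ] Laurent A m) a =
      AddMonoidAlgebra.single 0 a := rfl
    rw [this, smul_eq_mul, AddMonoidAlgebra.single_mul_single, AddMonoidAlgebra.coeff_single,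
      Finsupp.single_apply]
    simp only [add_zero, one_mul]
    split_ifs <;> simp
  | add a b ha hb =>
    rw [map_add, smul_add, map_add, ha, hb]
    split_ifs <;> simp

/-- Over A[X^±1] the product of t and the universal point acts in two ways: directly, with
χ-coefficient χ(t) ⊗ x_χ, and successively, with χ-coefficient t · (1 ⊗ x_χ). Multiplicativity of
the action identifies the coefficients. -/
theorem comp_isWeight (χ : Fin m → ℤ) (x : M.S) : P.IsWeight χ (P.comp χ x) := by
  classical
  intro A _ _ t
  obtain ⟨s, hs⟩ := P.exists_weights x
  let i : A →ₐ[ℝ] Laurent A m := AddMonoidAlgebra.singleZeroAlgHom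
  let t' : Fin m → (Laurent A m)ˣ := fun j => Units.map (i : A →* Laurent A m) (t j)
  have h := P.act_mul t' (coord A m) (1 ⊗ₜ x)
  rw [hs, hs, map_sum] at h
  have h2 : ∀ ψ, P.act t' ((chi (coord A m) ψ : Laurent A m) ⊗ₜ[ℝ] P.comp ψ x) =
      (AddMonoidAlgebra.single ψ 1 : Laurent A m) •
        Algebra.TensorProduct.map i (AlgHom.id ℝ M.S) (P.act t (1 ⊗ₜ P.comp ψ x)) := by
    intro ψ
    rw [← P.act_map, coe_chi_coord, ← map_smul, Algebra.TensorProduct.map_tmul, map_one,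
      TensorProduct.smul_tmul', smul_eq_mul, mul_one]
    rfl
  have h3 : ∀ ψ, ((chi (t' * coord A m) ψ : (Laurent A m)ˣ) : Laurent A m) ⊗ₜ[ℝ] P.comp ψ x =
      (AddMonoidAlgebra.single ψ 1 : Laurent A m) •
        Algebra.TensorProduct.map i (AlgHom.id ℝ M.S) ((chi t ψ : A) ⊗ₜ P.comp ψ x) := by
    intro ψ
    rw [chi_mul, map_chi, Units.val_mul, coe_chi_coord, Algebra.TensorProduct.map_tmul,
      TensorProduct.smul_tmul', smul_eq_mul, mul_comm]
    rfl
  have h4 := congrArg (coeffT A M.S χ) h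
  simp only [h2, h3, map_sum] at h4
  simp only [i, coeffT_single_smul, Finset.sum_ite_eq'] at h4
  by_cases hχ : χ ∈ s
  · simpa [hχ] using h4.symm
  -- A weight outside the finite set `s` occurs in no term of the expansion, so its component
  -- vanishes and there is nothing to show.
  · have : P.comp χ x = 0 := by
      rw [comp_apply, hs, map_sum]
      rw [Finset.sum_eq_zero, map_zero]
      intro ψ hψ
      rw [coeffT_tmul, coe_chi_coord, AddMonoidAlgebra.coeff_single,
        Finsupp.single_eq_of_ne (by rintro rfl; exact hχ hψ), TensorProduct.zero_tmul]
    simp [this]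

theorem exists_sum_comp (x : M.S) : ∃ s : Finset (Fin m → ℤ), x = ∑ χ ∈ s, P.comp χ x := by
  obtain ⟨s, hs⟩ := P.exists_weights x
  refine ⟨s, ?_⟩
  -- All characters equal 1 at the identity, so evaluating there recovers x as the sum of its
  -- components.
  have h := hs ℝ 1
  rw [act_one] at h
  simp only [chi_one] at h
  have := congrArg (TensorProduct.lid ℝ M.S) h
  simpa using this

/-- An element lies in every subspace that contains its weight components. -/
theorem mem_of_comp_mem {N : Submodule ℝ M.S} {x : M.S} (h : ∀ χ, P.comp χ x ∈ N) : x ∈ N := by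
  obtain ⟨s, hs⟩ := P.exists_sum_comp x
  rw [hs]
  exact N.sum_mem fun χ _ => h χ

theorem comp_of_isWeight {χ : Fin m → ℤ} {x : M.S} (hx : P.IsWeight χ x) (ψ : Fin m → ℤ) :
    P.comp ψ x = if χ = ψ then x else 0 := by
  rw [comp_apply, hx, coe_chi_coord, coeffT_tmul, AddMonoidAlgebra.coeff_single,
    Finsupp.single_apply]
  split_ifs <;> simp

theorem comp_deg {n : ℕ} {x : M.S} (hx : x ∈ deg M.gr n) (χ : Fin m → ℤ) :
    P.comp χ x ∈ deg M.gr n := by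
  have h1 : P.act (coord ℝ m) (1 ⊗ₜ x) ∈ (deg M.gr n).baseChange (Laurent ℝ m) :=
    ((P.toEquiv _ (coord ℝ m)).1.2.1 n _).2 (Submodule.tmul_mem_baseChange_of_mem _ hx)
  obtain ⟨z, hz⟩ := h1
  rw [comp_apply, ← hz]
  clear hz
  induction z using TensorProduct.induction_on with
  | zero => simp
  | tmul a y =>
    rw [LinearMap.baseChange_tmul, coeffT_tmul, TensorProduct.lid_tmul]
    exact Submodule.smul_mem _ _ y.2
  | add a b ha hb => simp only [map_add]; exact Submodule.add_mem _ ha hb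

theorem act_d (t : Fin m → Aˣ) (x : A ⊗[ℝ] M.S) :
    P.act t (M.d.baseChange A x) = M.d.baseChange A (P.act t x) := (P.toEquiv A t).1.2.2 x

theorem act_deg (t : Fin m → Aˣ) {n : ℕ} {x : A ⊗[ℝ] M.S}
    (hx : x ∈ (deg M.gr n).baseChange A) : P.act t x ∈ (deg M.gr n).baseChange A :=
  ((P.toEquiv A t).1.2.1 n x).2 hx

/-- The universal point commutes with d, and d is extended linearly in the Laurent variables, so it
can be compared coefficient by coefficient. -/
theorem comp_d (χ : Fin m → ℤ) (x : M.S) : P.comp χ (M.d x) = M.d (P.comp χ x) := by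
  rw [comp_apply, comp_apply, ← LinearMap.baseChange_tmul, act_d]
  generalize P.act (coord ℝ m) (1 ⊗ₜ x) = z
  induction z using TensorProduct.induction_on with
  | zero => simp
  | tmul a y =>
    rw [LinearMap.baseChange_tmul, coeffT_tmul, coeffT_tmul, TensorProduct.lid_tmul,
      TensorProduct.lid_tmul, map_smul]
  | add a b ha hb => simp only [map_add, ha, hb]

theorem comp_plus {x : M.S} (hx : x ∈ plus M.gr) (χ : Fin m → ℤ) : P.comp χ x ∈ plus M.gr := by
  have : plus M.gr ≤ (plus M.gr).comap (P.comp χ) :=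
    iSup_le fun n y hy => Submodule.mem_iSup_of_mem n (P.comp_deg hy χ)
  exact this hx

theorem comp_closedPlus {x : M.S} (hx : x ∈ M.closedPlus) (χ : Fin m → ℤ) :
    P.comp χ x ∈ M.closedPlus := by
  refine ⟨P.comp_plus hx.1 χ, ?_⟩
  change M.d _ = 0
  rw [← comp_d, LinearMap.mem_ker.1 hx.2, map_zero]

end TorusParam

end MinimalSullivanAlgebra

/-! ### Degree projections and truncation of generators -/

section Degree

variable {V : Type u} [AddCommGroup V] [Module ℝ V] {gr : ℕ → Submodule ℝ V}

/-- The projection of `S(V)` to the part of degree `n`. -/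
noncomputable def degProj (h : IsGrading gr) (n : ℕ) : FreeGC gr →ₗ[ℝ] FreeGC gr :=
  ((Polynomial.lcoeff (FreeGC gr) n).restrictScalars ℝ) ∘ₗ (gradingHom h).toLinearMap

theorem degProj_deg (h : IsGrading gr) (n : ℕ) {k : ℕ} {y : FreeGC gr} (hy : y ∈ deg gr k) :
    degProj h n y = if k = n then y else 0 := by
  simp [degProj, gradingHom_deg h hy, Polynomial.coeff_monomial]

/-- In each degree, decomposable elements are sums of products of elements of positive degrees. -/
theorem decomposable_mem (h : IsGrading gr) {n : ℕ} {N : Submodule ℝ (FreeGC gr)}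
    (hN : ∀ i j a b, 0 < i → 0 < j → i + j = n → a ∈ deg gr i → b ∈ deg gr j → a * b ∈ N)
    {x : FreeGC gr} (hx : x ∈ deg gr n) (hx' : x ∈ plus gr * plus gr) : x ∈ N := by
  have hle : plus gr * plus gr ≤ N.comap (degProj h n) := by
    rw [plus, Submodule.iSup_mul]
    refine iSup_le fun i => ?_
    rw [Submodule.mul_iSup]
    refine iSup_le fun j => ?_
    rw [Submodule.mul_le]
    intro a ha b hb
    rw [Submodule.mem_comap, degProj_deg h n (mul_mem_deg ha hb)]
    split_ifs with hij
    · exact hN _ _ a b i.succ_pos j.succ_pos hij ha hb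
    · exact N.zero_mem
  have := hle hx'
  rwa [Submodule.mem_comap, degProj_deg h n hx, if_pos rfl] at this

/-- The endomorphism of `S(V)` that kills the generators of degree greater than `p`. -/
noncomputable def trunc (h : IsGrading gr) (p : ℕ) : FreeGC gr →ₐ[ℝ] FreeGC gr :=
  lift (fromGr h fun n => if n ≤ p then ι gr else 0) (by
    intro m n x y hx hy
    rw [fromGr_apply h _ hx, fromGr_apply h _ hy]
    by_cases hm : m ≤ p <;> by_cases hn : n ≤ p <;> simp [hm, hn, ι_comm hx hy])

theorem trunc_ι (h : IsGrading gr) (p : ℕ) {n : ℕ} {v : V} (hv : v ∈ gr n) :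
    trunc h p (ι gr v) = if n ≤ p then ι gr v else 0 := by
  rw [trunc, lift_ι, fromGr_apply h _ hv]
  split_ifs <;> rfl

theorem trunc_deg (h : IsGrading gr) {p n : ℕ} {x : FreeGC gr} (hx : x ∈ deg gr n) (hn : n ≤ p) :
    trunc h p x = x := by
  refine deg_induction (p := fun n x => n ≤ p → trunc h p x = x) ?_ ?_ ?_ ?_ ?_ hx hn
  · simp
  · intro a b v y hv hy ih hab
    rw [map_mul, trunc_ι h p hv, if_pos (by omega), ih (by omega)]
  · simp
  · intro n x y hx hy hn
    rw [map_add, hx hn, hy hn]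
  · intro n r x hx hn
    rw [map_smul, hx hn]

/-- Both factors of a product of positive-degree elements of total degree p + 1 have degree at most
p, so no generator of degree above p occurs. This applies to dv for v of degree p. -/
theorem trunc_decomposable (h : IsGrading gr) {p : ℕ} {x : FreeGC gr} (hx : x ∈ deg gr (p + 1))
    (hx' : x ∈ plus gr * plus gr) : trunc h p x = x := by
  refine decomposable_mem h
    (N := LinearMap.eqLocus (trunc h p).toLinearMap LinearMap.id) ?_ hx hx'
  intro i j a b hi hj hij ha hb
  rw [LinearMap.mem_eqLocus, AlgHom.toLinearMap_apply, map_mul, trunc_deg h ha (by omega),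
    trunc_deg h hb (by omega), LinearMap.id_apply]

end Degree

/-! ### Detecting zero coefficients after extension of scalars -/

section BaseChange

variable {A : Type} [CommRing A] [Algebra ℝ A] {X : Type u} [AddCommGroup X] [Module ℝ X]

/-- A functional that vanishes on N but not at x extends A-linearly and reads off a up to a nonzero
real factor. Hence A may have zero divisors. -/
theorem eq_zero_of_tmul_mem_baseChange {N : Submodule ℝ X} {a : A} {x : X}
    (h : a ⊗ₜ[ℝ] x ∈ N.baseChange A) (hx : x ∉ N) : a = 0 := by
  obtain ⟨f, hf, hN⟩ := Submodule.exists_dual_map_eq_bot_of_notMem hx inferInstance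
  let F : A ⊗[ℝ] X →ₗ[A] A := (TensorProduct.AlgebraTensorModule.rid ℝ A A).toLinearMap ∘ₗ
    LinearMap.baseChange A f
  have hF : ∀ y ∈ N.baseChange A, F y = 0 := by
    rintro _ ⟨z, rfl⟩
    induction z using TensorProduct.induction_on with
    | zero => simp
    | tmul b y =>
      have : f y = 0 := by
        have : f y ∈ N.map f := ⟨y, y.2, rfl⟩
        rwa [hN, Submodule.mem_bot] at this
      simp [F, this]
    | add b c hb hc => rw [map_add, map_add, hb, hc, add_zero]
  have h0 := hF _ h
  have h1 : f x • a = 0 := by simpa [F] using h0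
  exact (smul_eq_zero.1 h1).resolve_left hf

theorem eq_zero_of_tmul_eq_zero {a : A} {x : X} (h : a ⊗ₜ[ℝ] x = 0) (hx : x ≠ 0) : a = 0 :=
  eq_zero_of_tmul_mem_baseChange (N := ⊥) (by rw [h]; exact Submodule.zero_mem _) (by simpa using hx)

end BaseChange

/-! ### Rigidity: a torus point is determined by its action on P(M) -/

namespace MinimalSullivanAlgebra.TorusParam

variable {V : Type u} [AddCommGroup V] [Module ℝ V] {M : MinimalSullivanAlgebra V}
  {T : M.SubgroupFamily} {m : ℕ} (P : TorusParam T m) {A : Type} [CommRing A] [Algebra ℝ A]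

theorem baseChange_comp_act (t : Fin m → Aˣ) (χ : Fin m → ℤ) (y : M.S) :
    (P.comp χ).baseChange A (P.act t (1 ⊗ₜ y)) = (chi t χ : A) ⊗ₜ[ℝ] P.comp χ y := by
  obtain ⟨s, hs⟩ := P.exists_sum_comp y
  conv_lhs => rw [hs]
  conv_rhs => rw [hs]
  simp only [TensorProduct.tmul_sum, map_sum]
  refine Finset.sum_congr rfl fun ψ _ => ?_
  rw [P.comp_isWeight ψ y, LinearMap.baseChange_tmul, P.comp_of_isWeight (P.comp_isWeight ψ y)]
  split_ifs with h
  · rw [h]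
  · simp

/-- The subalgebra of `M` fixed by a point of the torus. -/
noncomputable def fixed (t : Fin m → Aˣ) : Subalgebra ℝ M.S :=
  AlgHom.equalizer (((P.act t).toAlgHom.restrictScalars ℝ).comp
    (Algebra.TensorProduct.includeRight : M.S →ₐ[ℝ] A ⊗[ℝ] M.S)) Algebra.TensorProduct.includeRight

theorem mem_fixed {t : Fin m → Aˣ} {x : M.S} : x ∈ P.fixed t ↔ P.act t (1 ⊗ₜ x) = 1 ⊗ₜ x :=
  Iff.rfl

/-- Taking χ-components of t · y = y gives (χ(t) − 1) ⊗ y_χ = 0, and y_χ is a vector over a field.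
-/
theorem comp_eq_zero_of_mem_fixed {t : Fin m → Aˣ} {χ : Fin m → ℤ} {y : M.S}
    (hy : y ∈ P.fixed t) (hχ : chi t χ ≠ 1) : P.comp χ y = 0 := by
  by_contra h0
  have h := P.baseChange_comp_act t χ y
  rw [P.mem_fixed.1 hy, LinearMap.baseChange_tmul] at h
  have h1 : ((chi t χ : A) - 1) ⊗ₜ[ℝ] P.comp χ y = 0 := by
    rw [TensorProduct.sub_tmul, h, sub_self]
  exact hχ (Units.ext (by simpa using sub_eq_zero.1 (eq_zero_of_tmul_eq_zero h1 h0)))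

/-- A double induction, on the degree p and then on the Sullivan filtration within degree p. The
inner one is needed because generators of degree one are allowed: dv may contain generators of the
same degree as v. -/
theorem ι_mem_fixed {t : Fin m → Aˣ}
    (ht : ∀ (z : M.S) (χ : Fin m → ℤ), z ∈ M.closedPlus → P.IsWeight χ z →
      z ∉ plus M.gr * plus M.gr → chi t χ = 1) (p : ℕ) :
    ∀ v ∈ M.gr p, ι M.gr v ∈ P.fixed t := by
  induction p using Nat.strong_induction_on with
  | _ p ih =>
  have hdeg : ∀ q < p, ∀ x ∈ deg M.gr q, x ∈ P.fixed t := by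
    intro q hq x hx
    refine deg_induction (p := fun q x => q < p → x ∈ P.fixed t) ?_ ?_ ?_ ?_ ?_ hx hq
    · exact fun _ => Subalgebra.one_mem _
    · intro a b v y hv hy ihy hab
      exact Subalgebra.mul_mem _ (ih a (by omega) v hv) (ihy (by omega))
    · exact fun _ _ => Subalgebra.zero_mem _
    · exact fun n x y hx hy hn => Subalgebra.add_mem _ (hx hn) (hy hn)
    · exact fun n r x hx hn => Subalgebra.smul_mem _ (hx hn) r
  have hdec : ∀ x ∈ deg M.gr p, x ∈ plus M.gr * plus M.gr → x ∈ P.fixed t := by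
    intro x hx hx'
    refine decomposable_mem M.grading (N := Subalgebra.toSubmodule (P.fixed t)) ?_ hx hx'
    intro i j a b hi hj hij ha hb
    exact Subalgebra.mul_mem _ (hdeg i (by omega) a ha) (hdeg j (by omega) b hb)
  -- Suppose dv is fixed. A component of v whose weight is nontrivial at t has zero differential, so
  -- it is closed; being indecomposable would contradict `ht`, so it is decomposable and fixed by
  -- the degree induction. Components with trivial weight at t are fixed anyway.
  have hd : ∀ v ∈ M.gr p, M.d (ι M.gr v) ∈ P.fixed t → ι M.gr v ∈ P.fixed t := by
    intro v hv hdv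
    refine P.mem_of_comp_mem (N := Subalgebra.toSubmodule (P.fixed t)) fun χ => ?_
    rw [Subalgebra.mem_toSubmodule]
    by_cases hχ : chi t χ = 1
    · rw [mem_fixed, P.comp_isWeight χ, hχ, Units.val_one]
    · refine hdec _ (P.comp_deg (ι_mem_deg hv) χ) ?_
      by_contra h2
      refine hχ (ht _ χ ⟨P.comp_plus
        (ι_mem_plus M.grading.iSup_eq M.grading.zero v) χ, ?_⟩ (P.comp_isWeight χ _) h2)
      change M.d _ = 0
      rw [← comp_d, P.comp_eq_zero_of_mem_fixed hdv hχ]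
  obtain ⟨F, -, hun, hhom, h0, hstep⟩ := M.sullivan
  have hF : ∀ k, ∀ v ∈ F k ⊓ M.gr p, ι M.gr v ∈ P.fixed t := by
    intro k
    induction k with
    | zero =>
      intro v hv
      refine hd v hv.2 ?_
      rw [h0 v hv.1]
      exact Subalgebra.zero_mem _
    | succ k ihk =>
      intro v hv
      refine hd v hv.2 ?_
      -- The generators in `F k` may have degree above p, where nothing is known yet. Truncation
      -- removes them without changing dv; what remains is covered by the outer induction below p
      -- and by the inner one in degree p.
      have hle : Algebra.adjoin ℝ (ι M.gr '' (F k : Set V)) ≤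
          (P.fixed t).comap (trunc M.grading p) := by
        rw [Algebra.adjoin_le_iff]
        rintro _ ⟨w, hw, rfl⟩
        have hw' : (⨆ n, F k ⊓ M.gr n) ≤ (Subalgebra.toSubmodule (P.fixed t)).comap
            ((trunc M.grading p).toLinearMap ∘ₗ ι M.gr) := by
          refine iSup_le fun q w hw => ?_
          change trunc M.grading p (ι M.gr w) ∈ P.fixed t
          rw [trunc_ι M.grading p hw.2]
          split_ifs with hq
          · rcases hq.lt_or_eq with hq | rfl
            · exact ih q hq w hw.2
            · exact ihk w hw
          · exact Subalgebra.zero_mem _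
        exact hw' (hhom k hw)
      have := hle (hstep k v hv.1)
      rwa [Subalgebra.mem_comap, trunc_decomposable M.grading
        (M.d_deg p _ (ι_mem_deg hv.2)) (M.minimal _)] at this
  intro v hv
  obtain ⟨k, hk⟩ := hun v
  exact hF k v ⟨hk, hv⟩

/-- A point of the torus is determined by its action on the classes of closed elements. -/
theorem act_eq_self {t : Fin m → Aˣ}
    (ht : ∀ (z : M.S) (χ : Fin m → ℤ), z ∈ M.closedPlus → P.IsWeight χ z →
      z ∉ plus M.gr * plus M.gr → chi t χ = 1) (x : A ⊗[ℝ] M.S) : P.act t x = x := by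
  have hfix : ∀ x : M.S, x ∈ P.fixed t := by
    intro x
    induction x using induction_on M.grading.iSup_eq with
    | add a b ha hb => exact Subalgebra.add_mem _ ha hb
    | hp n x hx =>
      refine deg_induction (p := fun _ x => x ∈ P.fixed t) ?_ ?_ ?_ ?_ ?_ hx
      · exact Subalgebra.one_mem _
      · exact fun a b v y hv _ hy => Subalgebra.mul_mem _ (P.ι_mem_fixed ht a v hv) hy
      · exact fun _ => Subalgebra.zero_mem _
      · exact fun n x y hx hy => Subalgebra.add_mem _ hx hy
      · exact fun n r x hx => Subalgebra.smul_mem _ hx r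
  induction x using TensorProduct.induction_on with
  | zero => simp
  | tmul a x =>
    have : a ⊗ₜ[ℝ] x = a • ((1 : A) ⊗ₜ[ℝ] x) := by rw [TensorProduct.smul_tmul']; simp
    rw [this, map_smul, P.mem_fixed.1 (hfix x)]
  | add a b ha hb => rw [map_add, ha, hb]

theorem toEquiv_eq_one {t : Fin m → Aˣ} (ht : ∀ x : A ⊗[ℝ] M.S, P.act t x = x) :
    P.toEquiv A t = 1 :=
  Subtype.ext (Subtype.ext (AlgEquiv.ext ht))

end MinimalSullivanAlgebra.TorusParam

/-! ### Characters that separate points form a basis of the character lattice -/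

section Characters

/-- If finitely many characters of `𝔾_mⁿ`, as many as its dimension, separate points, then they
identify `𝔾_mⁿ` with itself. -/
theorem exists_chi_eq {n : ℕ} {χ : Fin n → Fin n → ℤ}
    (h : ∀ (A : Type) [CommRing A] [Algebra ℝ A] (t : Fin n → Aˣ),
      (∀ i, chi t (χ i) = 1) → t = 1)
    {A : Type} [CommRing A] (a : Fin n → Aˣ) : ∃ t : Fin n → Aˣ, ∀ i, chi t (χ i) = a i := by
  set L : Submodule ℤ (Fin n → ℤ) := Submodule.span ℤ (Set.range χ) with hL
  have hsum : ∀ ψ : Fin n → ℤ, ∑ i, ψ i • (Pi.single i 1 : Fin n → ℤ) = ψ := by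
    intro ψ
    ext j
    simp [Finset.sum_apply, Pi.single_apply]
  have hmem : ∀ i, (Pi.single i 1 : Fin n → ℤ) ∈ L := by
    -- The test algebra is the group algebra of ℤⁿ / L, with the point whose i-th coordinate is the
    -- monomial of the class of e_i. Every `χ i` lies in L, so it is trivial at this point; the
    -- point is then the identity, and since distinct group elements give distinct monomials, e_i
    -- lies in L.
    let F := monomialUnit ℝ ((Fin n → ℤ) ⧸ L)
    have key := h (AddMonoidAlgebra ℝ ((Fin n → ℤ) ⧸ L))
      (fun i => F (Multiplicative.ofAdd (L.mkQ (Pi.single i 1)))) (fun i => by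
        rw [chi_of_hom]
        simp only [← map_zsmul, ← map_sum]
        rw [hsum, show L.mkQ (χ i) = 0 by
          simpa using Submodule.subset_span (Set.mem_range_self i), ofAdd_zero,
          map_one])
    intro i
    have h1 : F (Multiplicative.ofAdd (L.mkQ (Pi.single i 1))) = 1 := congrFun key i
    have h2 := congrArg Units.val h1
    rw [coe_monomialUnit, Units.val_one, AddMonoidAlgebra.one_def] at h2
    have h3 := (AddMonoidAlgebra.single_left_injective (one_ne_zero (α := ℝ))) h2
    simpa using h3
  have hY : ∀ j, ∃ y : Fin n → ℤ, ∑ i, y i • χ i = Pi.single j 1 := fun j =>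
    (Submodule.mem_span_range_iff_exists_fun ℤ).1 (hmem j)
  choose Y hY using hY
  have hYX : Matrix.of Y * Matrix.of χ = 1 := by
    ext j k
    have := congrFun (hY j) k
    simp only [Finset.sum_apply, Pi.smul_apply, smul_eq_mul] at this
    rw [Matrix.mul_apply, Matrix.one_apply]
    simp only [Matrix.of_apply]
    rw [this, Pi.single_apply]
    simp [eq_comm]
  -- Expressing the e_j through the characters gives a left inverse of their matrix. The matrix is
  -- square, so it is a right inverse as well.
  have hXY := mul_eq_one_comm.1 hYX
  let F : Multiplicative (Fin n → ℤ) →* Aˣ :=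
    { toFun := fun ψ => chi a ψ.toAdd
      map_one' := by simp [chi_zero]
      map_mul' := fun ψ φ => by simp [chi_add] }
  -- The solution is t_j = a^(Y_j), the monomial change of coordinates given by the inverse matrix.
  refine ⟨fun j => F (Multiplicative.ofAdd (Y j)), fun i => ?_⟩
  rw [chi_of_hom]
  have : ∑ j, χ i j • Y j = Pi.single i 1 := by
    ext k
    have := congrFun (congrFun hXY i) k
    rw [Matrix.mul_apply, Matrix.one_apply] at this
    simp only [Matrix.of_apply] at this
    simp only [Finset.sum_apply, Pi.smul_apply, smul_eq_mul]
    rw [this, Pi.single_apply]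
    simp [eq_comm]
  rw [this]
  exact chi_single a i

end Characters

theorem mul_mem_baseChange {A : Type} [CommRing A] [Algebra ℝ A] {S : Type u} [Ring S]
    [Algebra ℝ S] {N N' : Submodule ℝ S} {x y : A ⊗[ℝ] S} (hx : x ∈ N.baseChange A)
    (hy : y ∈ N'.baseChange A) : x * y ∈ (N * N').baseChange A := by
  rw [Submodule.baseChange_eq_span] at hx hy
  induction hx using Submodule.span_induction with
  | zero => rw [zero_mul]; exact Submodule.zero_mem _
  | add a b _ _ ha hb => rw [add_mul]; exact Submodule.add_mem _ ha hb
  | smul r a _ ha => rw [smul_mul_assoc]; exact Submodule.smul_mem _ _ ha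
  | mem x hx =>
    obtain ⟨x, hx, rfl⟩ := hx
    induction hy using Submodule.span_induction with
    | zero => rw [mul_zero]; exact Submodule.zero_mem _
    | add a b _ _ ha hb => rw [mul_add]; exact Submodule.add_mem _ ha hb
    | smul r a _ ha => rw [mul_smul_comm]; exact Submodule.smul_mem _ _ ha
    | mem y hy =>
      obtain ⟨y, hy, rfl⟩ := hy
      rw [TensorProduct.mk_apply, TensorProduct.mk_apply, Algebra.TensorProduct.tmul_mul_tmul]
      exact Submodule.tmul_mem_baseChange_of_mem _ (Submodule.mul_mem_mul hx hy)

/-! ### The maximality criterion -/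

namespace MinimalSullivanAlgebra

variable {V : Type u} [AddCommGroup V] [Module ℝ V] {M : MinimalSullivanAlgebra V}

namespace TorusParam

variable {T : M.SubgroupFamily} {m : ℕ} (P : TorusParam T m) {A : Type} [CommRing A] [Algebra ℝ A]

theorem act_plus {t : Fin m → Aˣ} {x : M.S} (hx : x ∈ plus M.gr) :
    P.act t (1 ⊗ₜ x) ∈ (plus M.gr).baseChange A := by
  have : plus M.gr ≤ (((plus M.gr).baseChange A).restrictScalars ℝ).comap
      ((P.act t).toLinearMap.restrictScalars ℝ ∘ₗ TensorProduct.mk ℝ A M.S 1) := by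
    refine iSup_le fun n x hx => ?_
    exact Submodule.baseChange_mono A (le_iSup (fun n => deg M.gr (n + 1)) n)
      (P.act_deg t (Submodule.tmul_mem_baseChange_of_mem 1 hx))
  exact this hx

theorem act_decomposable {t : Fin m → Aˣ} {x : M.S} (hx : x ∈ plus M.gr * plus M.gr) :
    P.act t (1 ⊗ₜ x) ∈ (plus M.gr * plus M.gr).baseChange A := by
  have : plus M.gr * plus M.gr ≤ (((plus M.gr * plus M.gr).baseChange A).restrictScalars ℝ).comap
      ((P.act t).toLinearMap.restrictScalars ℝ ∘ₗ TensorProduct.mk ℝ A M.S 1) := by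
    rw [Submodule.mul_le]
    intro a ha b hb
    have : (1 : A) ⊗ₜ[ℝ] (a * b) = (1 ⊗ₜ a) * (1 ⊗ₜ b) := by
      rw [Algebra.TensorProduct.tmul_mul_tmul, one_mul]
    change P.act t ((1 : A) ⊗ₜ[ℝ] (a * b)) ∈ (plus M.gr * plus M.gr).baseChange A
    rw [this, map_mul]
    exact mul_mem_baseChange (P.act_plus ha) (P.act_plus hb)
  exact this hx

/-- A point of the torus that fixes closed elements which span `P(M)` is the identity. -/
theorem act_eq_self_of_span {ι' : Type*} {z : ι' → M.S}
    (hz : M.closedPlus ≤ Submodule.span ℝ (Set.range z) ⊔ plus M.gr * plus M.gr) {t : Fin m → Aˣ}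
    (ht : ∀ i, P.act t (1 ⊗ₜ z i) = (1 : A) ⊗ₜ[ℝ] z i) (x : A ⊗[ℝ] M.S) : P.act t x = x := by
  refine P.act_eq_self (fun y χ hy hχ hy' => ?_) x
  let f : M.S →ₗ[ℝ] A ⊗[ℝ] M.S :=
    (P.act t).toLinearMap.restrictScalars ℝ ∘ₗ TensorProduct.mk ℝ A M.S 1 -
      TensorProduct.mk ℝ A M.S 1
  -- The map t − 1 sends the chosen elements to zero and preserves decomposables, so it sends every
  -- closed element into the decomposables. On an indecomposable vector of weight χ it is
  -- multiplication by χ(t) − 1, which must then vanish.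
  have hle : M.closedPlus ≤
      (((plus M.gr * plus M.gr).baseChange A).restrictScalars ℝ).comap f := by
    refine hz.trans (sup_le (Submodule.span_le.2 ?_) fun y hy => ?_)
    · rintro _ ⟨i, rfl⟩
      change P.act t (1 ⊗ₜ z i) - 1 ⊗ₜ z i ∈ (plus M.gr * plus M.gr).baseChange A
      rw [ht, sub_self]
      exact Submodule.zero_mem _
    · change P.act t (1 ⊗ₜ y) - 1 ⊗ₜ y ∈ (plus M.gr * plus M.gr).baseChange A
      exact Submodule.sub_mem _ (P.act_decomposable hy) (Submodule.tmul_mem_baseChange_of_mem 1 hy)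
  have h1 : P.act t (1 ⊗ₜ y) - 1 ⊗ₜ y ∈ (plus M.gr * plus M.gr).baseChange A := hle hy
  rw [hχ, ← TensorProduct.sub_tmul] at h1
  exact Units.ext (by simpa using sub_eq_zero.1 (eq_zero_of_tmul_mem_baseChange h1 hy'))

/-- Weight components of closed elements are closed, so classes of closed weight vectors span P(M),
and a basis can be selected among them. -/
theorem exists_weight_basis {n : ℕ} (hn : Module.rank ℝ M.P = n) : ∃ z : Fin n → M.S,
    (∀ i, z i ≠ 0 ∧ ∃ χ, P.IsWeight χ (z i)) ∧
    M.closedPlus ≤ Submodule.span ℝ (Set.range z) ⊔ plus M.gr * plus M.gr := by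
  let D := (plus M.gr * plus M.gr).submoduleOf M.closedPlus
  let s : Set M.P := {q | ∃ (z : M.closedPlus) (χ : Fin m → ℤ), P.IsWeight χ z ∧ D.mkQ z = q}
  have hs : Submodule.span ℝ s = ⊤ := by
    rw [eq_top_iff]
    rintro q -
    obtain ⟨z, rfl⟩ := D.mkQ_surjective q
    obtain ⟨w, hw⟩ := P.exists_sum_comp (z : M.S)
    have : z = ∑ χ ∈ w, ⟨P.comp χ z, P.comp_closedPlus z.2 χ⟩ := by
      ext1
      rw [AddSubmonoidClass.coe_finsetSum]
      exact hw
    rw [this, map_sum]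
    exact Submodule.sum_mem _ fun χ _ => Submodule.subset_span ⟨_, χ, P.comp_isWeight χ _, rfl⟩
  obtain ⟨b, hbs, hb, hli⟩ := exists_linearIndependent ℝ s
  have hcard : Cardinal.mk b = n := by
    rw [← hn, ← (Module.Basis.mk hli (by rw [Subtype.range_coe, hb, hs])).mk_eq_rank'']
  obtain ⟨e⟩ : Nonempty (Fin n ≃ b) := by
    have hfin : Finite b := by
      rw [← Cardinal.lt_aleph0_iff_finite, hcard]
      exact Cardinal.natCast_lt_aleph0
    exact ⟨(Finite.equivFinOfCardEq (by rw [Nat.card, hcard, Cardinal.toNat_natCast])).symm⟩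
  choose z χ hz hzq using fun i => hbs (e i).2
  refine ⟨fun i => z i, fun i => ⟨?_, χ i, hz i⟩, ?_⟩
  · intro h0
    have : (e i : M.P) = 0 := by
      rw [← hzq, show z i = 0 from Subtype.ext h0, map_zero]
    exact hli.ne_zero (e i) this
  · intro x hx
    have h1 : D.mkQ ⟨x, hx⟩ ∈ Submodule.span ℝ (Set.range fun i => D.mkQ (z i)) := by
      have : Set.range (fun i => D.mkQ (z i)) = b := by
        simp only [hzq]
        exact (e.surjective.range_comp Subtype.val).trans Subtype.range_coe
      rw [this, hb, hs]
      exact Submodule.mem_top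
    rw [Submodule.mem_span_range_iff_exists_fun] at h1
    obtain ⟨c, hc⟩ := h1
    have h2 : (⟨x, hx⟩ : M.closedPlus) - ∑ i, c i • z i ∈ D := by
      rw [← Submodule.ker_mkQ D, LinearMap.mem_ker, map_sub, map_sum, ← hc]
      simp
    have h3 : x - ∑ i, c i • (z i : M.S) ∈ plus M.gr * plus M.gr := by
      have h4 : ((⟨x, hx⟩ - ∑ i, c i • z i : M.closedPlus) : M.S) ∈ plus M.gr * plus M.gr := h2
      simpa using h4
    rw [← sub_add_cancel x (∑ i, c i • (z i : M.S))]
    refine Submodule.add_mem _ (Submodule.mem_sup_right h3) (Submodule.mem_sup_left ?_)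
    exact Submodule.sum_mem _ fun i _ => Submodule.smul_mem _ _ (Submodule.subset_span ⟨i, rfl⟩)

/-- The universal point of T, regarded in T', multiplies z by a Laurent polynomial a. Each weight
component of z is thus a real multiple of z, and one of them is nonzero; so z itself is a weight
vector for T. -/
theorem exists_isWeight_of_le {T' : M.SubgroupFamily} {n : ℕ} (P' : TorusParam T' n)
    (hle : ∀ (A : Type) [CommRing A] [Algebra ℝ A], T A ≤ T' A) {z : M.S} (h0 : z ≠ 0)
    {χ' : Fin n → ℤ} (hz : P'.IsWeight χ' z) : ∃ χ, P.IsWeight χ z := by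
  obtain ⟨a, ha⟩ : ∃ a : Laurent ℝ m, P.act (coord ℝ m) (1 ⊗ₜ z) = a ⊗ₜ z := by
    have := hz _ ((P'.toEquiv _).symm ⟨_, hle _ (P.toEquiv _ (coord ℝ m)).2⟩)
    simp only [act, MulEquiv.apply_symm_apply] at this
    exact ⟨_, this⟩
  obtain ⟨χ, hχ⟩ : ∃ χ, P.comp χ z ≠ 0 := by
    by_contra! h
    exact h0 ((Submodule.mem_bot ℝ).1 (P.mem_of_comp_mem fun χ => by simpa using h χ))
  have h1 : P.comp χ z = a.coeff χ • z := by
    rw [comp_apply, ha, coeffT_tmul, TensorProduct.lid_tmul]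
  have hc : a.coeff χ ≠ 0 := by
    intro h
    rw [h1, h, zero_smul] at hχ
    exact hχ rfl
  refine ⟨χ, fun A _ _ t => ?_⟩
  have h2 := P.comp_isWeight χ z A t
  rw [h1, TensorProduct.tmul_smul, TensorProduct.tmul_smul] at h2
  have h3 : P.act t (a.coeff χ • (1 : A) ⊗ₜ[ℝ] z) = a.coeff χ • P.act t (1 ⊗ₜ[ℝ] z) :=
    map_smul ((P.act t).toLinearMap.restrictScalars ℝ) _ _
  rw [h3] at h2
  have h4 := congrArg (fun x => (a.coeff χ)⁻¹ • x) h2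
  simpa only [smul_smul, inv_mul_cancel₀ hc, one_smul] using h4

end TorusParam

/-- A split torus in `Aut M` of dimension `dim P(M)` is maximal. -/
theorem IsSplitTorus.isMaximal {T : M.SubgroupFamily} {n : ℕ} (hT : IsSplitTorus T n)
    (hn : Module.rank ℝ M.P = n) : IsMaximalSplitTorus T := by
  refine ⟨⟨n, hT⟩, fun T' ⟨m, hT'⟩ hle A _ _ g hg => ?_⟩
  obtain ⟨P⟩ := hT.nonempty_param
  obtain ⟨P'⟩ := hT'.nonempty_param
  obtain ⟨z, hz, hspan⟩ := P'.exists_weight_basis hn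
  choose h0 χ' hχ' using hz
  choose χ hχ using fun i => P.exists_isWeight_of_le P' hle (h0 i) (hχ' i)
  obtain ⟨τ, hτ⟩ := (P'.toEquiv A).surjective ⟨g, hg⟩
  -- By rigidity the T-weights of the basis separate the points of T, so some t in T has the same
  -- eigenvalues on the basis as the given point τ of T'.
  obtain ⟨t, ht⟩ := exists_chi_eq (χ := χ) (fun B _ _ s hs => by
    have := P.toEquiv_eq_one (P.act_eq_self_of_span hspan (t := s) fun i => by
      rw [hχ i, hs i, Units.val_one])
    simpa using this) (fun i => chi τ (χ' i))
  -- Here σ is t expressed in the coordinates of T'. Rigidity for T' then shows that σ⁻¹τ, which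
  -- fixes the basis of P(M), is trivial.
  obtain ⟨σ, hσ⟩ := (P'.toEquiv A).surjective ⟨_, hle A (P.toEquiv A t).2⟩
  have hact : ∀ x, P'.act σ x = P.act t x := fun x => by
    simp only [TorusParam.act, hσ]
  have h1 := P'.toEquiv_eq_one (P'.act_eq_self_of_span hspan (t := σ⁻¹ * τ) fun i => by
    rw [P'.act_mul, hχ' i, ← ht i, ← hχ i, ← hact, ← P'.act_mul, inv_mul_cancel, P'.act_one])
  have h2 : σ = τ := by
    rw [← inv_mul_eq_one]
    exact (P'.toEquiv A).map_eq_one_iff.1 h1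
  have h3 : g = (P.toEquiv A t).1 := by
    rw [h2, hτ] at hσ
    exact congrArg Subtype.val hσ
  rw [h3]
  exact (P.toEquiv A t).2

end MinimalSullivanAlgebra

section Free

variable {V : Type u} [AddCommGroup V] [Module ℝ V] {gr : ℕ → Submodule ℝ V}

/-! ### Components of word length one and two -/

/-- A graded symmetric bilinear map. -/
def IsGradedSymm (gr : ℕ → Submodule ℝ V) {W : Type*} [AddCommGroup W] [Module ℝ W]
    (β : V →ₗ[ℝ] V →ₗ[ℝ] W) : Prop :=
  ∀ (m n : ℕ) (x y : V), x ∈ gr m → y ∈ gr n → β x y = (-1 : ℝ) ^ (m * n) • β y x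

section quadEval

variable {W : Type*} [AddCommGroup W] [Module ℝ W] (β : V →ₗ[ℝ] V →ₗ[ℝ] W)

/-- The representation of `S(V)` on `ℝ ⊕ V ⊕ W` given by a graded symmetric bilinear map. -/
def quadRep (hβ : IsGradedSymm gr β) : FreeGC gr →ₐ[ℝ] Module.End ℝ (ℝ × V × W) :=
  lift
    { toFun := fun v =>
        { toFun := fun y => (0, y.1 • v, β v y.2.1)
          map_add' := fun y z => by simp [add_smul]
          map_smul' := fun r y => by simp [mul_smul] }
      map_add' := fun v w => by ext <;> simp
      map_smul' := fun r v => by ext <;> simp }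
    (by
      intro m n x y hx hy
      ext z <;> simp [hβ m n x y hx hy])

variable {β} (hβ : IsGradedSymm gr β)

theorem quadRep_ι (v : V) (y : ℝ × V × W) :
    quadRep β hβ (ι gr v) y = (0, y.1 • v, β v y.2.1) := by
  rw [quadRep, lift_ι]
  rfl

/-- Generators shift the filtration ℝ, V, W by one step. So a positive-degree element kills the
ℝ-coordinate, and a product of two such elements has no V-coordinate. -/
theorem quadRep_deg {n : ℕ} {x : FreeGC gr} (hx : x ∈ deg gr n) (y : ℝ × V × W) :
    (quadRep β hβ x y).1 = y.1 * (quadRep β hβ x (1, 0, 0)).1 ∧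
      (0 < n → (quadRep β hβ x y).1 = 0 ∧
        (quadRep β hβ x y).2.1 = y.1 • (quadRep β hβ x (1, 0, 0)).2.1) := by
  refine deg_induction (p := fun n x => (quadRep β hβ x y).1 = y.1 * (quadRep β hβ x (1, 0, 0)).1 ∧
      (0 < n → (quadRep β hβ x y).1 = 0 ∧
        (quadRep β hβ x y).2.1 = y.1 • (quadRep β hβ x (1, 0, 0)).2.1)) ?_ ?_ ?_ ?_ ?_ hx
  · simp
  · intro a b v z hv hz ih
    simp only [map_mul, Module.End.mul_apply, quadRep_ι]
    refine ⟨by simp, fun _ => ⟨trivial, ?_⟩⟩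
    rw [ih.1, mul_smul]
  · simp
  · intro n x z hx hz
    simp only [map_add, LinearMap.add_apply, Prod.fst_add, Prod.snd_add]
    refine ⟨by rw [hx.1, hz.1, mul_add], fun hn => ?_⟩
    obtain ⟨h1, h2⟩ := hx.2 hn
    obtain ⟨h3, h4⟩ := hz.2 hn
    rw [h1, h2, h3, h4, add_zero, smul_add]
    exact ⟨rfl, rfl⟩
  · intro n r x hx
    simp only [map_smul, LinearMap.smul_apply, Prod.smul_fst, Prod.smul_snd, smul_eq_mul]
    refine ⟨by rw [hx.1]; ring, fun hn => ?_⟩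
    obtain ⟨h1, h2⟩ := hx.2 hn
    rw [h1, h2, mul_zero, smul_comm]
    exact ⟨rfl, rfl⟩

/-- Applying vw to the vector (1, 0, 0) leaves β(v, w) in the last coordinate. Quadratic words can
thus be shown nonzero without a monomial basis of S(V). -/
theorem map_eq_zero_of_ι_mul_ι (hβ : IsGradedSymm gr β) {v w : V} (h : ι gr v * ι gr w = 0) : β v w = 0 := by
  have h1 := congrArg (fun x => (quadRep β hβ x (1, 0, 0)).2.2) h
  simpa [quadRep_ι] using h1

end quadEval

theorem isGradedSymm_zero : IsGradedSymm gr (0 : V →ₗ[ℝ] V →ₗ[ℝ] ℝ) := fun _ _ _ _ _ _ => by simp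

variable (gr) in
/-- The projection of `S(V)` to `V`. -/
def linPart : FreeGC gr →ₗ[ℝ] V where
  toFun x := (quadRep 0 (isGradedSymm_zero (gr := gr)) x (1, 0, 0)).2.1
  map_add' x y := by simp
  map_smul' r x := by simp

theorem linPart_ι (v : V) : linPart gr (ι gr v) = v := by
  change (quadRep 0 isGradedSymm_zero (ι gr v) (1, 0, 0)).2.1 = v
  rw [quadRep_ι, one_smul]

theorem ι_injective : Function.Injective (ι gr) :=
  Function.LeftInverse.injective (g := linPart gr) linPart_ι

theorem linPart_decomposable {x : FreeGC gr} (hx : x ∈ plus gr * plus gr) : linPart gr x = 0 := by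
  have hle : plus gr * plus gr ≤ LinearMap.ker (linPart gr) := by
    rw [plus, Submodule.iSup_mul]
    refine iSup_le fun i => ?_
    rw [Submodule.mul_iSup]
    refine iSup_le fun j => ?_
    rw [Submodule.mul_le]
    intro a ha b hb
    change (quadRep 0 isGradedSymm_zero (a * b) (1, 0, 0)).2.1 = 0
    rw [map_mul, Module.End.mul_apply, ((quadRep_deg _ ha _).2 i.succ_pos).2,
      ((quadRep_deg _ hb _).2 j.succ_pos).1, zero_smul]
  exact hle hx

theorem deg_le_plus {n : ℕ} (hn : 0 < n) : deg gr n ≤ plus gr := by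
  obtain ⟨n, rfl⟩ := Nat.exists_eq_succ_of_ne_zero hn.ne'
  exact le_iSup (fun n => deg gr (n + 1)) n

theorem sub_linPart_mem (h : IsGrading gr) {x : FreeGC gr} (hx : x ∈ plus gr) :
    x - ι gr (linPart gr x) ∈ plus gr * plus gr := by
  have hle : plus gr ≤ (plus gr * plus gr).comap (LinearMap.id - ι gr ∘ₗ linPart gr) := by
    refine iSup_le fun n x hx => ?_
    refine deg_induction
      (p := fun n x => 0 < n → x - ι gr (linPart gr x) ∈ plus gr * plus gr)
      ?_ ?_ ?_ ?_ ?_ hx n.succ_pos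
    · exact fun h => absurd h (lt_irrefl 0)
    · intro a b v y hv hy _ _
      rcases Nat.eq_zero_or_pos b with rfl | hb
      · obtain ⟨r, rfl⟩ := Submodule.mem_span_singleton.1 ((mem_deg_zero_or_one h.zero hy).1 rfl)
        rw [mul_smul_comm, mul_one, map_smul, map_smul, linPart_ι, sub_self]
        exact Submodule.zero_mem _
      · have := Submodule.mul_mem_mul (ι_mem_plus h.iSup_eq h.zero v) (deg_le_plus hb hy)
        rw [linPart_decomposable this, map_zero, sub_zero]
        exact this
    · simp
    · intro n x y hx hy hn
      rw [map_add, map_add, add_sub_add_comm]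
      exact Submodule.add_mem _ (hx hn) (hy hn)
    · intro n r x hx hn
      rw [map_smul, map_smul, ← smul_sub]
      exact Submodule.smul_mem _ _ (hx hn)
  exact hle hx

variable (gr) in
/-- The word length of `S(V)` as an algebra map to polynomials. -/
noncomputable def wordHom : FreeGC gr →ₐ[ℝ] Polynomial (FreeGC gr) :=
  lift ((Polynomial.monomial 1).restrictScalars ℝ ∘ₗ ι gr) (by
    intro m n x y hx hy
    simp only [LinearMap.comp_apply, LinearMap.restrictScalars_apply,
      Polynomial.monomial_mul_monomial]
    rw [ι_comm hx hy, Polynomial.smul_monomial])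

theorem wordHom_ι (v : V) : wordHom gr (ι gr v) = Polynomial.monomial 1 (ι gr v) := lift_ι _ _ v

theorem wordHom_coeff_zero {x : FreeGC gr} (hx : x ∈ plus gr) : (wordHom gr x).coeff 0 = 0 := by
  have hle : plus gr ≤ LinearMap.ker
      (((Polynomial.lcoeff (FreeGC gr) 0).restrictScalars ℝ) ∘ₗ (wordHom gr).toLinearMap) := by
    refine iSup_le fun n x hx => ?_
    change (wordHom gr x).coeff 0 = 0
    refine deg_induction (p := fun n x => 0 < n → (wordHom gr x).coeff 0 = 0)
      ?_ ?_ ?_ ?_ ?_ hx n.succ_pos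
    · exact fun h => absurd h (lt_irrefl 0)
    · intro a b v y _ _ _ _
      rw [map_mul, Polynomial.mul_coeff_zero, wordHom_ι, Polynomial.coeff_monomial]
      simp
    · simp
    · intro n x y hx hy hn
      rw [map_add, Polynomial.coeff_add, hx hn, hy hn, add_zero]
    · intro n r x hx hn
      rw [map_smul, Polynomial.coeff_smul, hx hn, smul_zero]
  exact hle hx

variable (gr) in
/-- The component of word length two. -/
noncomputable def wordTwo : FreeGC gr →ₗ[ℝ] FreeGC gr :=
  ((Polynomial.lcoeff (FreeGC gr) 2).restrictScalars ℝ) ∘ₗ (wordHom gr).toLinearMap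

theorem wordTwo_apply (x : FreeGC gr) : wordTwo gr x = (wordHom gr x).coeff 2 := rfl

theorem wordTwo_of_mem {x : FreeGC gr} (hx : x ∈ LinearMap.range (ι gr) ^ 2) :
    wordTwo gr x = x := by
  have hle : LinearMap.range (ι gr) ^ 2 ≤ LinearMap.eqLocus (wordTwo gr) LinearMap.id := by
    rw [pow_two, Submodule.mul_le]
    rintro _ ⟨v, rfl⟩ _ ⟨w, rfl⟩
    rw [LinearMap.mem_eqLocus, wordTwo_apply, map_mul, wordHom_ι, wordHom_ι,
      Polynomial.monomial_mul_monomial, Polynomial.coeff_monomial]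
    simp
  exact hle hx

theorem wordHom_coeff_one {x : FreeGC gr} (hx : x ∈ plus gr * plus gr) :
    (wordHom gr x).coeff 0 = 0 ∧ (wordHom gr x).coeff 1 = 0 := by
  refine Submodule.mul_induction_on hx (fun a ha b hb => ?_) fun x y hx hy => by simp [hx, hy]
  rw [map_mul, Polynomial.mul_coeff_zero, Polynomial.mul_coeff_one, wordHom_coeff_zero ha,
    wordHom_coeff_zero hb]
  simp

theorem wordTwo_mul_right {x y : FreeGC gr} (hx : x ∈ plus gr * plus gr) (hy : y ∈ plus gr) :
    wordTwo gr (x * y) = 0 := by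
  have h1 := wordHom_coeff_one hx
  have h2 := wordHom_coeff_zero hy
  rw [wordTwo_apply, map_mul, Polynomial.coeff_mul,
    show Finset.HasAntidiagonal.antidiagonal 2 = {(0, 2), (1, 1), (2, 0)} from rfl]
  simp [h1, h2]

theorem wordTwo_mul_left {x y : FreeGC gr} (hx : x ∈ plus gr * plus gr) (hy : y ∈ plus gr) :
    wordTwo gr (y * x) = 0 := by
  have h1 := wordHom_coeff_one hx
  have h2 := wordHom_coeff_zero hy
  rw [wordTwo_apply, map_mul, Polynomial.coeff_mul,
    show Finset.HasAntidiagonal.antidiagonal 2 = {(0, 2), (1, 1), (2, 0)} from rfl]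
  simp [h1, h2]

theorem par_mem_plus (h : IsGrading gr) {x : FreeGC gr} (hx : x ∈ plus gr) :
    par h x ∈ plus gr := by
  have : plus gr ≤ (plus gr).comap (par h).toLinearMap := by
    refine iSup_le fun n y hy => ?_
    rw [Submodule.mem_comap, AlgHom.toLinearMap_apply, par_deg h hy]
    exact Submodule.smul_mem _ _ (Submodule.mem_iSup_of_mem n hy)
  exact this hx

theorem adjoin_range_ι (h : IsGrading gr) : Algebra.adjoin ℝ (Set.range (ι gr)) = ⊤ := by
  rw [eq_top_iff]
  rintro x -
  induction x using induction_on h.iSup_eq with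
  | add a b ha hb => exact Subalgebra.add_mem _ ha hb
  | hp n x hx =>
    refine deg_induction (p := fun _ x => x ∈ Algebra.adjoin ℝ (Set.range (ι gr)))
      ?_ ?_ ?_ ?_ ?_ hx
    · exact Subalgebra.one_mem _
    · exact fun a b v y _ _ hy =>
        Subalgebra.mul_mem _ (Algebra.subset_adjoin (Set.mem_range_self v)) hy
    · exact fun _ => Subalgebra.zero_mem _
    · exact fun n x y hx hy => Subalgebra.add_mem _ hx hy
    · exact fun n r x hx => Subalgebra.smul_mem _ hx r

/-- Two algebra maps on `S(V)` agree if they agree on the generators. -/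
theorem algHom_ext (h : IsGrading gr) {B : Type*} [Ring B] [Algebra ℝ B]
    {f g : FreeGC gr →ₐ[ℝ] B} (hfg : ∀ v, f (ι gr v) = g (ι gr v)) : f = g := by
  refine AlgHom.ext_of_adjoin_eq_top (adjoin_range_ι h) ?_
  rintro _ ⟨v, rfl⟩
  exact hfg v

/-- The projection of `V` to the part of degree `n`. -/
noncomputable def grProj (h : IsGrading gr) (n : ℕ) : V →ₗ[ℝ] V :=
  fromGr h fun m => if m = n then LinearMap.id else 0

theorem grProj_of_mem (h : IsGrading gr) (n : ℕ) {m : ℕ} {v : V} (hv : v ∈ gr m) :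
    grProj h n v = if m = n then v else 0 := by
  rw [grProj, fromGr_apply h _ hv]
  split_ifs <;> rfl

/-- Two linear maps agree if they agree on homogeneous elements. -/
theorem linearMap_ext_gr (h : IsGrading gr) {C : Type*} [AddCommGroup C] [Module ℝ C]
    {f g : V →ₗ[ℝ] C} (hfg : ∀ n, ∀ v ∈ gr n, f v = g v) : f = g := by
  have : ⨆ n, gr n ≤ LinearMap.eqLocus f g := iSup_le fun n v hv => hfg n v hv
  rw [h.iSup_eq] at this
  exact LinearMap.ext fun v => this (Submodule.mem_top (x := v))

theorem grProj_mem (h : IsGrading gr) (n : ℕ) (v : V) : grProj h n v ∈ gr n := by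
  have : (⨆ m, gr m) ≤ (gr n).comap (grProj h n) := by
    refine iSup_le fun m v hv => ?_
    rw [Submodule.mem_comap, grProj_of_mem h n hv]
    split_ifs with hmn
    · exact hmn ▸ hv
    · exact Submodule.zero_mem _
  rw [h.iSup_eq] at this
  exact this (Submodule.mem_top (x := v))

theorem degProj_ι (h : IsGrading gr) (n : ℕ) (v : V) :
    degProj h n (ι gr v) = ι gr (grProj h n v) := by
  refine LinearMap.congr_fun (linearMap_ext_gr h (f := degProj h n ∘ₗ ι gr)
    (g := ι gr ∘ₗ grProj h n) fun m v hv => ?_) v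
  rw [LinearMap.comp_apply, LinearMap.comp_apply, degProj_deg h n (ι_mem_deg hv),
    grProj_of_mem h n hv]
  split_ifs
  · rfl
  · rw [map_zero]

end Free

/-! ### P(M) for a quadratic differential -/

namespace MinimalSullivanAlgebra

variable {V : Type u} [AddCommGroup V] [Module ℝ V] (M : MinimalSullivanAlgebra V)

theorem d_degProj (n : ℕ) (x : M.S) :
    M.d (degProj M.grading n x) = degProj M.grading (n + 1) (M.d x) := by
  induction x using induction_on M.grading.iSup_eq with
  | add a b ha hb => simp only [map_add, ha, hb]
  | hp k x hx =>
    rw [degProj_deg _ n hx, degProj_deg _ (n + 1) (M.d_deg k x hx)]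
    by_cases hk : k = n <;> simp [hk]

/-- By minimality and the product rule, d maps decomposables to words of length at least three. -/
theorem wordTwo_d_decomposable {x : M.S} (hx : x ∈ plus M.gr * plus M.gr) :
    wordTwo M.gr (M.d x) = 0 := by
  refine Submodule.mul_induction_on hx (fun a ha b hb => ?_) fun x y hx hy => by
    rw [map_add, map_add, hx, hy, add_zero]
  rw [d_mul, map_add, wordTwo_mul_right (M.minimal a) hb,
    wordTwo_mul_left (M.minimal b) (par_mem_plus M.grading ha), add_zero]

variable {M}

/-- If `d` is quadratic, the linear part of a closed element is closed. -/
theorem IsQuadratic.linPart_mem_closedGen (hM : M.IsQuadratic) {z : M.S} (hz : z ∈ M.closedPlus) :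
    linPart M.gr z ∈ M.closedGen := by
  change M.d (ι M.gr (linPart M.gr z)) = 0
  -- Write z = v + (decomposable). In dz = 0 the part of word length two is exactly dv, since d is
  -- quadratic on generators.
  have h1 := M.wordTwo_d_decomposable (sub_linPart_mem M.grading hz.1)
  rwa [map_sub, show M.d z = 0 from hz.2, zero_sub, map_neg, wordTwo_of_mem (hM _),
    neg_eq_zero] at h1

/-- If `d` is quadratic, then `P(M)` is the space of closed generators. -/
theorem IsQuadratic.rank_P (hM : M.IsQuadratic) :
    Module.rank ℝ M.P = Module.rank ℝ M.closedGen := by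
  let D := (plus M.gr * plus M.gr).submoduleOf M.closedPlus
  let f : M.closedGen →ₗ[ℝ] M.closedPlus := (ι M.gr ∘ₗ M.closedGen.subtype).codRestrict _
    fun v => ⟨ι_mem_plus M.grading.iSup_eq M.grading.zero _, v.2⟩
  refine (LinearEquiv.ofBijective (D.mkQ ∘ₗ f) ⟨?_, ?_⟩).rank_eq.symm
  · rw [← LinearMap.ker_eq_bot, LinearMap.ker_eq_bot']
    intro v hv
    have h1 : f v ∈ D := by
      rw [← Submodule.ker_mkQ D]
      exact hv
    have h2 := linPart_decomposable (show ι M.gr v ∈ plus M.gr * plus M.gr from h1)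
    rw [linPart_ι] at h2
    exact Subtype.ext h2
  · intro q
    obtain ⟨z, rfl⟩ := D.mkQ_surjective q
    refine ⟨⟨_, hM.linPart_mem_closedGen z.2⟩, ?_⟩
    rw [← sub_eq_zero, LinearMap.comp_apply, ← map_sub, ← neg_eq_zero, ← map_neg, neg_sub,
      ← LinearMap.mem_ker, Submodule.ker_mkQ]
    exact sub_linPart_mem M.grading z.2.1

end MinimalSullivanAlgebra

section Cyc

variable {V : Type u} [AddCommGroup V] [Module ℝ V] {gr : ℕ → Submodule ℝ V}

/-! ### The kernel of `s` on elements of word length two -/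

/-- The retraction of the inclusion `S(V) → S(V ⊕ V[1] ⊕ ℝ w)`. -/
def retr (gr : ℕ → Submodule ℝ V) : FreeGC (cycGr gr) →ₐ[ℝ] FreeGC gr :=
  lift (ι gr ∘ₗ LinearMap.fst ℝ V ((V ⧸ gr 1) × ℝ)) fun _ _ _ _ hx hy => ι_comm hx.1 hy.1

theorem retr_ι (x : CycSpace gr) : retr gr (ι _ x) = ι gr x.1 := lift_ι _ _ x

theorem retr_incl (h : IsGrading gr) (x : FreeGC gr) : retr gr (incl gr x) = x := by
  have : (retr gr).comp (incl gr) = AlgHom.id ℝ _ := algHom_ext h fun v => by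
    rw [AlgHom.comp_apply, incl_ι, retr_ι]
    rfl
  exact DFunLike.congr_fun this x

theorem incl_injective (h : IsGrading gr) : Function.Injective (incl gr) :=
  Function.LeftInverse.injective (retr_incl h)

theorem retr_sDer (h : IsGrading gr) (x : FreeGC (cycGr gr)) : retr gr (sDer h x) = 0 := by
  refine oddDer_mem (cycGr_grading h) (sGen gr) (sGen_odd h) (LinearMap.ker (retr gr).toLinearMap)
    (fun x y hy => ?_) (fun x y hy => ?_) (fun v => ?_) x
  · change retr gr (x * y) = 0
    rw [map_mul, show retr gr y = 0 from hy, mul_zero]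
  · change retr gr (y * x) = 0
    rw [map_mul, show retr gr y = 0 from hy, zero_mul]
  · change retr gr (ι _ (inS gr v.1)) = 0
    rw [retr_ι]
    exact map_zero _

/-- The endomorphism of `S(V ⊕ V[1] ⊕ ℝ w)` that kills `w`. -/
def killW (gr : ℕ → Submodule ℝ V) : FreeGC (cycGr gr) →ₐ[ℝ] FreeGC (cycGr gr) :=
  lift (ι (cycGr gr) ∘ₗ LinearMap.prodMap LinearMap.id (LinearMap.prodMap LinearMap.id 0))
    fun _ _ _ _ hx hy => ι_comm ⟨hx.1, hx.2.1, Submodule.zero_mem _⟩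
      ⟨hy.1, hy.2.1, Submodule.zero_mem _⟩

theorem killW_ι (x : CycSpace gr) : killW gr (ι _ x) = ι _ (x.1, x.2.1, 0) := lift_ι _ _ x

/-- The values of s on S(V) involve only V and V[1]. Setting w = 0 therefore separates s(du) from
the term sv · w. -/
theorem killW_sDer_incl (M : MinimalSullivanAlgebra V) (x : M.S) :
    killW M.gr (sDer M.grading (incl M.gr x)) = sDer M.grading (incl M.gr x) := by
  refine (M.par_incl_mem (N := AlgHom.equalizer (killW M.gr) (AlgHom.id ℝ _)) (G := ⊤)
    (x := x) ?_ ?_ ?_ ?_).2.2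
  · simp [M.grading.iSup_eq]
  · intro v _
    rw [AlgHom.mem_equalizer, killW_ι]
    rfl
  · intro v _
    rw [AlgHom.mem_equalizer, killW_ι]
    rfl
  · rw [Submodule.top_coe, Set.image_univ, adjoin_range_ι M.grading]
    exact Algebra.mem_top

/-- The values on generators of the derivation with `sv ↦ v` for `v` of degree at least two. -/
noncomputable def hGen (h : IsGrading gr) : CycSpace gr →ₗ[ℝ] FreeGC (cycGr gr) :=
  ι (cycGr gr) ∘ₗ inV gr ∘ₗ (gr 1).liftQ (LinearMap.id - grProj h 1) (fun v hv => by
    rw [LinearMap.mem_ker, LinearMap.sub_apply, grProj_of_mem h 1 hv, if_pos rfl]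
    exact sub_self v) ∘ₗ LinearMap.fst ℝ (V ⧸ gr 1) ℝ ∘ₗ LinearMap.snd ℝ V ((V ⧸ gr 1) × ℝ)

theorem hGen_inS (h : IsGrading gr) (v : V) :
    hGen h (inS gr v) = ι _ (inV gr (v - grProj h 1 v)) := rfl

theorem hGen_inV (h : IsGrading gr) (v : V) : hGen h (inV gr v) = 0 := by
  have : hGen h (inV gr v) = hGen h (inS gr 0) := rfl
  rw [this, map_zero, map_zero]

theorem hGen_odd (h : IsGrading gr) : IsOdd (hGen h) := by
  rintro n ⟨v, u, c⟩ ⟨-, ⟨u, hu, rfl⟩, -⟩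
  refine ⟨n + 1, ⟨n + 1, by ring⟩, ?_⟩
  change ι _ (inV gr (u - grProj h 1 u)) ∈ _
  rw [grProj_of_mem h 1 hu]
  refine ι_mem_deg (inV_mem (Submodule.sub_mem _ hu ?_))
  split_ifs
  · exact hu
  · exact Submodule.zero_mem _

/-- The derivation with `sv ↦ v` for `v` of degree at least two. -/
noncomputable def hDer (h : IsGrading gr) : FreeGC (cycGr gr) →ₗ[ℝ] FreeGC (cycGr gr) :=
  oddDer (cycGr_grading h) (hGen h) (hGen_odd h)

theorem hDer_inV (h : IsGrading gr) (v : V) : hDer h (ι _ (inV gr v)) = 0 := by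
  rw [hDer, oddDer_ι, hGen_inV]

theorem hDer_inS (h : IsGrading gr) (v : V) :
    hDer h (ι _ (inS gr v)) = ι _ (inV gr (v - grProj h 1 v)) := by
  rw [hDer, oddDer_ι, hGen_inS]

theorem hDer_mul (h : IsGrading gr) (x y : FreeGC (cycGr gr)) :
    hDer h (x * y) = hDer h x * y + par (cycGr_grading h) x * hDer h y := by
  unfold hDer
  exact oddDer_mul _ _ _ x y

/-- After s, at most one letter is of the form sv, and the contraction restores it unless it came
from degree one. So hs acts as a derivation that is the identity on generators of degree at least
two and zero on V¹. -/
theorem hDer_sDer_mul (h : IsGrading gr) {i : ℕ} {a : V} (ha : a ∈ gr i) (b : V) :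
    hDer h (sDer h (incl gr (ι gr a * ι gr b))) =
      incl gr (ι gr (a - grProj h 1 a) * ι gr b + ι gr a * ι gr (b - grProj h 1 b)) := by
  have h1 : ((-1 : ℝ) ^ i) * (-1) ^ i = 1 := by rw [← mul_pow]; simp
  simp only [map_mul, map_add, incl_ι, sDer_mul, sDer_inV, hDer_mul, hDer_inV, hDer_inS, mul_zero,
    add_zero, par_ι (cycGr_grading h) (inV_mem ha), map_smul, smul_mul_assoc, zero_mul,
    zero_add, smul_smul, h1, one_smul]

/-- On elements of word length two without component of degree two, the composition of `s` with the
derivation `sv ↦ v` has no eigenvalues but one and two. -/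
theorem hDer_sDer_polynomial (h : IsGrading gr) {y : FreeGC gr}
    (hy : y ∈ LinearMap.range (ι gr) ^ 2) (hy2 : degProj h 2 y = 0) :
    hDer h (sDer h (hDer h (sDer h (incl gr y)))) - (3 : ℝ) • hDer h (sDer h (incl gr y)) +
      (2 : ℝ) • incl gr y = 0 := by
  let K : FreeGC (cycGr gr) →ₗ[ℝ] FreeGC (cycGr gr) := hDer h ∘ₗ sDer h
  let Φ : FreeGC gr →ₗ[ℝ] FreeGC (cycGr gr) :=
    (K ∘ₗ K - (3 : ℝ) • K + (2 : ℝ) • LinearMap.id) ∘ₗ (incl gr).toLinearMap ∘ₗ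
      (LinearMap.id - degProj h 2 : FreeGC gr →ₗ[ℝ] FreeGC gr)
  have hle : LinearMap.range (ι gr) ^ 2 ≤ LinearMap.ker Φ := by
    rw [pow_two, LinearMap.range_eq_map, ← h.iSup_eq, Submodule.map_iSup, Submodule.iSup_mul]
    refine iSup_le fun i => ?_
    rw [Submodule.mul_iSup]
    refine iSup_le fun j => ?_
    rw [Submodule.mul_le]
    rintro _ ⟨a, ha, rfl⟩ _ ⟨b, hb, rfl⟩
    rw [LinearMap.mem_ker]
    have hdeg := degProj_deg h 2 (mul_mem_deg (ι_mem_deg ha) (ι_mem_deg hb))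
    by_cases hij : i + j = 2
    · have : (LinearMap.id - degProj h 2 : FreeGC gr →ₗ[ℝ] FreeGC gr) (ι gr a * ι gr b) = 0 := by
        rw [LinearMap.sub_apply, hdeg, if_pos hij]
        exact sub_self _
      rw [LinearMap.comp_apply, LinearMap.comp_apply, this, map_zero, map_zero]
    · have hid : (LinearMap.id - degProj h 2 : FreeGC gr →ₗ[ℝ] FreeGC gr) (ι gr a * ι gr b) = ι gr a * ι gr b := by
        rw [LinearMap.sub_apply, hdeg, if_neg hij, sub_zero, LinearMap.id_apply]
      have hK : K (incl gr (ι gr a * ι gr b)) =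
          incl gr (ι gr (a - grProj h 1 a) * ι gr b + ι gr a * ι gr (b - grProj h 1 b)) :=
        hDer_sDer_mul h ha b
      -- The eigenvalue c counts the letters of degree other than one. The value 0 would force total
      -- degree two, which is excluded.
      obtain ⟨c, hc, hKc⟩ : ∃ c : ℝ, c * c - 3 * c + 2 = 0 ∧
          K (incl gr (ι gr a * ι gr b)) = c • incl gr (ι gr a * ι gr b) := by
        rw [hK, grProj_of_mem h 1 ha, grProj_of_mem h 1 hb]
        by_cases hi : i = 1 <;> by_cases hj : j = 1
        · omega
        · exact ⟨1, by norm_num, by simp [hi, hj]⟩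
        · exact ⟨1, by norm_num, by simp [hi, hj]⟩
        · exact ⟨2, by norm_num, by simp [hi, hj, two_smul]⟩
      rw [LinearMap.comp_apply, LinearMap.comp_apply, hid]
      simp only [LinearMap.add_apply, LinearMap.sub_apply, LinearMap.smul_apply,
        LinearMap.comp_apply K K, LinearMap.id_apply, AlgHom.toLinearMap_apply]
      rw [hKc, map_smul, hKc, smul_smul, smul_smul, ← sub_smul, ← add_smul, hc, zero_smul]
  have h1 : Φ y = 0 := hle hy
  have h2 : (LinearMap.id - degProj h 2 : FreeGC gr →ₗ[ℝ] FreeGC gr) y = y := by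
    rw [LinearMap.sub_apply, hy2, sub_zero, LinearMap.id_apply]
  rwa [LinearMap.comp_apply, LinearMap.comp_apply, h2] at h1

/-- If s(y) = 0, the relation (K − 1)(K − 2) = 0 for K = hs reduces to 2y = 0. Degree two has to be
excluded because s kills products of two generators of degree one. -/
theorem eq_zero_of_sDer_incl (h : IsGrading gr) {y : FreeGC gr}
    (hy : y ∈ LinearMap.range (ι gr) ^ 2) (hy2 : degProj h 2 y = 0)
    (hs : sDer h (incl gr y) = 0) : y = 0 := by
  have h1 := hDer_sDer_polynomial h hy hy2
  rw [hs, map_zero, map_zero, map_zero, smul_zero, sub_zero, zero_add] at h1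
  have h2 := (smul_eq_zero.1 h1).resolve_left two_ne_zero
  exact incl_injective h (by rw [h2, map_zero])

/-- With c the w-coordinate, the form β(x, y) = c(x) y + c(y) x takes the value sv at (sv, w). It is
graded symmetric because c lives in the even degree two. -/
theorem inS_eq_zero_of_mul_genW {v : V} (h : ι (cycGr gr) (inS gr v) * ι _ (genW gr) = 0) :
    inS gr v = 0 := by
  let c : CycSpace gr →ₗ[ℝ] ℝ := LinearMap.snd ℝ (V ⧸ gr 1) ℝ ∘ₗ LinearMap.snd ℝ V _
  let β : CycSpace gr →ₗ[ℝ] CycSpace gr →ₗ[ℝ] CycSpace gr :=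
    LinearMap.lsmul ℝ (CycSpace gr) ∘ₗ c +
      (LinearMap.lsmul ℝ (CycSpace gr) ∘ₗ c).flip
  have hβ' : ∀ x y, β x y = c x • y + c y • x := fun _ _ => rfl
  have hc : ∀ n, ∀ x ∈ cycGr gr n, n ≠ 2 → c x = 0 := by
    intro n x hx hn
    have h2 := hx.2.2
    rw [if_neg hn] at h2
    exact h2
  have hβ : IsGradedSymm (cycGr gr) β := by
    intro m n x y hx hy
    by_cases hm : m = 2
    · rw [hm, pow_mul, hβ', hβ', add_comm]; simp
    · by_cases hn : n = 2
      · rw [hn, mul_comm, pow_mul, hβ', hβ', add_comm]; simp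
      · rw [hβ', hβ', hc m x hx hm, hc n y hy hn]; simp
  have h1 := map_eq_zero_of_ι_mul_ι hβ h
  rw [hβ'] at h1
  simpa [c, inS, genW] using h1

theorem range_sq_incl {x : FreeGC gr} (hx : x ∈ LinearMap.range (ι gr) ^ 2) :
    incl gr x ∈ LinearMap.range (ι (cycGr gr)) ^ 2 := by
  rw [pow_two] at *
  refine Submodule.mul_induction_on hx ?_ fun x y hx hy => by
    rw [map_add]; exact Submodule.add_mem _ hx hy
  rintro _ ⟨a, rfl⟩ _ ⟨b, rfl⟩
  rw [map_mul, incl_ι, incl_ι]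
  exact Submodule.mul_mem_mul ⟨_, rfl⟩ ⟨_, rfl⟩

theorem par_mem_range (h : IsGrading gr) (v : V) : par h (ι gr v) ∈ LinearMap.range (ι gr) := by
  have : (⨆ n, gr n) ≤ (LinearMap.range (ι gr)).comap ((par h).toLinearMap ∘ₗ ι gr) := by
    refine iSup_le fun n v hv => ?_
    rw [Submodule.mem_comap, LinearMap.comp_apply, AlgHom.toLinearMap_apply, par_ι h hv]
    exact Submodule.smul_mem _ _ ⟨v, rfl⟩
  rw [h.iSup_eq] at this
  exact this (Submodule.mem_top (x := v))

theorem range_sq_sDer_incl (h : IsGrading gr) {x : FreeGC gr}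
    (hx : x ∈ LinearMap.range (ι gr) ^ 2) :
    sDer h (incl gr x) ∈ LinearMap.range (ι (cycGr gr)) ^ 2 := by
  rw [pow_two] at *
  refine Submodule.mul_induction_on hx ?_ fun x y hx hy => by
    rw [map_add, map_add]; exact Submodule.add_mem _ hx hy
  rintro _ ⟨a, rfl⟩ _ ⟨b, rfl⟩
  rw [map_mul, incl_ι, incl_ι, sDer_mul, sDer_inV, sDer_inV]
  exact Submodule.add_mem _ (Submodule.mul_mem_mul ⟨_, rfl⟩ ⟨_, rfl⟩)
    (Submodule.mul_mem_mul (par_mem_range _ _) ⟨_, rfl⟩)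

end Cyc

/-! ### Closed generators of the cyclification -/

namespace MinimalSullivanAlgebra

variable {V : Type u} [AddCommGroup V] [Module ℝ V] {M : MinimalSullivanAlgebra V}

theorem IsQuadratic.cyclification (hM : M.IsQuadratic) : M.cyclification.IsQuadratic := by
  intro y
  change M.cycD (ι (cycGr M.gr) y) ∈ LinearMap.range (ι (cycGr M.gr)) ^ 2
  obtain ⟨v, u, c, rfl⟩ := cyc_decomp y
  rw [cycD_ι, map_add M.cycGen, map_add M.cycGen, map_smul, cycGen_genW, smul_zero, add_zero,
    cycGen_inV, cycGen_inS]
  refine Submodule.add_mem _ (Submodule.add_mem _ (range_sq_incl (hM v)) ?_)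
    (Submodule.neg_mem _ (range_sq_sDer_incl _ (hM u)))
  refine (pow_two (LinearMap.range (ι (cycGr M.gr)))).ge ?_
  exact Submodule.mul_mem_mul ⟨_, rfl⟩ ⟨_, rfl⟩

theorem d_ι_grProj_one {v : V} (hv : v ∈ M.closedGen) : M.d (ι M.gr (grProj M.grading 1 v)) = 0 := by
  rw [← degProj_ι, d_degProj, show M.d (ι M.gr v) = 0 from hv, map_zero]

/-- The closed generator of the cyclification given by a closed generator of `M` and a multiple
of `w`. -/
noncomputable def closedGenMap (M : MinimalSullivanAlgebra V) :
    V × ℝ →ₗ[ℝ] CycSpace M.gr :=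
  LinearMap.coprod (inV M.gr ∘ₗ grProj M.grading 1 + inS M.gr)
    (LinearMap.toSpanSingleton ℝ _ (genW M.gr))

theorem closedGenMap_apply (v : V) (c : ℝ) : M.closedGenMap (v, c) =
    inV M.gr (grProj M.grading 1 v) + inS M.gr v + c • genW M.gr := rfl

/-- A closed v of degree at least two contributes sv, as d_c(sv) = −s(dv). In degree one sv = 0, and
v itself stays closed because the term sv · w disappears. -/
theorem closedGenMap_mem {v : V} (hv : v ∈ M.closedGen) (c : ℝ) :
    M.closedGenMap (v, c) ∈ M.cyclification.closedGen := by
  change M.cycD (ι (cycGr M.gr) _) = 0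
  rw [closedGenMap_apply, cycD_ι, map_add M.cycGen, map_add M.cycGen, map_smul, cycGen_genW,
    smul_zero, add_zero, cycGen_inV, cycGen_inS, d_ι_grProj_one hv,
    show M.d (ι M.gr v) = 0 from hv, inS_eq_zero (grProj_mem _ _ _)]
  simp

/-- If `d` is quadratic, every closed generator of the cyclification is obtained from a closed
generator of `M` and a multiple of `w`. -/
theorem IsQuadratic.exists_closedGenMap_eq (hM : M.IsQuadratic) {y : CycSpace M.gr}
    (hy : y ∈ M.cyclification.closedGen) :
    ∃ v ∈ M.closedGen, ∃ c, M.closedGenMap (v, c) = y := by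
  replace hy : M.cycD (ι (cycGr M.gr) y) = 0 := hy
  obtain ⟨v, u, c, rfl⟩ := cyc_decomp y
  rw [cycD_ι, map_add M.cycGen, map_add M.cycGen, map_smul, cycGen_genW, smul_zero, add_zero,
    cycGen_inV, cycGen_inS] at hy
  -- Setting V[1] and w to zero leaves dv.
  have hdv : M.d (ι M.gr v) = 0 := by
    have h1 := congrArg (retr M.gr) hy
    rw [map_add, map_add, map_neg, retr_sDer, retr_incl M.grading, map_mul, retr_ι, map_zero,
      show (inS M.gr v).1 = 0 from rfl, map_zero, zero_mul, add_zero, neg_zero, add_zero] at h1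
    exact h1
  rw [hdv, map_zero, zero_add] at hy
  have hsu : sDer M.grading (incl M.gr (M.d (ι M.gr u))) = 0 := by
    have h1 := congrArg (killW M.gr) hy
    rw [map_add, map_mul, map_neg, killW_sDer_incl, killW_ι (genW M.gr), map_zero,
      show ((genW M.gr).1, (genW M.gr).2.1, (0 : ℝ)) = 0 from rfl, map_zero, mul_zero, zero_add,
      neg_eq_zero] at h1
    exact h1
  rw [hsu, neg_zero, add_zero] at hy
  have hv : v ∈ M.gr 1 := by
    have h1 := congrArg (fun x : CycSpace M.gr => x.2.1) (inS_eq_zero_of_mul_genW hy)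
    simpa [inS] using h1
  set u₁ := grProj M.grading 1 u with hu₁
  have hu₁m : u₁ ∈ M.gr 1 := grProj_mem _ _ _
  -- Removing the degree-one part of u removes the degree-two part of du, and s(du₁) = 0 by
  -- `sd_eq_zero`; so injectivity of s applies.
  have hdu : M.d (ι M.gr (u - u₁)) = 0 := by
    refine eq_zero_of_sDer_incl M.grading (hM _) ?_ ?_
    · rw [← d_degProj, degProj_ι, map_sub, ← hu₁, grProj_of_mem M.grading 1 hu₁m, if_pos rfl,
        sub_self, map_zero, map_zero]
    · rw [map_sub, map_sub, map_sub, map_sub, hsu, zero_sub, neg_eq_zero]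
      exact M.sd_eq_zero hu₁m
  -- The two summands live in complementary degrees: the degree-one projection returns v, and s
  -- returns su.
  refine ⟨v + (u - u₁), ?_, c, ?_⟩
  · change M.d (ι M.gr _) = 0
    rw [map_add, map_add, hdv, hdu, add_zero]
  · rw [closedGenMap_apply, map_add, map_sub, grProj_of_mem M.grading 1 hv, ← hu₁,
      grProj_of_mem M.grading 1 hu₁m, if_pos rfl, if_pos rfl, sub_self, add_zero, map_add, map_sub,
      inS_eq_zero hv, inS_eq_zero hu₁m, zero_add, sub_zero]

/-- The parametrization is injective: a zero V[1]-coordinate puts v in V¹, where the V-coordinate is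
v itself. -/
theorem IsQuadratic.rank_closedGen_cyclification (hM : M.IsQuadratic) :
    Module.rank ℝ M.cyclification.closedGen = Module.rank ℝ M.closedGen + 1 := by
  let f : M.closedGen × ℝ →ₗ[ℝ] M.cyclification.closedGen :=
    (M.closedGenMap ∘ₗ LinearMap.prodMap M.closedGen.subtype LinearMap.id).codRestrict _
      fun x => closedGenMap_mem x.1.2 x.2
  have hf : Function.Bijective f := by
    refine ⟨?_, ?_⟩
    · rw [← LinearMap.ker_eq_bot, LinearMap.ker_eq_bot']
      rintro ⟨⟨v, hv⟩, c⟩ h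
      have h0 : M.closedGenMap (v, c) = 0 := congrArg Subtype.val h
      rw [closedGenMap_apply] at h0
      have h1 := congrArg (fun x : CycSpace M.gr => x.1) h0
      have h2 := congrArg (fun x : CycSpace M.gr => x.2.1) h0
      have h3 := congrArg (fun x : CycSpace M.gr => x.2.2) h0
      simp only [inV, inS, genW, Prod.fst_add, Prod.snd_add] at h1 h2 h3
      have h1' : grProj M.grading 1 v = 0 := by simpa using h1
      have h2' : v ∈ M.gr 1 := by simpa using h2
      have h3' : c = 0 := by simpa using h3
      rw [grProj_of_mem M.grading 1 h2', if_pos rfl] at h1'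
      subst h1' h3'
      rfl
    · rintro ⟨y, hy⟩
      obtain ⟨v, hv, c, rfl⟩ := hM.exists_closedGenMap_eq hy
      exact ⟨(⟨v, hv⟩, c), rfl⟩
  rw [← (LinearEquiv.ofBijective f hf).rank_eq]
  simp

end MinimalSullivanAlgebra

/-! ### Extension of scalars: products, parity and induction principles -/

section BaseChange

variable {A : Type} [CommRing A] [Algebra ℝ A]

theorem baseChange_mem_baseChange {X Y : Type*} [AddCommGroup X] [Module ℝ X] [AddCommGroup Y]
    [Module ℝ Y] (f : X →ₗ[ℝ] Y) {p : Submodule ℝ X} {q : Submodule ℝ Y} (h : p ≤ q.comap f)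
    {x : A ⊗[ℝ] X} (hx : x ∈ p.baseChange A) : f.baseChange A x ∈ q.baseChange A := by
  rw [Submodule.baseChange_eq_span] at hx
  induction hx using Submodule.span_induction with
  | zero => rw [map_zero]; exact Submodule.zero_mem _
  | add a b _ _ ha hb => rw [map_add]; exact Submodule.add_mem _ ha hb
  | smul r a _ ha => rw [map_smul]; exact Submodule.smul_mem _ _ ha
  | mem x hx =>
    obtain ⟨x, hx, rfl⟩ := hx
    exact Submodule.tmul_mem_baseChange_of_mem 1 (h hx)

/-- Extension of scalars of a product rule. -/
theorem baseChange_leibniz {S : Type u} [Ring S] [Algebra ℝ S] (δ : S →ₗ[ℝ] S) (p : S →ₐ[ℝ] S)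
    (h : ∀ x y, δ (x * y) = δ x * y + p x * δ y) (x y : A ⊗[ℝ] S) :
    δ.baseChange A (x * y) = δ.baseChange A x * y +
      Algebra.TensorProduct.map (AlgHom.id A A) p x * δ.baseChange A y := by
  induction x using TensorProduct.induction_on with
  | zero => simp
  | add a b ha hb => rw [add_mul, map_add, ha, hb, map_add, map_add]; noncomm_ring
  | tmul a x =>
    induction y using TensorProduct.induction_on with
    | zero => simp
    | add c b hc hb => rw [mul_add, map_add, hc, hb, map_add]; noncomm_ring
    | tmul b y =>
      simp [Algebra.TensorProduct.tmul_mul_tmul, h, TensorProduct.tmul_add]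

variable {V : Type u} [AddCommGroup V] [Module ℝ V] {gr : ℕ → Submodule ℝ V}

theorem comm_baseChange_deg {m n : ℕ} {x y : A ⊗[ℝ] FreeGC gr}
    (hx : x ∈ (deg gr m).baseChange A) (hy : y ∈ (deg gr n).baseChange A) :
    x * y = (-1 : ℝ) ^ (m * n) • (y * x) := by
  rw [Submodule.baseChange_eq_span] at hx hy
  induction hx using Submodule.span_induction with
  | zero => simp
  | add a b _ _ ha hb => rw [add_mul, mul_add, smul_add, ha, hb]
  | smul r a _ ha => rw [smul_mul_assoc, mul_smul_comm, ha, smul_comm]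
  | mem x hx =>
    obtain ⟨x, hx, rfl⟩ := hx
    induction hy using Submodule.span_induction with
    | zero => simp
    | add a b _ _ ha hb => rw [add_mul, mul_add, smul_add, ha, hb]
    | smul r a _ ha => rw [smul_mul_assoc, mul_smul_comm, ha, smul_comm]
    | mem y hy =>
      obtain ⟨y, hy, rfl⟩ := hy
      simp only [TensorProduct.mk_apply, Algebra.TensorProduct.tmul_mul_tmul]
      rw [comm_deg hx hy, TensorProduct.tmul_smul]

/-- Induction on an element of `A ⊗ S(V)`. -/
theorem baseChange_induction (h : IsGrading gr) {p : A ⊗[ℝ] FreeGC gr → Prop}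
    (one : p 1) (ι_mul : ∀ n, ∀ v ∈ gr n, ∀ y, p y → p (1 ⊗ₜ ι gr v * y))
    (add : ∀ x y, p x → p y → p (x + y)) (smul : ∀ (a : A) x, p x → p (a • x))
    (x : A ⊗[ℝ] FreeGC gr) : p x := by
  have zero : p 0 := by simpa using smul 0 1 one
  have h1 : ∀ x : FreeGC gr, p (1 ⊗ₜ x) := by
    intro x
    induction x using induction_on h.iSup_eq with
    | add a b ha hb => rw [TensorProduct.tmul_add]; exact add _ _ ha hb
    | hp n x hx =>
      refine deg_induction (p := fun _ x => p (1 ⊗ₜ x)) one ?_ ?_ ?_ ?_ hx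
      · intro a b v y hv _ hy
        have := ι_mul a v hv _ hy
        rwa [Algebra.TensorProduct.tmul_mul_tmul, one_mul] at this
      · intro _; rw [TensorProduct.tmul_zero]; exact zero
      · intro n x y hx hy; rw [TensorProduct.tmul_add]; exact add _ _ hx hy
      · intro n r x hx
        have := smul (algebraMap ℝ A r) _ hx
        rwa [algebraMap_smul, ← TensorProduct.tmul_smul] at this
  induction x using TensorProduct.induction_on with
  | zero => exact zero
  | add a b ha hb => exact add _ _ ha hb
  | tmul a x =>
    have := smul a _ (h1 x)
    rwa [TensorProduct.smul_tmul', smul_eq_mul, mul_one] at this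

theorem baseChange_algHom_ext (h : IsGrading gr) {B : Type*} [Ring B] [Algebra A B]
    {f g : A ⊗[ℝ] FreeGC gr →ₐ[A] B}
    (hfg : ∀ n, ∀ v ∈ gr n, f (1 ⊗ₜ ι gr v) = g (1 ⊗ₜ ι gr v)) : f = g := by
  refine AlgHom.ext fun x => ?_
  induction x using baseChange_induction h with
  | one => rw [map_one, map_one]
  | ι_mul n v hv y hy => rw [map_mul, map_mul, hy, hfg n v hv]
  | add x y hx hy => rw [map_add, map_add, hx, hy]
  | smul a x hx => rw [map_smul, map_smul, hx]

/-- An `A`-linear map that satisfies a product rule and vanishes on generators is zero. -/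
theorem baseChange_eq_zero_of_ι (h : IsGrading gr) {B : Type*} [Ring B] [Algebra A B]
    {E : A ⊗[ℝ] FreeGC gr →ₗ[A] B} {f g : A ⊗[ℝ] FreeGC gr → B} (h1 : E 1 = 0)
    (hι : ∀ n, ∀ v ∈ gr n, E (1 ⊗ₜ ι gr v) = 0)
    (hE : ∀ x y, E (x * y) = E x * f y + g x * E y) (x : A ⊗[ℝ] FreeGC gr) : E x = 0 := by
  induction x using baseChange_induction h with
  | one => exact h1
  | ι_mul n v hv y hy => rw [hE, hι n v hv, hy, zero_mul, mul_zero, add_zero]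
  | add x y hx hy => rw [map_add, hx, hy, add_zero]
  | smul a x hx => rw [map_smul, hx, smul_zero]

/-- The parity involution of `A ⊗ S(V)`. -/
noncomputable def parA (A : Type) [CommRing A] [Algebra ℝ A] (h : IsGrading gr) :
    A ⊗[ℝ] FreeGC gr →ₐ[A] A ⊗[ℝ] FreeGC gr := Algebra.TensorProduct.map (AlgHom.id A A) (par h)

theorem parA_deg (h : IsGrading gr) {n : ℕ} {x : A ⊗[ℝ] FreeGC gr}
    (hx : x ∈ (deg gr n).baseChange A) : parA A h x = (-1 : ℝ) ^ n • x := by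
  rw [Submodule.baseChange_eq_span] at hx
  induction hx using Submodule.span_induction with
  | zero => simp
  | add a b _ _ ha hb => rw [map_add, ha, hb, smul_add]
  | smul r a _ ha => rw [map_smul, ha, smul_comm]
  | mem x hx =>
    obtain ⟨x, hx, rfl⟩ := hx
    rw [TensorProduct.mk_apply, parA, Algebra.TensorProduct.map_tmul, par_deg h hx, map_one,
      TensorProduct.tmul_smul]

variable {U : Type u} [AddCommGroup U] [Module ℝ U] {gr' : ℕ → Submodule ℝ U}

theorem map_parA (h : IsGrading gr) (h' : IsGrading gr')
    {f : A ⊗[ℝ] FreeGC gr →ₐ[A] A ⊗[ℝ] FreeGC gr'}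
    (hf : ∀ n, ∀ v ∈ gr n, f (1 ⊗ₜ ι gr v) ∈ (deg gr' n).baseChange A) (x : A ⊗[ℝ] FreeGC gr) :
    f (parA A h x) = parA A h' (f x) := by
  have : f.comp (parA A h) = (parA A h').comp f := by
    refine baseChange_algHom_ext h fun n v hv => ?_
    rw [AlgHom.comp_apply, AlgHom.comp_apply, parA_deg h' (hf n v hv),
      parA_deg h (Submodule.tmul_mem_baseChange_of_mem 1 (ι_mem_deg hv))]
    exact map_smul (f.toLinearMap.restrictScalars ℝ) _ _
  exact DFunLike.congr_fun this x

theorem map_deg {f : A ⊗[ℝ] FreeGC gr →ₐ[A] A ⊗[ℝ] FreeGC gr'}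
    (hf : ∀ n, ∀ v ∈ gr n, f (1 ⊗ₜ ι gr v) ∈ (deg gr' n).baseChange A) {n : ℕ}
    {x : A ⊗[ℝ] FreeGC gr} (hx : x ∈ (deg gr n).baseChange A) :
    f x ∈ (deg gr' n).baseChange A := by
  rw [Submodule.baseChange_eq_span] at hx
  induction hx using Submodule.span_induction with
  | zero => rw [map_zero]; exact Submodule.zero_mem _
  | add a b _ _ ha hb => rw [map_add]; exact Submodule.add_mem _ ha hb
  | smul r a _ ha => rw [map_smul]; exact Submodule.smul_mem _ _ ha
  | mem x hx =>
    obtain ⟨x, hx, rfl⟩ := hx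
    rw [TensorProduct.mk_apply]
    refine deg_induction (p := fun n x => f (1 ⊗ₜ x) ∈ (deg gr' n).baseChange A)
      ?_ ?_ ?_ ?_ ?_ hx
    · rw [← Algebra.TensorProduct.one_def, map_one]
      exact Submodule.tmul_mem_baseChange_of_mem 1 one_mem_deg
    · intro a b v y hv _ hy
      have h1 : (1 : A) ⊗ₜ[ℝ] (ι gr v * y) = (1 ⊗ₜ ι gr v) * (1 ⊗ₜ y) := by
        rw [Algebra.TensorProduct.tmul_mul_tmul, one_mul]
      rw [h1, map_mul]
      refine Submodule.baseChange_mono A ?_ (mul_mem_baseChange (hf a v hv) hy)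
      exact Submodule.mul_le.2 fun x hx y hy => mul_mem_deg hx hy
    · intro n
      rw [TensorProduct.tmul_zero, map_zero]
      exact Submodule.zero_mem _
    · intro n x y hx hy
      rw [TensorProduct.tmul_add, map_add]
      exact Submodule.add_mem _ hx hy
    · intro n r x hx
      have h1 : (1 : A) ⊗ₜ[ℝ] (r • x) = algebraMap ℝ A r • (1 : A) ⊗ₜ[ℝ] x := by
        rw [algebraMap_smul, TensorProduct.tmul_smul]
      rw [h1, map_smul]
      exact Submodule.smul_mem _ _ hx

end BaseChange

/-! ### The inclusion and the derivation s over A -/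

section Cyc

variable {V : Type u} [AddCommGroup V] [Module ℝ V] {gr : ℕ → Submodule ℝ V}
variable (A : Type) [CommRing A] [Algebra ℝ A]

variable (gr) in
/-- The inclusion `A ⊗ S(V) → A ⊗ S(V ⊕ V[1] ⊕ ℝ w)`. -/
noncomputable def inclB : A ⊗[ℝ] FreeGC gr →ₐ[A] A ⊗[ℝ] FreeGC (cycGr gr) :=
  Algebra.TensorProduct.map (AlgHom.id A A) (incl gr)

/-- The `A`-linear extension of the derivation `s`. -/
noncomputable def sB (h : IsGrading gr) :
    A ⊗[ℝ] FreeGC (cycGr gr) →ₗ[A] A ⊗[ℝ] FreeGC (cycGr gr) := LinearMap.baseChange A (sDer h)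

variable {A}

theorem inclB_tmul (a : A) (x : FreeGC gr) : inclB gr A (a ⊗ₜ x) = a ⊗ₜ incl gr x := by
  rw [inclB, Algebra.TensorProduct.map_tmul]
  rfl

theorem inclB_deg {n : ℕ} {x : A ⊗[ℝ] FreeGC gr} (hx : x ∈ (deg gr n).baseChange A) :
    inclB gr A x ∈ (deg (cycGr gr) n).baseChange A := by
  refine map_deg (fun n v hv => ?_) hx
  rw [inclB_tmul, incl_ι]
  exact Submodule.tmul_mem_baseChange_of_mem 1 (ι_mem_deg (inV_mem hv))

theorem sB_mul (h : IsGrading gr) (x y : A ⊗[ℝ] FreeGC (cycGr gr)) :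
    sB A h (x * y) = sB A h x * y + parA A (cycGr_grading h) x * sB A h y :=
  baseChange_leibniz _ _ (sDer_mul h) x y

theorem sB_tmul (h : IsGrading gr) (a : A) (x : FreeGC (cycGr gr)) :
    sB A h (a ⊗ₜ x) = a ⊗ₜ sDer h x := rfl

theorem sB_deg (h : IsGrading gr) {n : ℕ} {x : A ⊗[ℝ] FreeGC (cycGr gr)}
    (hx : x ∈ (deg (cycGr gr) (n + 1)).baseChange A) :
    sB A h x ∈ (deg (cycGr gr) n).baseChange A :=
  baseChange_mem_baseChange (q := deg (cycGr gr) n) (sDer h) (fun _ hx => sDer_deg h hx) hx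

/-- Since V[1] is V / V¹, this makes sv ↦ t · s(gv) well defined: g preserves degree one. -/
theorem sB_inclB_deg_one (h : IsGrading gr) {x : A ⊗[ℝ] FreeGC gr}
    (hx : x ∈ (deg gr 1).baseChange A) : sB A h (inclB gr A x) = 0 := by
  have h1 : (sDer h ∘ₗ (incl gr).toLinearMap).baseChange A x ∈
      (⊥ : Submodule ℝ (FreeGC (cycGr gr))).baseChange A := by
    refine baseChange_mem_baseChange _ (fun y hy => ?_) hx
    obtain ⟨v, hv, rfl⟩ := (mem_deg_zero_or_one h.zero hy).2 rfl
    rw [Submodule.mem_comap, LinearMap.comp_apply, AlgHom.toLinearMap_apply, incl_ι, sDer_inV,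
      inS_eq_zero hv, map_zero]
    exact Submodule.zero_mem _
  rw [Submodule.baseChange_bot, Submodule.mem_bot, LinearMap.baseChange_comp] at h1
  exact h1

theorem inclB_injective (h : IsGrading gr) : Function.Injective (inclB gr A) := by
  refine Function.LeftInverse.injective
    (g := Algebra.TensorProduct.map (AlgHom.id A A) (retr gr)) fun x => ?_
  induction x using TensorProduct.induction_on with
  | zero => simp
  | add a b ha hb => rw [map_add, map_add, ha, hb]
  | tmul a x =>
    rw [inclB_tmul, Algebra.TensorProduct.map_tmul, retr_incl h]
    rfl

end Cyc

namespace MinimalSullivanAlgebra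

variable {V : Type u} [AddCommGroup V] [Module ℝ V] (M : MinimalSullivanAlgebra V)
variable {A : Type} [CommRing A] [Algebra ℝ A]

theorem baseChange_cycD_inclB (x : A ⊗[ℝ] M.S) : M.cycD.baseChange A (inclB M.gr A x) =
    inclB M.gr A (M.d.baseChange A x) +
      sB A M.grading (inclB M.gr A x) * 1 ⊗ₜ ι _ (genW M.gr) := by
  induction x using TensorProduct.induction_on with
  | zero => simp
  | add a b ha hb => simp only [map_add, ha, hb, add_mul]; abel
  | tmul a x =>
    rw [inclB_tmul, LinearMap.baseChange_tmul, LinearMap.baseChange_tmul, inclB_tmul, cycD_incl,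
      sB_tmul, Algebra.TensorProduct.tmul_mul_tmul, mul_one, TensorProduct.tmul_add]

theorem baseChange_cycD_sB_inclB (x : A ⊗[ℝ] M.S) :
    M.cycD.baseChange A (sB A M.grading (inclB M.gr A x)) =
      - sB A M.grading (inclB M.gr A (M.d.baseChange A x)) := by
  induction x using TensorProduct.induction_on with
  | zero => simp
  | add a b ha hb => simp only [map_add, ha, hb]; abel
  | tmul a x =>
    rw [inclB_tmul, LinearMap.baseChange_tmul, inclB_tmul, sB_tmul, sB_tmul,
      LinearMap.baseChange_tmul, ← TensorProduct.tmul_neg]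
    have h := M.cycD_sDer (incl M.gr x)
    rw [cycD_incl, map_add, sDer_mul, sDer_sDer, sDer_genW, zero_mul, mul_zero, add_zero,
      add_zero] at h
    rw [eq_neg_of_add_eq_zero_left h]

/-! ### Automorphisms of the cyclification -/

variable {M}

/-- The restriction of an automorphism to the generators. -/
def autGen (g : M.Aut A) : V →ₗ[ℝ] A ⊗[ℝ] M.S :=
  (g.1.toLinearMap.restrictScalars ℝ) ∘ₗ TensorProduct.mk ℝ A M.S 1 ∘ₗ ι M.gr

theorem autGen_apply (g : M.Aut A) (v : V) : autGen g v = g.1 (1 ⊗ₜ ι M.gr v) := rfl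

theorem autGen_deg (g : M.Aut A) {n : ℕ} {v : V} (hv : v ∈ M.gr n) :
    autGen g v ∈ (deg M.gr n).baseChange A :=
  (g.2.1 n _).2 (Submodule.tmul_mem_baseChange_of_mem 1 (ι_mem_deg hv))

/-- The values of the automorphism given by `(g, t)` on generators. -/
noncomputable def cycAutGen (g : M.Aut A) (t : Aˣ) :
    CycSpace M.gr →ₗ[ℝ] A ⊗[ℝ] FreeGC (cycGr M.gr) :=
  LinearMap.coprod (((inclB M.gr A).toLinearMap.restrictScalars ℝ) ∘ₗ autGen g)
    (LinearMap.coprod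
      ((M.gr 1).liftQ ((((t : A) • sB A M.grading ∘ₗ (inclB M.gr A).toLinearMap).restrictScalars ℝ)
        ∘ₗ autGen g) fun v hv => by
          change (t : A) • sB A M.grading (inclB M.gr A (autGen g v)) = 0
          rw [sB_inclB_deg_one M.grading (autGen_deg g hv), smul_zero])
      (LinearMap.toSpanSingleton ℝ _ (((t⁻¹ : Aˣ) : A) ⊗ₜ ι _ (genW M.gr))))

theorem cycAutGen_inV (g : M.Aut A) (t : Aˣ) (v : V) :
    cycAutGen g t (inV M.gr v) = inclB M.gr A (autGen g v) := by
  rw [cycAutGen, inV, LinearMap.coprod_apply, LinearMap.inl_apply, map_zero, add_zero]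
  rfl

theorem cycAutGen_inS (g : M.Aut A) (t : Aˣ) (v : V) :
    cycAutGen g t (inS M.gr v) = (t : A) • sB A M.grading (inclB M.gr A (autGen g v)) := by
  have : cycAutGen g t (inS M.gr v) = cycAutGen g t (0, (M.gr 1).mkQ v, 0) := rfl
  rw [this, cycAutGen, LinearMap.coprod_apply, LinearMap.coprod_apply, map_zero, zero_add,
    map_zero, add_zero]
  rfl

theorem cycAutGen_genW (g : M.Aut A) (t : Aˣ) :
    cycAutGen g t (genW M.gr) = ((t⁻¹ : Aˣ) : A) ⊗ₜ ι _ (genW M.gr) := by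
  rw [cycAutGen, genW, LinearMap.coprod_apply, LinearMap.coprod_apply, map_zero, map_zero,
    zero_add, zero_add, LinearMap.toSpanSingleton_apply, one_smul]

theorem cycAutGen_deg (g : M.Aut A) (t : Aˣ) {n : ℕ} {x : CycSpace M.gr} (hx : x ∈ cycGr M.gr n) :
    cycAutGen g t x ∈ (deg (cycGr M.gr) n).baseChange A := by
  obtain ⟨v, u, c⟩ := x
  obtain ⟨hv, ⟨u, hu, rfl⟩, hc⟩ := hx
  have hdec : ((v, (M.gr 1).mkQ u, c) : CycSpace M.gr) =
      inV M.gr v + inS M.gr u + c • genW M.gr := by simp [inV, inS, genW]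
  rw [hdec, map_add, map_add, map_smul, cycAutGen_genW, cycAutGen_inV, cycAutGen_inS]
  refine Submodule.add_mem _ (Submodule.add_mem _ (inclB_deg (autGen_deg g hv)) ?_) ?_
  · exact Submodule.smul_mem _ _ (sB_deg M.grading (inclB_deg (autGen_deg g hu)))
  · by_cases hn : n = 2
    · subst hn
      rw [← TensorProduct.tmul_smul]
      exact Submodule.tmul_mem_baseChange_of_mem _ (Submodule.smul_mem _ _ (ι_mem_deg genW_mem))
    · rw [if_neg hn] at hc
      rw [show c = 0 from hc, zero_smul]
      exact Submodule.zero_mem _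

/-- The endomorphism of `A ⊗ S(V ⊕ V[1] ⊕ ℝ w)` given by `(g, t)`. -/
noncomputable def cycEnd (g : M.Aut A) (t : Aˣ) :
    A ⊗[ℝ] FreeGC (cycGr M.gr) →ₐ[A] A ⊗[ℝ] FreeGC (cycGr M.gr) :=
  Algebra.TensorProduct.lift (Algebra.ofId A _)
    (lift (cycAutGen g t) fun _ _ _ _ hx hy =>
      comm_baseChange_deg (cycAutGen_deg g t hx) (cycAutGen_deg g t hy))
    fun a _ => Algebra.commutes a _

theorem cycEnd_ι (g : M.Aut A) (t : Aˣ) (x : CycSpace M.gr) :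
    cycEnd g t (1 ⊗ₜ ι _ x) = cycAutGen g t x := by
  refine (Algebra.TensorProduct.lift_tmul _ _ _ _ _).trans ?_
  rw [map_one, one_mul, lift_ι]

theorem cycEnd_ι_deg (g : M.Aut A) (t : Aˣ) (n : ℕ) (x : CycSpace M.gr) (hx : x ∈ cycGr M.gr n) :
    cycEnd g t (1 ⊗ₜ ι _ x) ∈ (deg (cycGr M.gr) n).baseChange A := by
  rw [cycEnd_ι]
  exact cycAutGen_deg g t hx

theorem cycEnd_inclB (g : M.Aut A) (t : Aˣ) (x : A ⊗[ℝ] M.S) :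
    cycEnd g t (inclB M.gr A x) = inclB M.gr A (g.1 x) := by
  have : (cycEnd g t).comp (inclB M.gr A) = (inclB M.gr A).comp (g.1 : _ →ₐ[A] _) := by
    refine baseChange_algHom_ext M.grading fun n v _ => ?_
    rw [AlgHom.comp_apply, AlgHom.comp_apply, inclB_tmul, incl_ι, cycEnd_ι, cycAutGen_inV]
    rfl
  exact DFunLike.congr_fun this x

theorem cycEnd_genW (g : M.Aut A) (t : Aˣ) :
    cycEnd g t (1 ⊗ₜ ι _ (genW M.gr)) = ((t⁻¹ : Aˣ) : A) • 1 ⊗ₜ ι _ (genW M.gr) := by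
  rw [cycEnd_ι, cycAutGen_genW, TensorProduct.smul_tmul', smul_eq_mul, mul_one]

/-- Both sides are odd derivations on A ⊗ S(V) along g, twisted by parity, and they agree on
generators by construction; hence they agree on the nonlinear elements g(dv) too. -/
theorem cycEnd_sB_inclB (g : M.Aut A) (t : Aˣ) (x : A ⊗[ℝ] M.S) :
    cycEnd g t (sB A M.grading (inclB M.gr A x)) =
      (t : A) • sB A M.grading (inclB M.gr A (g.1 x)) := by
  have hg : ∀ x, (g.1 (parA A M.grading x)) = parA A M.grading (g.1 x) :=
    map_parA (f := (g.1 : _ →ₐ[A] _)) M.grading M.grading fun n v hv => autGen_deg g hv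
  have hi : ∀ x, inclB M.gr A (parA A M.grading x) =
      parA A (cycGr_grading M.grading) (inclB M.gr A x) :=
    map_parA M.grading (cycGr_grading M.grading) fun n v hv =>
      inclB_deg (Submodule.tmul_mem_baseChange_of_mem 1 (ι_mem_deg hv))
  have key := baseChange_eq_zero_of_ι M.grading
    (E := (cycEnd g t).toLinearMap ∘ₗ sB A M.grading ∘ₗ (inclB M.gr A).toLinearMap -
      (t : A) • sB A M.grading ∘ₗ (inclB M.gr A).toLinearMap ∘ₗ g.1.toLinearMap)
    (f := fun y => inclB M.gr A (g.1 y)) (g := fun x => inclB M.gr A (g.1 (parA A M.grading x)))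
    ?_ ?_ ?_ x
  · exact sub_eq_zero.1 key
  · have h1 : sB A M.grading 1 = 0 := by simpa using sB_mul M.grading (1 : A ⊗[ℝ] _) 1
    simp [h1]
  · intro n v _
    change cycEnd g t (sB A M.grading (inclB M.gr A (1 ⊗ₜ ι M.gr v))) -
      (t : A) • sB A M.grading (inclB M.gr A (autGen g v)) = 0
    rw [inclB_tmul, incl_ι, sB_tmul, sDer_inV, cycEnd_ι, cycAutGen_inS, sub_self]
  · intro x y
    simp only [LinearMap.sub_apply, LinearMap.smul_apply, LinearMap.comp_apply,
      AlgHom.toLinearMap_apply, AlgEquiv.toLinearMap_apply, map_mul, sB_mul, map_add, ← hi,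
      cycEnd_inclB, hg, smul_add, sub_mul, mul_sub, smul_mul_assoc, mul_smul_comm]
    abel

/-- Generators of the cyclification up to scalars and sums. -/
theorem cycSpace_induction {p : CycSpace M.gr → Prop} (hV : ∀ v, p (inV M.gr v))
    (hS : ∀ v, p (inS M.gr v)) (hW : p (genW M.gr)) (add : ∀ x y, p x → p y → p (x + y))
    (smul : ∀ (c : ℝ) x, p x → p (c • x)) (x : CycSpace M.gr) : p x := by
  obtain ⟨v, u, c, rfl⟩ := cyc_decomp x
  exact add _ _ (add _ _ (hV v) (hS u)) (smul c _ hW)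

/-- The commutator with d_c is a twisted derivation, so the generators suffice. There the claim
reduces to the compatibility of g with d and of the endomorphism with s. -/
theorem cycEnd_cycD (g : M.Aut A) (t : Aˣ) (x : A ⊗[ℝ] FreeGC (cycGr M.gr)) :
    cycEnd g t (M.cycD.baseChange A x) = M.cycD.baseChange A (cycEnd g t x) := by
  have hd : ∀ x, g.1 (M.d.baseChange A x) = M.d.baseChange A (g.1 x) := g.2.2
  have hi := cycGr_grading M.grading
  have hp : ∀ x, cycEnd g t (parA A hi x) = parA A hi (cycEnd g t x) :=
    map_parA hi hi (cycEnd_ι_deg g t)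
  have hD : ∀ x y : A ⊗[ℝ] FreeGC (cycGr M.gr), M.cycD.baseChange A (x * y) =
      M.cycD.baseChange A x * y + parA A hi x * M.cycD.baseChange A y :=
    baseChange_leibniz _ _ M.cycD_mul
  let E := (cycEnd g t).toLinearMap ∘ₗ M.cycD.baseChange A -
      M.cycD.baseChange A ∘ₗ (cycEnd g t).toLinearMap
  have hE : ∀ x, E x = cycEnd g t (M.cycD.baseChange A x) -
    M.cycD.baseChange A (cycEnd g t x) := fun _ => rfl
  have key := baseChange_eq_zero_of_ι hi (E := E)
    (f := fun y => cycEnd g t y) (g := fun x => cycEnd g t (parA A hi x)) ?_ ?_ ?_ x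
  · exact sub_eq_zero.1 key
  · have h1 : M.cycD.baseChange A 1 = 0 := by simpa using hD 1 1
    simp [hE, h1]
  · rintro - y -
    induction y using cycSpace_induction with
    | hV v =>
      rw [hE, sub_eq_zero, cycEnd_ι, cycAutGen_inV, baseChange_cycD_inclB, autGen_apply, ← hd,
        ← cycEnd_inclB, LinearMap.baseChange_tmul, LinearMap.baseChange_tmul, cycD_ι, cycGen_inV,
        TensorProduct.tmul_add, map_add, inclB_tmul]
      have h1 : (1 : A) ⊗ₜ[ℝ] (ι (cycGr M.gr) (inS M.gr v) * ι _ (genW M.gr)) =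
          (1 ⊗ₜ ι _ (inS M.gr v)) * (1 ⊗ₜ ι _ (genW M.gr)) := by
        rw [Algebra.TensorProduct.tmul_mul_tmul, one_mul]
      -- The scalars t on sv and t⁻¹ on w cancel, which forces the weight of w.
      rw [h1, map_mul, cycEnd_genW, cycEnd_ι, cycAutGen_inS, smul_mul_smul_comm, Units.mul_inv,
        one_smul]
      rfl
    | hS v =>
      rw [hE, sub_eq_zero, cycEnd_ι, cycAutGen_inS, map_smul, baseChange_cycD_sB_inclB,
        autGen_apply, ← hd, LinearMap.baseChange_tmul, LinearMap.baseChange_tmul, cycD_ι,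
        cycGen_inS, TensorProduct.tmul_neg, map_neg, smul_neg, ← cycEnd_sB_inclB, inclB_tmul,
        sB_tmul]
    | hW =>
      rw [hE, cycEnd_genW, map_smul, LinearMap.baseChange_tmul, cycD_ι, cycGen_genW,
        TensorProduct.tmul_zero, map_zero, smul_zero, sub_zero]
    | add x y hx hy => rw [map_add, TensorProduct.tmul_add, map_add, hx, hy, add_zero]
    | smul c x hx =>
      rw [map_smul, TensorProduct.tmul_smul]
      exact (map_smul (E.restrictScalars ℝ) c _).trans ((congrArg (c • ·) hx).trans (smul_zero c))
  · intro x y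
    simp only [hE, map_mul, hD, map_add, hp, sub_mul, mul_sub]
    abel

theorem cycEnd_ext {f f' : A ⊗[ℝ] FreeGC (cycGr M.gr) →ₐ[A] A ⊗[ℝ] FreeGC (cycGr M.gr)}
    (hV : ∀ v, f (1 ⊗ₜ ι _ (inV M.gr v)) = f' (1 ⊗ₜ ι _ (inV M.gr v)))
    (hS : ∀ v, f (1 ⊗ₜ ι _ (inS M.gr v)) = f' (1 ⊗ₜ ι _ (inS M.gr v)))
    (hW : f (1 ⊗ₜ ι _ (genW M.gr)) = f' (1 ⊗ₜ ι _ (genW M.gr))) : f = f' := by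
  refine baseChange_algHom_ext (cycGr_grading M.grading) fun _ x h => ?_
  clear h
  induction x using cycSpace_induction with
  | hV v => exact hV v
  | hS v => exact hS v
  | hW => exact hW
  | add x y hx hy => rw [map_add, TensorProduct.tmul_add, map_add, map_add, hx, hy]
  | smul c x hx =>
    rw [map_smul, TensorProduct.tmul_smul]
    exact (map_smul (f.toLinearMap.restrictScalars ℝ) c _).trans ((congrArg (c • ·) hx).trans
      (map_smul (f'.toLinearMap.restrictScalars ℝ) c _).symm)

theorem cycEnd_inS (g : M.Aut A) (t : Aˣ) (v : V) : cycEnd g t (1 ⊗ₜ ι _ (inS M.gr v)) =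
    (t : A) • sB A M.grading (inclB M.gr A (g.1 (1 ⊗ₜ ι M.gr v))) := by
  rw [cycEnd_ι, cycAutGen_inS, autGen_apply]

theorem cycEnd_inV (g : M.Aut A) (t : Aˣ) (v : V) : cycEnd g t (1 ⊗ₜ ι _ (inV M.gr v)) =
    inclB M.gr A (g.1 (1 ⊗ₜ ι M.gr v)) := by
  rw [cycEnd_ι, cycAutGen_inV, autGen_apply]

theorem cycEnd_mul (g g' : M.Aut A) (t t' : Aˣ) :
    cycEnd (g * g') (t * t') = (cycEnd g t).comp (cycEnd g' t') := by
  refine cycEnd_ext (fun v => ?_) (fun v => ?_) ?_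
  · rw [AlgHom.comp_apply, cycEnd_inV, cycEnd_inV, cycEnd_inclB]
    rfl
  · rw [AlgHom.comp_apply, cycEnd_inS, cycEnd_inS, map_smul, cycEnd_sB_inclB, smul_smul,
      Units.val_mul, mul_comm (t : A)]
    rfl
  · rw [AlgHom.comp_apply, cycEnd_genW, cycEnd_genW, map_smul, cycEnd_genW, smul_smul, mul_inv,
      Units.val_mul, mul_comm]

theorem cycEnd_one : cycEnd (1 : M.Aut A) (1 : Aˣ) = AlgHom.id A _ := by
  refine cycEnd_ext (fun v => ?_) (fun v => ?_) ?_
  · rw [cycEnd_inV]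
    change inclB M.gr A (1 ⊗ₜ ι M.gr v) = _
    rw [inclB_tmul, incl_ι]
    rfl
  · rw [cycEnd_inS]
    change ((1 : Aˣ) : A) • sB A M.grading (inclB M.gr A (1 ⊗ₜ ι M.gr v)) = _
    rw [inclB_tmul, incl_ι, sB_tmul, sDer_inV, Units.val_one, one_smul]
    rfl
  · rw [cycEnd_genW, inv_one, Units.val_one, one_smul]
    rfl

/-- The automorphism of `A ⊗ S(V ⊕ V[1] ⊕ ℝ w)` given by `(g, t)`. -/
noncomputable def cycEquiv (g : M.Aut A) (t : Aˣ) :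
    (A ⊗[ℝ] FreeGC (cycGr M.gr)) ≃ₐ[A] (A ⊗[ℝ] FreeGC (cycGr M.gr)) :=
  AlgEquiv.ofAlgHom (cycEnd g t) (cycEnd g⁻¹ t⁻¹)
    (by rw [← cycEnd_mul, mul_inv_cancel, mul_inv_cancel, cycEnd_one])
    (by rw [← cycEnd_mul, inv_mul_cancel, inv_mul_cancel, cycEnd_one])

/-- The natural inclusion `Aut M × 𝔾_m ⊆ Aut M_c`. -/
noncomputable def cycAut (M : MinimalSullivanAlgebra V) (A : Type) [CommRing A] [Algebra ℝ A] :
    M.Aut A × Aˣ →* M.cyclification.Aut A where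
  toFun x := ⟨cycEquiv x.1 x.2, fun n y => by
    refine ⟨fun hy => ?_, fun hy => map_deg (cycEnd_ι_deg x.1 x.2) hy⟩
    -- Degrees are also reflected, because the inverse is an endomorphism of the same form.
    have h := map_deg (cycEnd_ι_deg x.1⁻¹ x.2⁻¹) hy
    have h1 : cycEnd x.1⁻¹ x.2⁻¹ (cycEquiv x.1 x.2 y) = y :=
      (cycEquiv x.1 x.2).symm_apply_apply y
    exact h1 ▸ h, cycEnd_cycD x.1 x.2⟩
  map_one' := Subtype.ext (AlgEquiv.ext fun y => DFunLike.congr_fun cycEnd_one y)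
  map_mul' x y := Subtype.ext (AlgEquiv.ext fun z =>
    DFunLike.congr_fun (cycEnd_mul x.1 y.1 x.2 y.2) z)

end MinimalSullivanAlgebra

/-! ### Naturality and injectivity of the inclusion, and the torus T × 𝔾_m -/

namespace MinimalSullivanAlgebra

variable {V : Type u} [AddCommGroup V] [Module ℝ V] {M : MinimalSullivanAlgebra V}

section Natural

variable {A B : Type} [CommRing A] [Algebra ℝ A] [CommRing B] [Algebra ℝ B]

theorem map_smul_scalar {S : Type*} [Ring S] [Algebra ℝ S] (f : A →ₐ[ℝ] B) (a : A)
    (x : A ⊗[ℝ] S) : Algebra.TensorProduct.map f (AlgHom.id ℝ S) (a • x) =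
      f a • Algebra.TensorProduct.map f (AlgHom.id ℝ S) x := by
  induction x using TensorProduct.induction_on with
  | zero => simp
  | add x y hx hy => rw [smul_add, map_add, map_add, smul_add, hx, hy]
  | tmul b x => simp [TensorProduct.smul_tmul']

theorem map_sB_inclB (f : A →ₐ[ℝ] B) (x : A ⊗[ℝ] M.S) :
    Algebra.TensorProduct.map f (AlgHom.id ℝ _) (sB A M.grading (inclB M.gr A x)) =
      sB B M.grading (inclB M.gr B (Algebra.TensorProduct.map f (AlgHom.id ℝ _) x)) := by
  induction x using TensorProduct.induction_on with
  | zero => simp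
  | add x y hx hy => simp only [map_add, hx, hy]
  | tmul b x =>
    rw [inclB_tmul, sB_tmul, Algebra.TensorProduct.map_tmul, Algebra.TensorProduct.map_tmul,
      inclB_tmul, sB_tmul]
    rfl

theorem map_inclB (f : A →ₐ[ℝ] B) (x : A ⊗[ℝ] M.S) :
    Algebra.TensorProduct.map f (AlgHom.id ℝ _) (inclB M.gr A x) =
      inclB M.gr B (Algebra.TensorProduct.map f (AlgHom.id ℝ _) x) := by
  induction x using TensorProduct.induction_on with
  | zero => simp
  | add x y hx hy => simp only [map_add, hx, hy]
  | tmul b x =>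
    rw [inclB_tmul, Algebra.TensorProduct.map_tmul, Algebra.TensorProduct.map_tmul, inclB_tmul]
    rfl

theorem map_cycEnd (f : A →ₐ[ℝ] B) {g : M.Aut A} {g' : M.Aut B} (t : Aˣ)
    (h : M.IsBaseChange f g g') (x : A ⊗[ℝ] FreeGC (cycGr M.gr)) :
    Algebra.TensorProduct.map f (AlgHom.id ℝ _) (cycEnd g t x) =
      cycEnd g' (Units.map f t) (Algebra.TensorProduct.map f (AlgHom.id ℝ _) x) := by
  have hgen : ∀ y : CycSpace M.gr,
      Algebra.TensorProduct.map f (AlgHom.id ℝ _) (cycEnd g t (1 ⊗ₜ ι _ y)) =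
        cycEnd g' (Units.map f t) (1 ⊗ₜ ι _ y) := by
    have h1 : ∀ v, Algebra.TensorProduct.map f (AlgHom.id ℝ M.S) (g.1 (1 ⊗ₜ ι M.gr v)) =
        g'.1 (1 ⊗ₜ ι M.gr v) := fun v => by
      rw [h, Algebra.TensorProduct.map_tmul, map_one]
      rfl
    intro y
    induction y using cycSpace_induction with
    | hV v => rw [cycEnd_inV, cycEnd_inV, map_inclB, h1]
    | hS v =>
      rw [cycEnd_inS, cycEnd_inS, map_smul_scalar, map_sB_inclB, h1]
      rfl
    | hW =>
      rw [cycEnd_genW, cycEnd_genW, map_smul_scalar, Algebra.TensorProduct.map_tmul, map_one,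
        ← map_inv]
      rfl
    | add x y hx hy =>
      rw [map_add, TensorProduct.tmul_add, TensorProduct.tmul_add, map_add, map_add, hx, hy,
        map_add]
    | smul c x hx =>
      have hA : (1 : A) ⊗ₜ[ℝ] ι (cycGr M.gr) (c • x) = algebraMap ℝ A c • 1 ⊗ₜ ι _ x := by
        rw [map_smul, TensorProduct.tmul_smul, algebraMap_smul]
      have hB : (1 : B) ⊗ₜ[ℝ] ι (cycGr M.gr) (c • x) = algebraMap ℝ B c • 1 ⊗ₜ ι _ x := by
        rw [map_smul, TensorProduct.tmul_smul, algebraMap_smul]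
      rw [hA, hB, map_smul, map_smul_scalar, map_smul, hx, AlgHom.commutes]
  induction x using baseChange_induction (cycGr_grading M.grading) with
  | one => simp
  | ι_mul n v _ y hy =>
    rw [map_mul, map_mul, hy, hgen, map_mul, map_mul, Algebra.TensorProduct.map_tmul, map_one]
    rfl
  | add x y hx hy => simp only [map_add, hx, hy]
  | smul a x hx => rw [map_smul, map_smul_scalar, hx, map_smul_scalar, map_smul]

end Natural

theorem ι_genW_ne_zero : ι (cycGr M.gr) (genW M.gr) ≠ 0 := by
  intro h
  have h1 : genW M.gr = 0 := ι_injective (by rw [h, map_zero])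
  have h2 : (1 : ℝ) = 0 := congrArg (fun x : CycSpace M.gr => x.2.2) h1
  exact one_ne_zero h2

/-- The restriction to A ⊗ S(V) recovers g, and the eigenvalue on w recovers t. -/
theorem cycAut_injective (A : Type) [CommRing A] [Algebra ℝ A] :
    Function.Injective (M.cycAut A) := by
  rintro ⟨g, t⟩ ⟨g', t'⟩ h
  have h1 : ∀ x, cycEnd g t x = cycEnd g' t' x := fun x =>
    DFunLike.congr_fun (congrArg Subtype.val h) x
  have hg : g = g' := Subtype.ext (AlgEquiv.ext fun x => inclB_injective M.grading (by
    rw [← cycEnd_inclB g t, ← cycEnd_inclB g' t', h1]))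
  have ht : t⁻¹ = t'⁻¹ := by
    have h2 := h1 (1 ⊗ₜ ι _ (genW M.gr))
    rw [cycEnd_genW, cycEnd_genW, ← sub_eq_zero, ← sub_smul, TensorProduct.smul_tmul',
      smul_eq_mul, mul_one] at h2
    exact Units.ext (sub_eq_zero.1 (eq_zero_of_tmul_eq_zero h2 ι_genW_ne_zero))
  rw [hg, inv_injective ht]

theorem cycAut_isNaturalInclusion : M.IsNaturalInclusion fun A _ _ => M.cycAut A where
  injective A _ _ := cycAut_injective A
  natural _ _ _ _ _ _ f _ _ t h := map_cycEnd f t h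
  map_v _ _ _ g t v := cycEnd_inV g t v
  map_sv _ _ _ g t v := cycEnd_inS g t v
  map_w _ _ _ g t := cycEnd_genW g t

section Product

variable {T : M.SubgroupFamily} {n : ℕ} (P : TorusParam T n)
  (j : ∀ (A : Type) [CommRing A] [Algebra ℝ A], M.Aut A × Aˣ →* M.cyclification.Aut A)
  (A : Type) [CommRing A] [Algebra ℝ A]

/-- The parametrization of `T × 𝔾_m` by `𝔾_mⁿ⁺¹`. -/
def prodGmPoint (t : Fin (n + 1) → Aˣ) : M.Aut A × Aˣ := ((P.toEquiv A fun i => t i.succ).1, t 0)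

theorem prodGmPoint_mul (s t : Fin (n + 1) → Aˣ) :
    prodGmPoint P A (s * t) = prodGmPoint P A s * prodGmPoint P A t := by
  refine Prod.ext ?_ rfl
  have h := map_mul (P.toEquiv A) (fun i => s i.succ) (fun i => t i.succ)
  exact congrArg Subtype.val h

theorem prodGmPoint_injective : Function.Injective (prodGmPoint P A) := by
  intro s t h
  have h2 := (P.toEquiv A).injective (Subtype.ext (congrArg Prod.fst h))
  have h3 : s 0 = t 0 := congrArg Prod.snd h
  exact funext (Fin.cases h3 (congrFun h2))

theorem prodGmPoint_mem (t : Fin (n + 1) → Aˣ) : j A (prodGmPoint P A t) ∈ M.prodGm j T A :=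
  Subgroup.mem_map_of_mem _ ⟨(P.toEquiv A fun i => t i.succ).2, Subgroup.mem_top _⟩

theorem exists_prodGmPoint {x : M.cyclification.Aut A} (hx : x ∈ M.prodGm j T A) :
    ∃ t, j A (prodGmPoint P A t) = x := by
  obtain ⟨⟨g, t⟩, ⟨hg, -⟩, rfl⟩ := hx
  obtain ⟨s, hs⟩ := (P.toEquiv A).surjective ⟨g, hg⟩
  -- Coordinate 0 is the extra factor 𝔾_m; the others parametrize T.
  refine ⟨Fin.cons t s, congrArg (j A) (Prod.ext ?_ rfl)⟩
  exact congrArg Subtype.val hs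

/-- The isomorphism of `𝔾_mⁿ⁺¹` with the image of `T × 𝔾_m`. -/
noncomputable def prodGmEquiv (hj : Function.Injective (j A)) :
    (Fin (n + 1) → Aˣ) ≃* M.prodGm j T A :=
  MulEquiv.mk (Equiv.ofBijective (fun t => ⟨j A (prodGmPoint P A t), prodGmPoint_mem P j A t⟩)
    ⟨fun _ _ h => prodGmPoint_injective P A (hj (congrArg Subtype.val h)), fun x =>
      (exists_prodGmPoint P j A x.2).imp fun _ h => Subtype.ext h⟩)
    fun s t => Subtype.ext ((congrArg (j A) (prodGmPoint_mul P A s t)).trans (map_mul (j A) _ _))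

end Product

/-- If `T` is a split torus, then so is `T × 𝔾_m`. -/
theorem IsSplitTorus.prodGm {T : M.SubgroupFamily} {n : ℕ} (hT : IsSplitTorus T n)
    {j : ∀ (A : Type) [CommRing A] [Algebra ℝ A], M.Aut A × Aˣ →* M.cyclification.Aut A}
    (hj : M.IsNaturalInclusion j) : IsSplitTorus (M.prodGm j T) (n + 1) := by
  obtain ⟨P⟩ := hT.nonempty_param
  refine ⟨fun A _ _ => prodGmEquiv P j A (hj.injective A), fun A B _ _ _ _ f t => ?_⟩
  exact hj.natural A B f (P.toEquiv A fun i => t i.succ).1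
    (P.toEquiv B fun i => Units.map f (t i.succ)).1 (t 0) (P.natural A B f fun i => t i.succ)

end MinimalSullivanAlgebra

end Sullivan

/-! ### The main theorem -/

theorem mainTheorem3 {V : Type*} [AddCommGroup V] [Module ℝ V] [FiniteDimensional ℝ V]
    (M : Sullivan.MinimalSullivanAlgebra V) (hM : M.IsQuadratic)
    (T : M.SubgroupFamily) (n : ℕ) (hT : Sullivan.MinimalSullivanAlgebra.IsSplitTorus T n)
    (hn : Module.rank ℝ M.P = n) :
    Sullivan.MinimalSullivanAlgebra.IsMaximalSplitTorus T ∧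
    Module.rank ℝ M.cyclification.closedGen = Module.rank ℝ M.closedGen + 1 ∧
    Module.rank ℝ M.cyclification.P = Module.rank ℝ M.P + 1 ∧
    ∃ j : ∀ (A : Type) [CommRing A] [Algebra ℝ A], M.Aut A × Aˣ →* M.cyclification.Aut A,
      M.IsNaturalInclusion j ∧
      Sullivan.MinimalSullivanAlgebra.IsSplitTorus (M.prodGm j T) (n + 1) ∧
      Sullivan.MinimalSullivanAlgebra.IsMaximalSplitTorus (M.prodGm j T) := by
  have hP : Module.rank ℝ M.cyclification.P = Module.rank ℝ M.P + 1 := by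
    rw [hM.cyclification.rank_P, hM.rank_closedGen_cyclification, hM.rank_P]
  have hj := M.cycAut_isNaturalInclusion
  have hjT := hT.prodGm hj
  -- The same criterion serves twice: for T in `Aut M`, and for T × 𝔾_m in `Aut M_c`, whose
  -- dimension n + 1 is dim P(M_c).
  exact ⟨hT.isMaximal hn, hM.rank_closedGen_cyclification, hP, _, hj, hjT,
    hjT.isMaximal (by rw [hP, hn, Nat.cast_add, Nat.cast_one])⟩
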